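/- Let $(\mathbb S,\mathscr F,\{\mathscr F_t\}_{t\ge 0},\mathbb P)$ be a filtered probability space carrying a standard one-dimensional $\{\mathscr F_t\}$-Brownian motion $W$, and let $r>0$ (riskless rate), $\delta>0$ (dividend yield), $\sigma>0$ (volatility), $K>0$ (principal), $\gamma\in\mathbb R$ (loan rate), $T>0$ (maturity) be constants. For a state $(S,I)$ at time $t$ and $u\ge t$ let $$S_u=S\exp\Big(\big(r-\delta-\tfrac{\sigma^2}{2}\big)(u-t)+\sigma(W_u-W_t)\Big),\qquad I_u=Ie^{r(u-t)}+\int_t^u\delta e^{r(u-w)}S_w\,dw$$ be the stock price and the accumulated cash dividends, which are paid to the borrower on redemption. Let $\mathcal T_{[t,T]}$ be the set of $\{\mathscr F_s\}$-stopping times with values in $[t,T]$, let $$V_4(S,I,t)=\sup_{v\in\mathcal T_{[t,T]}}\mathbb E\Big[e^{-r(v-t)}\big(S_v+I_v-Ke^{\gamma v}\big)^+\Big]$$ be the value of the stock loan, let $\Omega=(0,\infty)\times(0,\infty)\times[0,T)$, and let $$E_4=\{(S,I,t)\in\Omega: V_4(S,I,t)=S+I-Ke^{\gamma t}\}$$ be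 the redemption region. For $S>0$, $I\ge 0$, $0\le t\le T$ the discounted payoff of every $v\in\mathcal T_{[t,T]}$ is integrable, and the supremum is finite. Moreover: (i) If $r>\gamma$, then $E_4=\emptyset$, and early redemption is never optimal: for all $S>0$, $I\ge0$, $0\le t<T$ the stopping time $v=T$ attains the supremum, and every $v\in\mathcal T_{[t,T]}$ with $\mathbb P(v<T)>0$ satisfies $\mathbb E[e^{-r(v-t)}(S_v+I_v-Ke^{\gamma v})^+]<V_4(S,I,t)$. (ii) If $r=\gamma$, then for all $S>0$, $I\ge0$, $0\le t<T$ it is optimal to hold the loan to expiry: $v=T$ attains the supremum. (iii) If $r\ge\gamma$, then $V_4$ is a classical solution of the linear problem $$-\Big(\frac{\partial V_4}{\partial t}+\frac12\sigma^2S^2\frac{\partial^2V_4}{\partial S^2}+(r-\delta)S\frac{\partial V_4}{\partial S}-rV_4\Big)-(\delta S+rI)\frac{\partial V_4}{\partial I}=0\ \text{ in }\Omega,\qquad V_4(S,I,T)=(S+I-Ke^{\gamma T})^+\ \text{ for } S,I>0;$$ that is, $V_4$ is continuous on $(0,\infty)^2\times[0,T]$, the partial derivatives that occur exist and are continuous in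 $\Omega$ (at $t=0$ the time derivative is one-sided), and the equation and the terminal condition hold pointwise. -/

import Mathlib

open MeasureTheory ProbabilityTheory Set
open scoped NNReal

noncomputable section

/-- `W` is a standard Brownian motion on the filtered probability space `(Ω, 𝓕, P)`: a Brownian
motion (Brownian finite-dimensional laws, almost surely continuous paths, `W 0 = 0` almost surely)
which is adapted to `𝓕` and whose increments after `s` are independent of `𝓕 s`. -/
structure IsBrownianWrt {Ω : Type*} {mΩ : MeasurableSpace Ω} (W : ℝ≥0 → Ω → ℝ)
    (𝓕 : Filtration ℝ≥0 mΩ) (P : Measure Ω) : Prop where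
  isBrownian : IsBrownianReal W P
  adapted : Adapted 𝓕 W
  indep : ∀ s t : ℝ≥0, s ≤ t →
    Indep (MeasurableSpace.comap (fun ω => W t ω - W s ω) inferInstance) (𝓕 s) P

/-- The numerical data of the model and of the contract. -/
structure StockLoan where
  /-- riskless interest rate -/
  r : ℝ
  /-- continuous dividend yield -/
  δ : ℝ
  /-- volatility -/
  σ : ℝ
  /-- principal -/
  K : ℝ
  /-- continuously compounded loan interest rate -/
  γ : ℝ
  /-- maturity -/
  T : ℝ

namespace StockLoan

/-- The stock price at time `u ≥ t`, started from `S` at time `t`: the geometric Brownian motion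
solving `dS = (r - δ) S du + σ S dW`. -/
def stock {Ω : Type*} (L : StockLoan) (W : ℝ≥0 → Ω → ℝ) (S t u : ℝ) (ω : Ω) : ℝ :=
  S * Real.exp ((L.r - L.δ - L.σ ^ 2 / 2) * (u - t)
    + L.σ * (W u.toNNReal ω - W t.toNNReal ω))

/-- The accumulated cash dividends at time `u ≥ t`, started from `I` at time `t`:
`dI = (δ S + r I) du`. -/
def dividends {Ω : Type*} (L : StockLoan) (W : ℝ≥0 → Ω → ℝ) (S I t u : ℝ) (ω : Ω) : ℝ :=
  I * Real.exp (L.r * (u - t))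
    + ∫ w in t..u, L.δ * Real.exp (L.r * (u - w)) * L.stock W S t w ω

/-- The payoff at time `u ≥ t`, discounted to time `t`, of redeeming at time `u` when the
accumulated dividends are returned to the borrower on redemption. -/
def discountedPayoff {Ω : Type*} (L : StockLoan) (W : ℝ≥0 → Ω → ℝ) (S I t u : ℝ) (ω : Ω) : ℝ :=
  Real.exp (-L.r * (u - t)) *
    max (L.stock W S t u ω + L.dividends W S I t u ω - L.K * Real.exp (L.γ * u)) 0

/-- The stopping times with values in `[t, T]`. -/
def IsRedemptionTime {Ω : Type*} {mΩ : MeasurableSpace Ω} (L : StockLoan)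
    (𝓕 : Filtration ℝ≥0 mΩ) (t : ℝ) (v : Ω → ℝ≥0) : Prop :=
  IsStoppingTime 𝓕 (fun ω => (v ω : WithTop ℝ≥0)) ∧ ∀ ω, t ≤ (v ω : ℝ) ∧ (v ω : ℝ) ≤ L.T

/-- The expected discounted payoff of the redemption time `v`, from the state `(S, I)` at `t`. -/
def expectedPayoff {Ω : Type*} {mΩ : MeasurableSpace Ω} (L : StockLoan) (P : Measure Ω)
    (W : ℝ≥0 → Ω → ℝ) (S I t : ℝ) (v : Ω → ℝ≥0) : ℝ :=
  ∫ ω, L.discountedPayoff W S I t (v ω) ω ∂P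

/-- The expected payoffs that the borrower can achieve from the state `(S, I)` at time `t`. -/
def achievable {Ω : Type*} {mΩ : MeasurableSpace Ω} (L : StockLoan) (P : Measure Ω)
    (𝓕 : Filtration ℝ≥0 mΩ) (W : ℝ≥0 → Ω → ℝ) (S I t : ℝ) : Set ℝ :=
  {x | ∃ v : Ω → ℝ≥0, L.IsRedemptionTime 𝓕 t v ∧ x = L.expectedPayoff P W S I t v}

/-- The value `V₄(S, I, t)` of the stock loan. -/
def value {Ω : Type*} {mΩ : MeasurableSpace Ω} (L : StockLoan) (P : Measure Ω)
    (𝓕 : Filtration ℝ≥0 mΩ) (W : ℝ≥0 → Ω → ℝ) (S I t : ℝ) : ℝ :=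
  sSup (L.achievable P 𝓕 W S I t)

/-- `v` is an optimal redemption time from the state `(S, I)` at time `t`. -/
def IsOptimal {Ω : Type*} {mΩ : MeasurableSpace Ω} (L : StockLoan) (P : Measure Ω)
    (𝓕 : Filtration ℝ≥0 mΩ) (W : ℝ≥0 → Ω → ℝ) (S I t : ℝ) (v : Ω → ℝ≥0) : Prop :=
  L.IsRedemptionTime 𝓕 t v ∧
    IsGreatest (L.achievable P 𝓕 W S I t) (L.expectedPayoff P W S I t v)

/-- The state space `(0, ∞) × (0, ∞) × [0, T)`, with points `(S, I, t)`. -/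
def domain (L : StockLoan) : Set (ℝ × ℝ × ℝ) :=
  Ioi 0 ×ˢ Ioi 0 ×ˢ Ico 0 L.T

/-- The redemption region: the states in which the value equals `S + I - K e ^ (γ t)`. -/
def redemptionRegion {Ω : Type*} {mΩ : MeasurableSpace Ω} (L : StockLoan) (P : Measure Ω)
    (𝓕 : Filtration ℝ≥0 mΩ) (W : ℝ≥0 → Ω → ℝ) : Set (ℝ × ℝ × ℝ) :=
  {p ∈ L.domain |
    L.value P 𝓕 W p.1 p.2.1 p.2.2 = p.1 + p.2.1 - L.K * Real.exp (L.γ * p.2.2)}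

/-- `V` is a classical solution of the linear terminal value problem
`- (V_t + (1/2) σ² S² V_SS + (r - δ) S V_S - r V) - (δ S + r I) V_I = 0` in the domain,
`V (S, I, T) = (S + I - K e ^ (γ T))⁺`: `V` is continuous up to and including the time `T`, the
partial derivatives in the equation exist and are continuous in the domain (at `t = 0` the
derivative in time is the one-sided one), and the equation and the terminal condition hold
everywhere. -/
def SolvesLinearProblem (L : StockLoan) (V : ℝ → ℝ → ℝ → ℝ) : Prop :=
  ContinuousOn (fun p : ℝ × ℝ × ℝ => V p.1 p.2.1 p.2.2) (Ioi 0 ×ˢ Ioi 0 ×ˢ Icc 0 L.T) ∧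
  (∃ Vt VS VSS VI : ℝ × ℝ × ℝ → ℝ,
    ContinuousOn Vt L.domain ∧ ContinuousOn VS L.domain ∧
    ContinuousOn VSS L.domain ∧ ContinuousOn VI L.domain ∧
    ∀ S I t : ℝ, (S, I, t) ∈ L.domain →
      HasDerivWithinAt (fun u => V S I u) (Vt (S, I, t)) (Ico 0 L.T) t ∧
      HasDerivAt (fun s => V s I t) (VS (S, I, t)) S ∧
      HasDerivAt (fun s => VS (s, I, t)) (VSS (S, I, t)) S ∧
      HasDerivAt (fun i => V S i t) (VI (S, I, t)) I ∧
      -(Vt (S, I, t) + 1 / 2 * L.σ ^ 2 * S ^ 2 * VSS (S, I, t)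
          + (L.r - L.δ) * S * VS (S, I, t) - L.r * V S I t)
        - (L.δ * S + L.r * I) * VI (S, I, t) = 0) ∧
  ∀ S I : ℝ, 0 < S → 0 < I → V S I L.T = max (S + I - L.K * Real.exp (L.γ * L.T)) 0

end StockLoan

end

/-! Discounting removes the interest rate. Let `X` (`gbm`) be the discounted stock started from 1
and `Y = X + δ ∫ X` (`wealth δ σ 0`) the discounted value of one share with its dividends. `X` loses
mean at rate `δ` and the dividends restore exactly that, so `Y` is a martingale
(`setIntegral_wealth`). Redemption at time `t + s` is worth `(S Y_s + I - k(s))⁺` with `k(s) = K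
exp(γ (t + s) - r s)` (`discountedPayoff_eq_reward`): a call on a martingale whose strike does not
increase when `γ ≤ r`. The reward is therefore a nonnegative continuous submartingale, and optional
stopping makes maturity optimal.

If `γ < r`, waiting gains strictly from every event of positive probability
(`setIntegral_reward_lt`): where the reward is positive the strike falls, and where it vanishes the
stock may still rise above any level. Comparing `v` with a deterministic `q < T` on the event `v ≤
q` gives the strict inequality. Immediate redemption is then strictly worse than waiting, so the
redemption region is empty.

For the equation, holding to maturity turns the value into `u(S, c, τ) = E (S Y_τ + c)⁺`
(`callValue`), where `c` is `I` minus the discounted final repayment and `τ = T - t`. The equation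
has no second derivative in `I` and `Y_τ` has no convenient density, so regularity is obtained
probabilistically. The first derivatives in `S` and `c` are expectations involving the indicator of
`S Y + c > 0`. The second derivative in `S` needs an integration by parts: up to a horizon `Θ` the
path is a Brownian bridge plus an independent Gaussian drift, `Y` is strictly increasing in the
drift, and Gaussian integration by parts in the drift trades the indicator for the positive part
times a weight, the `score` (`integral_heaviside_mul_wealth`).

The derivative in `τ` comes from the Markov property `callValue_add`: a second order Taylor
expansion over a short time, with the moments of `X_h - 1`, gives a right derivative. It is
continuous, hence a two-sided derivative. Joint continuity follows throughout from almost sure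
convergence and uniform moment bounds, because `S Y + c` almost surely does not vanish. The equation
then reduces to the identity `u = S u_S + c u_c` (`callValue_eq_add`). -/

noncomputable section

open Filter
open scoped ENNReal Topology

namespace StockLoan

/-! ### Functionals of a path: the discounted stock and the wealth. -/

section

/-- A version of the evaluation `f w` of a path `f` at the time `w` that only uses `f` at countably
many times up to `w`, so that it is jointly measurable in the path and the time. -/
def pathEval (f : ℝ≥0 → ℝ) (w : ℝ) : ℝ :=
  limUnder atTop fun n : ℕ => f ((⌊((n : ℝ) + 1) * w⌋₊ : ℝ≥0) / ((n : ℝ≥0) + 1))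

lemma measurable_pathEval : Measurable fun p : (ℝ≥0 → ℝ) × ℝ => pathEval p.1 p.2 := by
  refine StronglyMeasurable.measurable (StronglyMeasurable.limUnder fun n => ?_)
  refine Measurable.stronglyMeasurable ?_
  have h : Measurable fun q : ℕ × (ℝ≥0 → ℝ) => q.2 ((q.1 : ℝ≥0) / ((n : ℝ≥0) + 1)) :=
    measurable_from_prod_countable_right fun k => measurable_pi_apply ((k : ℝ≥0) / ((n : ℝ≥0) + 1))
  have h2 : Measurable fun p : (ℝ≥0 → ℝ) × ℝ => (⌊((n : ℝ) + 1) * p.2⌋₊, p.1) :=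
    (Nat.measurable_floor.comp (measurable_snd.const_mul _)).prodMk measurable_fst
  exact h.comp h2

lemma tendsto_floor_mul_div (w : ℝ) :
    Tendsto (fun n : ℕ => (⌊((n : ℝ) + 1) * w⌋₊ : ℝ≥0) / ((n : ℝ≥0) + 1)) atTop
      (𝓝 w.toNNReal) := by
  rw [← NNReal.tendsto_coe]
  rcases le_total 0 w with hw | hw
  · rw [Real.coe_toNNReal _ hw]
    have h1 : Tendsto (fun n : ℕ => (n : ℝ) + 1) atTop atTop :=
      tendsto_atTop_add_const_right _ _ tendsto_natCast_atTop_atTop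
    have h2 := (tendsto_nat_floor_mul_div_atTop hw).comp h1
    refine h2.congr fun n => ?_
    simp [mul_comm]
  · rw [Real.toNNReal_of_nonpos hw]
    refine tendsto_const_nhds.congr fun n => ?_
    rw [Nat.floor_of_nonpos (mul_nonpos_of_nonneg_of_nonpos (by positivity) hw)]
    simp

lemma pathEval_of_continuous {f : ℝ≥0 → ℝ} (hf : Continuous f) (w : ℝ) :
    pathEval f w = f w.toNNReal :=
  Tendsto.limUnder_eq ((hf.tendsto _).comp (tendsto_floor_mul_div w))

lemma continuous_pathEval {f : ℝ≥0 → ℝ} (hf : Continuous f) : Continuous (pathEval f) := by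
  have : pathEval f = fun w => f w.toNNReal := funext (pathEval_of_continuous hf)
  rw [this]
  exact hf.comp continuous_real_toNNReal

lemma floor_mul_div_le {w : ℝ} {a : ℝ≥0} (hw : w ≤ a) (n : ℕ) :
    (⌊((n : ℝ) + 1) * w⌋₊ : ℝ≥0) / ((n : ℝ≥0) + 1) ≤ a := by
  rw [div_le_iff₀ (by positivity), ← NNReal.coe_le_coe]
  push_cast
  rcases le_total 0 w with h | h
  · refine (Nat.floor_le (by positivity)).trans ?_
    rw [mul_comm]
    gcongr
  · rw [Nat.floor_of_nonpos (mul_nonpos_of_nonneg_of_nonpos (by positivity) h)]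
    simp only [CharP.cast_eq_zero]
    positivity

/-- The sampling times are rounded down, so no continuity is needed. This makes the functionals
below adapted to the filtration exactly, and not only up to null sets. -/
lemma pathEval_min (f : ℝ≥0 → ℝ) {w : ℝ} {a : ℝ≥0} (hw : w ≤ a) :
    pathEval (fun s => f (min s a)) w = pathEval f w := by
  unfold pathEval
  congr 1
  ext n
  exact congrArg f (min_eq_left (floor_mul_div_le hw n))

/-- The discounted stock price started from `1`, along the path `f` of the Brownian motion. -/
def gbm (δ σ : ℝ) (f : ℝ≥0 → ℝ) (w : ℝ) : ℝ :=
  Real.exp (-(δ + σ ^ 2 / 2) * w + σ * pathEval f w)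

/-- The integral of `w ^ k` against the discounted stock price, up to the time `τ`. -/
def gbmInt (δ σ : ℝ) (k : ℕ) (f : ℝ≥0 → ℝ) (τ : ℝ) : ℝ :=
  ∫ w in 0..τ, w ^ k * gbm δ σ f w

/-- For `k = 0`, the discounted value at the time `τ` of a stock bought at the price `1` together
with its accumulated dividends; the other values of `k` come up in the derivatives with respect to
a drift of the path. -/
def wealth (δ σ : ℝ) (k : ℕ) (f : ℝ≥0 → ℝ) (τ : ℝ) : ℝ :=
  τ ^ k * gbm δ σ f τ + δ * gbmInt δ σ k f τ

variable {δ σ : ℝ} {f : ℝ≥0 → ℝ}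

lemma measurable_gbm (δ σ : ℝ) : Measurable fun p : (ℝ≥0 → ℝ) × ℝ => gbm δ σ p.1 p.2 := by
  have := measurable_pathEval
  unfold gbm
  fun_prop

lemma measurable_gbm_left (δ σ w : ℝ) : Measurable fun f => gbm δ σ f w :=
  (measurable_gbm δ σ).comp (measurable_id.prodMk measurable_const)

lemma measurable_gbmInt (δ σ : ℝ) (k : ℕ) (τ : ℝ) : Measurable fun f => gbmInt δ σ k f τ := by
  have h : StronglyMeasurable fun p : (ℝ≥0 → ℝ) × ℝ => p.2 ^ k * gbm δ σ p.1 p.2 :=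
    ((measurable_snd.pow_const k).mul (measurable_gbm δ σ)).stronglyMeasurable
  unfold gbmInt intervalIntegral
  exact (h.integral_prod_right.sub h.integral_prod_right).measurable

lemma measurable_wealth (δ σ : ℝ) (k : ℕ) (τ : ℝ) : Measurable fun f => wealth δ σ k f τ :=
  ((measurable_gbm_left δ σ τ).const_mul _).add ((measurable_gbmInt δ σ k τ).const_mul _)

lemma gbm_pos (δ σ : ℝ) (f : ℝ≥0 → ℝ) (w : ℝ) : 0 < gbm δ σ f w := Real.exp_pos _

lemma continuous_gbm (hf : Continuous f) : Continuous (gbm δ σ f) := by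
  have := continuous_pathEval hf
  unfold gbm
  fun_prop

lemma intervalIntegrable_gbm (hf : Continuous f) (k : ℕ) (a b : ℝ) :
    IntervalIntegrable (fun w => w ^ k * gbm δ σ f w) volume a b :=
  ((continuous_id.pow k).mul (continuous_gbm hf)).intervalIntegrable _ _

lemma continuous_gbmInt (hf : Continuous f) (k : ℕ) : Continuous (gbmInt δ σ k f) :=
  intervalIntegral.continuous_primitive (fun a b => intervalIntegrable_gbm hf k a b) 0

lemma continuous_wealth (hf : Continuous f) (k : ℕ) : Continuous (wealth δ σ k f) :=
  ((continuous_id.pow k).mul (continuous_gbm hf)).add (continuous_const.mul (continuous_gbmInt hf k))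

lemma gbmInt_nonneg (f : ℝ≥0 → ℝ) (k : ℕ) {τ : ℝ} (hτ : 0 ≤ τ) : 0 ≤ gbmInt δ σ k f τ :=
  intervalIntegral.integral_nonneg hτ fun w hw =>
    mul_nonneg (pow_nonneg hw.1 k) (gbm_pos δ σ f w).le

lemma gbmInt_mono (hf : Continuous f) (k : ℕ) {τ τ' : ℝ} (hτ : 0 ≤ τ) (h : τ ≤ τ') :
    gbmInt δ σ k f τ ≤ gbmInt δ σ k f τ' := by
  have h1 := intervalIntegral.integral_add_adjacent_intervals
    (intervalIntegrable_gbm (δ := δ) (σ := σ) hf k 0 τ) (intervalIntegrable_gbm hf k τ τ')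
  have h2 : 0 ≤ ∫ w in τ..τ', w ^ k * gbm δ σ f w :=
    intervalIntegral.integral_nonneg h fun w hw =>
      mul_nonneg (pow_nonneg (hτ.trans hw.1) k) (gbm_pos δ σ f w).le
  unfold gbmInt
  linarith

lemma pow_mul_gbm_le_wealth (hδ : 0 ≤ δ) (f : ℝ≥0 → ℝ) (k : ℕ) {τ : ℝ} (hτ : 0 ≤ τ) :
    τ ^ k * gbm δ σ f τ ≤ wealth δ σ k f τ :=
  le_add_of_nonneg_right (mul_nonneg hδ (gbmInt_nonneg f k hτ))

lemma gbm_le_wealth (hδ : 0 ≤ δ) (f : ℝ≥0 → ℝ) {τ : ℝ} (hτ : 0 ≤ τ) :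
    gbm δ σ f τ ≤ wealth δ σ 0 f τ := by
  simpa using pow_mul_gbm_le_wealth (σ := σ) hδ f 0 hτ

lemma wealth_zero_pos (hδ : 0 ≤ δ) (f : ℝ≥0 → ℝ) {τ : ℝ} (hτ : 0 ≤ τ) :
    0 < wealth δ σ 0 f τ := (gbm_pos δ σ f τ).trans_le (gbm_le_wealth hδ f hτ)

lemma wealth_pos (hδ : 0 ≤ δ) (f : ℝ≥0 → ℝ) (k : ℕ) {τ : ℝ} (hτ : 0 < τ) :
    0 < wealth δ σ k f τ :=
  (mul_pos (pow_pos hτ k) (gbm_pos δ σ f τ)).trans_le (pow_mul_gbm_le_wealth hδ f k hτ.le)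

/-- The integral on the right no longer depends on `τ`, so moment bounds uniform in `τ` need only
`gbm` at single times and one integral. -/
lemma wealth_zero_le (hδ : 0 ≤ δ) (hf : Continuous f) {τ Θ : ℝ} (hτ : 0 ≤ τ) (h : τ ≤ Θ) :
    wealth δ σ 0 f τ ≤ gbm δ σ f τ + δ * gbmInt δ σ 0 f Θ := by
  have := mul_le_mul_of_nonneg_left (gbmInt_mono (δ := δ) (σ := σ) hf 0 hτ h) hδ
  unfold wealth
  linarith

lemma wealth_succ_le (hδ : 0 ≤ δ) (hf : Continuous f) (k : ℕ) {τ : ℝ} (hτ : 0 ≤ τ) :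
    wealth δ σ (k + 1) f τ ≤ τ * wealth δ σ k f τ := by
  have h : gbmInt δ σ (k + 1) f τ ≤ τ * gbmInt δ σ k f τ := by
    unfold gbmInt
    rw [← intervalIntegral.integral_const_mul]
    refine intervalIntegral.integral_mono_on hτ (intervalIntegrable_gbm hf _ _ _)
      ((intervalIntegrable_gbm hf k _ _).const_mul τ) fun w hw => ?_
    rw [pow_succ', mul_assoc]
    exact mul_le_mul_of_nonneg_right hw.2 (mul_nonneg (pow_nonneg hw.1 k) (gbm_pos δ σ f w).le)
  have := mul_le_mul_of_nonneg_left h hδ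
  unfold wealth
  linear_combination this

lemma wealth_at_zero (δ σ : ℝ) (f : ℝ≥0 → ℝ) : wealth δ σ 0 f 0 = gbm δ σ f 0 := by
  simp [wealth, gbmInt]

lemma gbm_at_zero (hf : Continuous f) (h0 : f 0 = 0) : gbm δ σ f 0 = 1 := by
  simp [gbm, pathEval_of_continuous hf, h0]

lemma gbm_min (f : ℝ≥0 → ℝ) {w : ℝ} {a : ℝ≥0} (hw : w ≤ a) :
    gbm δ σ (fun s => f (min s a)) w = gbm δ σ f w := by
  simp only [gbm, pathEval_min f hw]

lemma wealth_min (f : ℝ≥0 → ℝ) (k : ℕ) (a : ℝ≥0) :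
    wealth δ σ k (fun s => f (min s a)) a = wealth δ σ k f a := by
  unfold wealth gbmInt
  rw [gbm_min f le_rfl]
  congr 2
  refine intervalIntegral.integral_congr fun w hw => ?_
  rw [uIcc_of_le a.coe_nonneg] at hw
  simp only [gbm_min f hw.2]

lemma gbmInt_min (f : ℝ≥0 → ℝ) (k : ℕ) (a : ℝ≥0) :
    gbmInt δ σ k (fun s => f (min s a)) a = gbmInt δ σ k f a := by
  unfold gbmInt
  refine intervalIntegral.integral_congr fun w hw => ?_
  rw [uIcc_of_le a.coe_nonneg] at hw
  simp only [gbm_min f hw.2]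

/-! ### Restarting a path. -/

/-- The increments of the path `f` after the time `h`. -/
def shiftPath (h : ℝ≥0) (f : ℝ≥0 → ℝ) (s : ℝ≥0) : ℝ := f (h + s) - f h

lemma continuous_shiftPath (hf : Continuous f) (h : ℝ≥0) : Continuous (shiftPath h f) := by
  unfold shiftPath
  fun_prop

lemma gbm_add (hf : Continuous f) (h : ℝ≥0) {s : ℝ} (hs : 0 ≤ s) :
    gbm δ σ f (h + s) = gbm δ σ f h * gbm δ σ (shiftPath h f) s := by
  unfold gbm
  rw [← Real.exp_add, pathEval_of_continuous hf, pathEval_of_continuous hf,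
    pathEval_of_continuous (continuous_shiftPath hf h), Real.toNNReal_add h.coe_nonneg hs,
    Real.toNNReal_coe]
  unfold shiftPath
  congr 1
  ring

lemma gbmInt_add (hf : Continuous f) (h : ℝ≥0) {τ : ℝ} (hτ : 0 ≤ τ) :
    gbmInt δ σ 0 f (h + τ)
      = gbmInt δ σ 0 f h + gbm δ σ f h * gbmInt δ σ 0 (shiftPath h f) τ := by
  have h1 := intervalIntegral.integral_add_adjacent_intervals
    (intervalIntegrable_gbm (δ := δ) (σ := σ) hf 0 0 h) (intervalIntegrable_gbm hf 0 h (h + τ))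
  unfold gbmInt
  rw [← h1]
  congr 1
  rw [← intervalIntegral.integral_const_mul]
  have h2 := intervalIntegral.integral_comp_add_left (a := 0) (b := τ)
    (fun w => w ^ 0 * gbm δ σ f w) (h : ℝ)
  rw [add_zero] at h2
  rw [← h2]
  refine intervalIntegral.integral_congr fun w hw => ?_
  rw [uIcc_of_le hτ] at hw
  simp only [pow_zero, one_mul, gbm_add hf h hw.1]

/-- After the time `h` everything scales with the stock at `h`, while the dividends already
collected are a constant. In `S * wealth + c` the past thus only changes `S` and `c`, which is the
source of the Markov property. -/
lemma wealth_add (hf : Continuous f) (h : ℝ≥0) {τ : ℝ} (hτ : 0 ≤ τ) :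
    wealth δ σ 0 f (h + τ)
      = gbm δ σ f h * wealth δ σ 0 (shiftPath h f) τ + δ * gbmInt δ σ 0 f h := by
  unfold wealth
  rw [gbm_add hf h hτ, gbmInt_add hf h hτ]
  ring

/-! ### Dependence on a drift of the path. -/

/-- The path `b` with the drift `x`. -/
def driftPath (b : ℝ≥0 → ℝ) (x : ℝ) (s : ℝ≥0) : ℝ := b s + x * s

lemma measurable_driftPath : Measurable fun p : (ℝ≥0 → ℝ) × ℝ => driftPath p.1 p.2 := by
  unfold driftPath
  refine measurable_pi_lambda _ fun s => ?_
  fun_prop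

lemma continuous_driftPath {b : ℝ≥0 → ℝ} (hb : Continuous b) (x : ℝ) :
    Continuous (driftPath b x) := by
  unfold driftPath
  fun_prop

lemma gbm_driftPath {b : ℝ≥0 → ℝ} (hb : Continuous b) (x : ℝ) {w : ℝ} (hw : 0 ≤ w) :
    gbm δ σ (driftPath b x) w = gbm δ σ b w * Real.exp (σ * x * w) := by
  unfold gbm
  rw [← Real.exp_add, pathEval_of_continuous (continuous_driftPath hb x),
    pathEval_of_continuous hb]
  unfold driftPath
  rw [Real.coe_toNNReal _ hw]
  congr 1
  ring

lemma hasDerivAt_gbm_driftPath {b : ℝ≥0 → ℝ} (hb : Continuous b) (x : ℝ) {w : ℝ} (hw : 0 ≤ w) :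
    HasDerivAt (fun y => gbm δ σ (driftPath b y) w) (σ * w * gbm δ σ (driftPath b x) w) x := by
  have h : (fun y => gbm δ σ (driftPath b y) w)
      = fun y => gbm δ σ b w * Real.exp (σ * y * w) := funext fun y => gbm_driftPath hb y hw
  rw [h, gbm_driftPath hb x hw]
  have h1 : HasDerivAt (fun y : ℝ => σ * y * w) (σ * w) x := by
    simpa using ((hasDerivAt_id x).const_mul σ).mul_const w
  exact (h1.exp.const_mul (gbm δ σ b w)).congr_deriv (by ring)

lemma hasDerivAt_gbmInt_driftPath {b : ℝ≥0 → ℝ} (hb : Continuous b) (k : ℕ) (x : ℝ) {τ : ℝ}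
    (hτ : 0 ≤ τ) :
    HasDerivAt (fun y => gbmInt δ σ k (driftPath b y) τ)
      (σ * gbmInt δ σ (k + 1) (driftPath b x) τ) x := by
  unfold gbmInt
  rw [← intervalIntegral.integral_const_mul]
  have hbd : Continuous fun w : ℝ => |σ| * (|w| ^ (k + 1) * (gbm δ σ b w
      * Real.exp (|σ| * (|x| + 1) * |w|))) := by
    have := continuous_gbm (δ := δ) (σ := σ) hb
    fun_prop
  refine (intervalIntegral.hasDerivAt_integral_of_dominated_loc_of_deriv_le
    (F := fun y w => w ^ k * gbm δ σ (driftPath b y) w)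
    (F' := fun y w => σ * (w ^ (k + 1) * gbm δ σ (driftPath b y) w))
    -- Drifts in the unit ball around `x` satisfy `|y| ≤ |x| + 1`, which dominates the exponential
    -- factor.
    (bound := fun w => |σ| * (|w| ^ (k + 1) * (gbm δ σ b w * Real.exp (|σ| * (|x| + 1) * |w|))))
    (Metric.ball_mem_nhds x one_pos) ?_ (intervalIntegrable_gbm (continuous_driftPath hb x) _ _ _)
    ?_ ?_ (hbd.intervalIntegrable _ _) ?_).2
  · refine Eventually.of_forall fun y => ?_
    exact (((continuous_id.pow k).mul
      (continuous_gbm (continuous_driftPath hb y))).aestronglyMeasurable)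
  · exact ((continuous_const.mul ((continuous_id.pow (k + 1)).mul
      (continuous_gbm (continuous_driftPath hb x)))).aestronglyMeasurable)
  · refine Eventually.of_forall fun w hw y hy => ?_
    rw [uIoc_of_le hτ] at hw
    rw [gbm_driftPath hb y hw.1.le, Real.norm_eq_abs, abs_mul, abs_mul, abs_mul, abs_pow,
      abs_of_pos (gbm_pos δ σ b w), Real.abs_exp]
    have hy' : |y| ≤ |x| + 1 := by
      have : |y - x| < 1 := by simpa [Real.dist_eq] using hy
      calc |y| = |x + (y - x)| := by ring_nf
        _ ≤ |x| + |y - x| := abs_add_le _ _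
        _ ≤ _ := by linarith
    have h3 : σ * y * w ≤ |σ| * (|x| + 1) * |w| := by
      calc σ * y * w ≤ |σ * y * w| := le_abs_self _
        _ = |σ| * |y| * |w| := by rw [abs_mul, abs_mul]
        _ ≤ _ := by gcongr
    have := (gbm_pos δ σ b w).le
    gcongr
  · refine Eventually.of_forall fun w hw y _ => ?_
    rw [uIoc_of_le hτ] at hw
    exact ((hasDerivAt_gbm_driftPath hb y hw.1.le).const_mul (w ^ k)).congr_deriv (by ring)

/-- A drift `x` multiplies `gbm` at `w` by `exp (σ * x * w)`, so each derivative brings down a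
factor `σ * w` and raises the index `k` by one. -/
lemma hasDerivAt_wealth_driftPath {b : ℝ≥0 → ℝ} (hb : Continuous b) (k : ℕ) (x : ℝ) {τ : ℝ}
    (hτ : 0 ≤ τ) :
    HasDerivAt (fun y => wealth δ σ k (driftPath b y) τ)
      (σ * wealth δ σ (k + 1) (driftPath b x) τ) x := by
  unfold wealth
  exact (((hasDerivAt_gbm_driftPath hb x hτ).const_mul (τ ^ k)).fun_add
    ((hasDerivAt_gbmInt_driftPath hb k x hτ).const_mul δ)).congr_deriv (by ring)

/-- Used to see that a level is attained for at most one drift, so that the positive part has at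
most one kink in `x`. -/
lemma strictMono_wealth_driftPath {b : ℝ≥0 → ℝ} (hb : Continuous b) (hδ : 0 ≤ δ) (hσ : 0 < σ)
    (k : ℕ) {τ : ℝ} (hτ : 0 < τ) : StrictMono fun y => wealth δ σ k (driftPath b y) τ :=
  strictMono_of_hasDerivAt_pos (fun x => hasDerivAt_wealth_driftPath hb k x hτ.le)
    fun _ => mul_pos hσ (wealth_pos hδ _ _ hτ)

end

section

/-! ### Integration by parts for the Gaussian measure -/

/-- Integrability of `F'` gives `F` limits at both ends, and integrability of `F` forces them to be
zero. The exceptional set leaves room for the kink of a positive part. -/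
lemma integral_eq_zero_of_hasDerivAt_off_countable {F F' : ℝ → ℝ} {s : Set ℝ} (hs : s.Countable)
    (hc : Continuous F) (hd : ∀ x ∉ s, HasDerivAt F (F' x) x) (hF : Integrable F)
    (hF' : Integrable F') : ∫ x, F' x = 0 := by
  have key : ∀ a b, a ≤ b → ∫ x in a..b, F' x = F b - F a := fun a b hab =>
    integral_eq_of_hasDerivAt_off_countable_of_le F F' hab hs hc.continuousOn
      (fun x hx => hd x hx.2) hF'.intervalIntegrable
  have h1 : Tendsto (fun b => F b - F 0) atTop (𝓝 (∫ x in Ioi 0, F' x)) := by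
    refine (intervalIntegral_tendsto_integral_Ioi 0 hF'.integrableOn tendsto_id).congr' ?_
    filter_upwards [eventually_ge_atTop 0] with b hb using key 0 b hb
  have h2 : Tendsto (fun a => F 0 - F a) atBot (𝓝 (∫ x in Iic 0, F' x)) := by
    refine (intervalIntegral_tendsto_integral_Iic 0 hF'.integrableOn tendsto_id).congr' ?_
    filter_upwards [eventually_le_atBot 0] with a ha using key a 0 ha
  have h3 : Tendsto F atTop (𝓝 ((∫ x in Ioi 0, F' x) + F 0)) := by
    simpa using h1.add_const (F 0)
  have h4 : Tendsto F atBot (𝓝 (F 0 - ∫ x in Iic 0, F' x)) := by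
    simpa using h2.const_sub (F 0)
  have e3 := IntegrableAtFilter.eq_zero_of_tendsto (μ := volume)
    ⟨Ioi 0, Ioi_mem_atTop _, hF.integrableOn⟩ (fun s hs => by
      rcases mem_atTop_sets.1 hs with ⟨b, hb⟩
      rw [← top_le_iff, ← Real.volume_Ici (a := b)]
      exact measure_mono hb) h3
  have e4 := IntegrableAtFilter.eq_zero_of_tendsto (μ := volume)
    ⟨Iio 0, Iio_mem_atBot _, hF.integrableOn⟩ (fun s hs => by
      rcases mem_atBot_sets.1 hs with ⟨b, hb⟩
      rw [← top_le_iff, ← Real.volume_Iic (a := b)]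
      exact measure_mono hb) h4
  rw [← intervalIntegral.integral_Iic_add_Ioi (b := 0) hF'.integrableOn hF'.integrableOn]
  linarith

lemma hasDerivAt_gaussianPDFReal (v : ℝ≥0) (x : ℝ) :
    HasDerivAt (gaussianPDFReal 0 v) (-(x / v) * gaussianPDFReal 0 v x) x := by
  rw [gaussianPDFReal_def]
  have h : HasDerivAt (fun y : ℝ => -(y - 0) ^ 2 / (2 * v)) (-(x / v)) x := by
    have h0 := (((hasDerivAt_id x).sub_const 0).pow 2).neg.div_const (2 * (v : ℝ))
    refine h0.congr_deriv ?_
    simp only [id_eq, sub_zero]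
    -- For `v = 0` division by zero makes both sides vanish.
    rcases eq_or_ne (v : ℝ) 0 with hv | hv
    · simp [hv]
    · push_cast
      field_simp
  exact (h.exp.const_mul _).congr_deriv (by ring)

/-- The integrand times the Gaussian density is the derivative of `G` times the density. -/
lemma integral_gaussianReal_deriv_sub {v : ℝ≥0} (hv : v ≠ 0) {G G' : ℝ → ℝ} {s : Set ℝ}
    (hs : s.Countable) (hc : Continuous G) (hd : ∀ x ∉ s, HasDerivAt G (G' x) x)
    (hG : Integrable G (gaussianReal 0 v))
    (hG' : Integrable (fun x => G' x - x / v * G x) (gaussianReal 0 v)) :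
    ∫ x, (G' x - x / v * G x) ∂(gaussianReal 0 v) = 0 := by
  rw [integral_gaussianReal_eq_integral_smul hv]
  have hint : ∀ {g : ℝ → ℝ}, Integrable g (gaussianReal 0 v) →
      Integrable fun x => gaussianPDFReal 0 v x * g x := by
    intro g hg
    rw [gaussianReal_of_var_ne_zero _ hv, integrable_withDensity_iff_integrable_smul'
      (measurable_gaussianPDF _ _) (ae_of_all _ fun _ => gaussianPDF_lt_top)] at hg
    simpa using hg
  have hcφ : Continuous (gaussianPDFReal 0 v) :=
    continuous_iff_continuousAt.2 fun x => (hasDerivAt_gaussianPDFReal v x).continuousAt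
  refine integral_eq_zero_of_hasDerivAt_off_countable hs (hcφ.mul hc) (fun x hx => ?_)
    (hint hG) (hint hG')
  exact ((hasDerivAt_gaussianPDFReal v x).mul (hd x hx)).congr_deriv
    (by simp only [smul_eq_mul]; ring)

/-! ### Families with bounded moments -/

variable {Ω : Type*} {mΩ : MeasurableSpace Ω} {P : Measure Ω}

lemma enorm_add_pow_le (a b : ℝ) (n : ℕ) :
    ‖a + b‖ₑ ^ n ≤ 2 ^ n * ‖a‖ₑ ^ n + 2 ^ n * ‖b‖ₑ ^ n := by
  rcases le_total ‖a‖ₑ ‖b‖ₑ with h | h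
  · refine le_add_left ?_
    rw [← mul_pow]
    gcongr
    exact (enorm_add_le a b).trans (by rw [two_mul]; gcongr)
  · refine le_add_right ?_
    rw [← mul_pow]
    gcongr
    exact (enorm_add_le a b).trans (by rw [two_mul]; gcongr)

/-- The product is at most the square of the larger factor. This replaces Hölder's inequality at the
price of doubling the order, which is harmless when all moments are bounded. -/
lemma enorm_mul_pow_le (a b : ℝ) (n : ℕ) :
    ‖a * b‖ₑ ^ n ≤ ‖a‖ₑ ^ (2 * n) + ‖b‖ₑ ^ (2 * n) := by
  rw [enorm_mul]
  rcases le_total ‖a‖ₑ ‖b‖ₑ with h | h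
  · refine le_add_left ?_
    rw [pow_mul, sq]
    gcongr
  · refine le_add_right ?_
    rw [pow_mul, sq]
    gcongr

/-- A family of random variables whose moments of all orders are bounded, uniformly over the
indices in `s`. -/
structure BoundedMoments {ι : Type*} (P : Measure Ω) (Z : ι → Ω → ℝ) (s : Set ι) : Prop where
  aesm : ∀ i ∈ s, AEStronglyMeasurable (Z i) P
  bound : ∀ n : ℕ, ∃ C : ℝ≥0, ∀ i ∈ s, ∫⁻ ω, ‖Z i ω‖ₑ ^ n ∂P ≤ C

namespace BoundedMoments

variable {ι : Type*} {Z Z' : ι → Ω → ℝ} {s t : Set ι}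

lemma subset (h : BoundedMoments P Z s) (hts : t ⊆ s) : BoundedMoments P Z t where
  aesm i hi := h.aesm i (hts hi)
  bound n := let ⟨C, hC⟩ := h.bound n; ⟨C, fun i hi => hC i (hts hi)⟩

lemma mono (h : BoundedMoments P Z s) (hm : ∀ i ∈ s, AEStronglyMeasurable (Z' i) P)
    (hle : ∀ i ∈ s, ∀ᵐ ω ∂P, |Z' i ω| ≤ |Z i ω|) : BoundedMoments P Z' s where
  aesm := hm
  bound n := by
    obtain ⟨C, hC⟩ := h.bound n
    refine ⟨C, fun i hi => (lintegral_mono_ae ?_).trans (hC i hi)⟩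
    filter_upwards [hle i hi] with ω hω
    gcongr
    exact enorm_le_iff_norm_le.2 hω

lemma add (h : BoundedMoments P Z s) (h' : BoundedMoments P Z' s) :
    BoundedMoments P (fun i ω => Z i ω + Z' i ω) s where
  aesm i hi := (h.aesm i hi).add (h'.aesm i hi)
  bound n := by
    obtain ⟨C, hC⟩ := h.bound n
    obtain ⟨C', hC'⟩ := h'.bound n
    refine ⟨2 ^ n * C + 2 ^ n * C', fun i hi => ?_⟩
    calc ∫⁻ ω, ‖Z i ω + Z' i ω‖ₑ ^ n ∂P
        ≤ ∫⁻ ω, (2 ^ n * ‖Z i ω‖ₑ ^ n + 2 ^ n * ‖Z' i ω‖ₑ ^ n) ∂P :=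
          lintegral_mono fun ω => enorm_add_pow_le _ _ n
      _ = 2 ^ n * ∫⁻ ω, ‖Z i ω‖ₑ ^ n ∂P + 2 ^ n * ∫⁻ ω, ‖Z' i ω‖ₑ ^ n ∂P := by
          rw [lintegral_add_left' (((h.aesm i hi).enorm.pow_const n).const_mul _),
            lintegral_const_mul'' _ ((h.aesm i hi).enorm.pow_const n),
            lintegral_const_mul'' _ ((h'.aesm i hi).enorm.pow_const n)]
      _ ≤ 2 ^ n * C + 2 ^ n * C' := by gcongr; exacts [hC i hi, hC' i hi]
      _ = _ := by push_cast; rfl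

lemma mul (h : BoundedMoments P Z s) (h' : BoundedMoments P Z' s) :
    BoundedMoments P (fun i ω => Z i ω * Z' i ω) s where
  aesm i hi := (h.aesm i hi).mul (h'.aesm i hi)
  bound n := by
    obtain ⟨C, hC⟩ := h.bound (2 * n)
    obtain ⟨C', hC'⟩ := h'.bound (2 * n)
    refine ⟨C + C', fun i hi => ?_⟩
    calc ∫⁻ ω, ‖Z i ω * Z' i ω‖ₑ ^ n ∂P
        ≤ ∫⁻ ω, (‖Z i ω‖ₑ ^ (2 * n) + ‖Z' i ω‖ₑ ^ (2 * n)) ∂P :=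
          lintegral_mono fun ω => enorm_mul_pow_le _ _ n
      _ = ∫⁻ ω, ‖Z i ω‖ₑ ^ (2 * n) ∂P + ∫⁻ ω, ‖Z' i ω‖ₑ ^ (2 * n) ∂P :=
          lintegral_add_left' ((h.aesm i hi).enorm.pow_const _) _
      _ ≤ C + C' := add_le_add (hC i hi) (hC' i hi)
      _ = _ := by push_cast; rfl

lemma of_bounded [IsProbabilityMeasure P] {c : ι → ℝ} (C : ℝ) (hC : ∀ i ∈ s, |c i| ≤ C) :
    BoundedMoments P (fun i _ => c i) s where
  aesm _ _ := aestronglyMeasurable_const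
  bound n := by
    refine ⟨C.toNNReal ^ n, fun i hi => ?_⟩
    rw [lintegral_const, measure_univ, mul_one]
    push_cast
    gcongr
    rw [← ofReal_norm]
    exact ENNReal.ofReal_le_ofReal (hC i hi)

lemma const [IsProbabilityMeasure P] (c : ℝ) : BoundedMoments P (fun _ _ => c) s :=
  of_bounded |c| fun _ _ => le_rfl

lemma const_mul [IsProbabilityMeasure P] (c : ℝ) (h : BoundedMoments P Z s) :
    BoundedMoments P (fun i ω => c * Z i ω) s := (const c).mul h

lemma abs (h : BoundedMoments P Z s) : BoundedMoments P (fun i ω => |Z i ω|) s :=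
  h.mono (fun i hi => (h.aesm i hi).norm) fun _ _ => ae_of_all _ fun _ => (abs_abs _).le

lemma comp {κ : Type*} (h : BoundedMoments P Z s) (g : κ → ι) {u : Set κ} (hg : MapsTo g u s) :
    BoundedMoments P (fun k => Z (g k)) u where
  aesm _ hk := h.aesm _ (hg hk)
  bound n := let ⟨C, hC⟩ := h.bound n; ⟨C, fun _ hk => hC _ (hg hk)⟩

lemma integrable (h : BoundedMoments P Z s) {i : ι} (hi : i ∈ s) : Integrable (Z i) P := by
  obtain ⟨C, hC⟩ := h.bound 1
  refine ⟨h.aesm i hi, ?_⟩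
  have := hC i hi
  simp only [pow_one] at this
  exact this.trans_lt ENNReal.coe_lt_top

end BoundedMoments

/-- Truncation at `M`: dominated convergence handles the first term, a second moment bound the
other. -/
lemma sub_le_min_add_sq (x : ℝ) {M : ℝ} (hM : 0 < M) : |x| ≤ min |x| M + x ^ 2 / M := by
  have h0 : 0 ≤ x ^ 2 / M := by positivity
  rcases le_total |x| M with h | h
  · rw [min_eq_left h]; linarith
  · rw [min_eq_right h]
    have : |x| ≤ x ^ 2 / M := by
      rw [le_div_iff₀ hM, ← sq_abs, sq]
      gcongr
    linarith

/-- Convergence of expectations under almost sure convergence and bounded second moments. -/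
lemma tendsto_integral_of_sq_le [IsProbabilityMeasure P] {Z : ℕ → Ω → ℝ} {Z₀ : Ω → ℝ}
    (hm : ∀ n, AEStronglyMeasurable (Z n) P) {C : ℝ≥0} (hC : ∀ n, ∫⁻ ω, ‖Z n ω‖ₑ ^ 2 ∂P ≤ C)
    (hlim : ∀ᵐ ω ∂P, Tendsto (Z · ω) atTop (𝓝 (Z₀ ω))) :
    Tendsto (fun n => ∫ ω, Z n ω ∂P) atTop (𝓝 (∫ ω, Z₀ ω ∂P)) := by
  have hm0 : AEStronglyMeasurable Z₀ P := aestronglyMeasurable_of_tendsto_ae atTop hm hlim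
  -- By Fatou's lemma the limit inherits the bound.
  have hC0 : ∫⁻ ω, ‖Z₀ ω‖ₑ ^ 2 ∂P ≤ C := by
    have h1 : ∀ᵐ ω ∂P, ‖Z₀ ω‖ₑ ^ 2 = liminf (fun n => ‖Z n ω‖ₑ ^ 2) atTop := by
      filter_upwards [hlim] with ω hω
      exact ((((ENNReal.continuous_pow 2).comp continuous_enorm).tendsto _).comp hω).liminf_eq.symm
    rw [lintegral_congr_ae h1]
    refine (lintegral_liminf_le' fun n => (hm n).enorm.pow_const 2).trans ?_
    exact liminf_le_of_le (by isBoundedDefault) fun b hb => by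
      obtain ⟨n, hn⟩ := hb.exists
      exact hn.trans (hC n)
  have hsq : ∀ {X : Ω → ℝ}, AEStronglyMeasurable X P → ∫⁻ ω, ‖X ω‖ₑ ^ 2 ∂P ≤ C →
      MemLp X 2 P ∧ ∫ ω, X ω ^ 2 ∂P ≤ C := by
    intro X hX hXC
    have e : ∀ ω, ENNReal.ofReal (X ω ^ 2) = ‖X ω‖ₑ ^ 2 := fun ω => by
      rw [← ofReal_norm, ← ENNReal.ofReal_pow (norm_nonneg _), Real.norm_eq_abs, sq_abs]
    constructor
    · rw [memLp_two_iff_integrable_sq hX]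
      refine ⟨hX.pow 2, ?_⟩
      refine lt_of_le_of_lt ?_ (hXC.trans_lt ENNReal.coe_lt_top)
      exact lintegral_mono fun ω => by simp
    · rw [integral_eq_lintegral_of_nonneg_ae (ae_of_all _ fun ω => sq_nonneg _) (hX.pow 2)]
      refine ENNReal.toReal_le_of_le_ofReal C.2 ?_
      simp only [e, ENNReal.ofReal_coe_nnreal]
      exact hXC
  have h0 := hsq hm0 hC0
  have hn := fun n => hsq (hm n) (hC n)
  have hD : ∀ n, MemLp (fun ω => Z n ω - Z₀ ω) 2 P := fun n => (hn n).1.sub h0.1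
  have hDsq : ∀ n, ∫ ω, (Z n ω - Z₀ ω) ^ 2 ∂P ≤ 4 * C := by
    intro n
    have i1 := (hn n).1.integrable_sq
    have i2 := h0.1.integrable_sq
    calc ∫ ω, (Z n ω - Z₀ ω) ^ 2 ∂P ≤ ∫ ω, (2 * Z n ω ^ 2 + 2 * Z₀ ω ^ 2) ∂P := by
          refine integral_mono (hD n).integrable_sq ((i1.const_mul 2).add (i2.const_mul 2))
            fun ω => ?_
          simp only
          nlinarith [sq_nonneg (Z n ω + Z₀ ω)]
      _ = 2 * ∫ ω, Z n ω ^ 2 ∂P + 2 * ∫ ω, Z₀ ω ^ 2 ∂P := by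
          rw [integral_add (i1.const_mul 2) (i2.const_mul 2), integral_const_mul,
            integral_const_mul]
      _ ≤ 4 * C := by linarith [(hn n).2, h0.2]
  rw [Metric.tendsto_atTop]
  intro ε hε
  -- The level is chosen so that the tail, at most `4 * C / M` by `hDsq`, uses up less than half of
  -- `ε`.
  obtain ⟨M, hM, hM'⟩ : ∃ M : ℝ, 0 < M ∧ 4 * C / M < ε / 2 := by
    refine ⟨8 * C / ε + 1, by positivity, ?_⟩
    rw [div_lt_iff₀ (by positivity)]
    have : ε / 2 * (8 * C / ε + 1) = 4 * C + ε / 2 := by field_simp; ring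
    linarith
  have hmin : Tendsto (fun n => ∫ ω, min |Z n ω - Z₀ ω| M ∂P) atTop (𝓝 (∫ _, (0 : ℝ) ∂P)) := by
    refine tendsto_integral_of_dominated_convergence (fun _ => M)
      (fun n => ((hm n).sub hm0).norm.inf aestronglyMeasurable_const) (integrable_const M)
      (fun n => ae_of_all _ fun ω => ?_) ?_
    · rw [Real.norm_eq_abs, abs_of_nonneg (le_min (abs_nonneg _) hM.le)]
      exact min_le_right _ _
    · filter_upwards [hlim] with ω hω
      have h1 : Tendsto (fun n => |Z n ω - Z₀ ω|) atTop (𝓝 0) := by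
        simpa using (hω.sub_const (Z₀ ω)).abs
      simpa [hM.le] using h1.min (tendsto_const_nhds (x := M))
  rw [integral_zero] at hmin
  obtain ⟨N, hN⟩ := Metric.tendsto_atTop.1 hmin (ε / 2) (by positivity)
  refine ⟨N, fun n hnN => ?_⟩
  have hNn := hN n hnN
  rw [Real.dist_eq, sub_zero] at hNn
  have iD : Integrable (fun ω => Z n ω - Z₀ ω) P := (hD n).integrable (by norm_num)
  have imin : Integrable (fun ω => min |Z n ω - Z₀ ω| M) P :=
    iD.abs.inf (integrable_const M)
  have isq : Integrable (fun ω => (Z n ω - Z₀ ω) ^ 2 / M) P := (hD n).integrable_sq.div_const M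
  rw [Real.dist_eq, ← integral_sub ((hn n).1.integrable (by norm_num))
    (h0.1.integrable (by norm_num))]
  calc |∫ ω, (Z n ω - Z₀ ω) ∂P| ≤ ∫ ω, |Z n ω - Z₀ ω| ∂P := abs_integral_le_integral_abs
    _ ≤ ∫ ω, (min |Z n ω - Z₀ ω| M + (Z n ω - Z₀ ω) ^ 2 / M) ∂P :=
        integral_mono iD.abs (imin.add isq) fun ω => sub_le_min_add_sq _ hM
    _ = ∫ ω, min |Z n ω - Z₀ ω| M ∂P + (∫ ω, (Z n ω - Z₀ ω) ^ 2 ∂P) / M := by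
        rw [integral_add imin isq, integral_div]
    _ < ε := by
        have := div_le_div_of_nonneg_right (hDsq n) hM.le
        linarith [le_abs_self (∫ ω, min |Z n ω - Z₀ ω| M ∂P)]

lemma BoundedMoments.tendsto_integral [IsProbabilityMeasure P] {ι : Type*} {Z : ι → Ω → ℝ}
    {s : Set ι} (h : BoundedMoments P Z s) {l : Filter ι} [l.IsCountablyGenerated]
    (hl : ∀ᶠ i in l, i ∈ s) {Z₀ : Ω → ℝ} (hlim : ∀ᵐ ω ∂P, Tendsto (Z · ω) l (𝓝 (Z₀ ω))) :
    Tendsto (fun i => ∫ ω, Z i ω ∂P) l (𝓝 (∫ ω, Z₀ ω ∂P)) := by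
  refine tendsto_of_seq_tendsto fun u hu => ?_
  obtain ⟨N, hN⟩ := eventually_atTop.1 (hu.eventually hl)
  obtain ⟨C, hC⟩ := h.bound 2
  rw [← tendsto_add_atTop_iff_nat N]
  refine tendsto_integral_of_sq_le (Z := fun n => Z (u (n + N)))
    (fun n => h.aesm _ (hN _ (Nat.le_add_left _ _)))
    (fun n => hC _ (hN _ (Nat.le_add_left _ _))) ?_
  filter_upwards [hlim] with ω hω
  exact (hω.comp hu).comp (tendsto_add_atTop_nat N)

end

section

variable {Ω : Type*} {mΩ : MeasurableSpace Ω} {P : Measure Ω} {B : ℝ≥0 → Ω → ℝ} {δ σ : ℝ}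

/-! ### The law of the paths of a Brownian motion -/

lemma measurable_path (hm : ∀ t, Measurable (B t)) : Measurable fun ω => (B · ω) :=
  measurable_pi_lambda _ hm

/-- On the product σ-algebra a law is determined by its finite-dimensional marginals. This is why
all functionals are defined, and measurable, on the space of all paths. -/
lemma map_path_eq [IsFiniteMeasure P] {B' : ℝ≥0 → Ω → ℝ} (hB : IsPreBrownianReal B P)
    (hB' : IsPreBrownianReal B' P) (hm : ∀ t, Measurable (B t)) (hm' : ∀ t, Measurable (B' t)) :
    P.map (fun ω => (B · ω)) = P.map (fun ω => (B' · ω)) := by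
  rw [map_eq_iff_forall_finset_map_restrict_eq (measurable_path hm).aemeasurable
    (measurable_path hm').aemeasurable]
  exact fun I => (hB.hasLaw I).map_eq.trans (hB'.hasLaw I).map_eq.symm

lemma integral_path_eq [IsFiniteMeasure P] {B' : ℝ≥0 → Ω → ℝ} (hB : IsPreBrownianReal B P)
    (hB' : IsPreBrownianReal B' P) (hm : ∀ t, Measurable (B t)) (hm' : ∀ t, Measurable (B' t))
    {Φ : (ℝ≥0 → ℝ) → ℝ} (hΦ : Measurable Φ) :
    ∫ ω, Φ (B · ω) ∂P = ∫ ω, Φ (B' · ω) ∂P := by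
  have h := map_path_eq hB hB' hm hm'
  have h1 := integral_map (measurable_path hm).aemeasurable (μ := P)
    (hΦ.aestronglyMeasurable (μ := P.map fun ω => (B · ω)))
  have h2 := integral_map (measurable_path hm').aemeasurable (μ := P)
    (hΦ.aestronglyMeasurable (μ := P.map fun ω => (B' · ω)))
  rw [← h1, ← h2, h]

lemma isBrownianReal_shiftPath (hB : IsBrownianReal B P) (h : ℝ≥0) :
    IsBrownianReal (fun s ω => shiftPath h (B · ω) s) P := hB.shift h

lemma measurable_shiftPath (hm : ∀ t, Measurable (B t)) (h s : ℝ≥0) :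
    Measurable fun ω => shiftPath h (B · ω) s := (hm _).sub (hm _)

/-- The Brownian path up to the time `Θ` without its mean drift, i.e. the Brownian bridge. -/
def bridge (Θ : ℝ≥0) (B : ℝ≥0 → Ω → ℝ) (s : ℝ≥0) (ω : Ω) : ℝ :=
  B (min s Θ) ω - ((min s Θ : ℝ≥0) : ℝ) / Θ * B Θ ω

lemma measurable_bridge (hm : ∀ t, Measurable (B t)) (Θ s : ℝ≥0) : Measurable (bridge Θ B s) :=
  (hm _).sub ((hm _).const_mul _)

lemma continuous_bridge {ω : Ω} (h : Continuous (B · ω)) (Θ : ℝ≥0) :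
    Continuous (bridge Θ B · ω) := by
  unfold bridge
  fun_prop

/-- The bridge and the endpoint are jointly Gaussian, both being linear in `B`, and uncorrelated:
for `s ≤ Θ` the covariance of `B s - (s / Θ) B Θ` with `B Θ` is `s - s = 0`. -/
lemma indepFun_bridge (hB : IsPreBrownianReal B P) (hm : ∀ t, Measurable (B t))
    {Θ : ℝ≥0} (hΘ : 0 < Θ) :
    IndepFun (fun ω s => bridge Θ B s ω) (fun ω => B Θ ω / Θ) P := by
  have hP := hB.isGaussianProcess.isProbabilityMeasure
  -- The criterion compares two processes, so the endpoint becomes a process indexed by `Unit`.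
  have h : IndepFun (fun ω s => bridge Θ B s ω) (fun ω (_ : Unit) => B Θ ω / Θ) P := by
    refine IsGaussianProcess.indepFun_of_covariance_eq_zero (X := bridge Θ B)
      (Y := fun _ ω => B Θ ω / Θ) ?_ (fun s => (measurable_bridge hm Θ s).aemeasurable)
      (fun _ => ((hm Θ).div_const _).aemeasurable) ?_
    · refine hB.isGaussianProcess.of_isGaussianProcess ?_
      rintro (s | u)
      · exact ⟨{min s Θ, Θ},
          { toFun x := x ⟨min s Θ, by simp⟩ - ((min s Θ : ℝ≥0) : ℝ) / Θ * x ⟨Θ, by simp⟩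
            map_add' x y := by simp; ring
            map_smul' c x := by simp; ring }, by simp [bridge]⟩
      · exact ⟨{Θ},
          { toFun x := x ⟨Θ, by simp⟩ / Θ
            map_add' x y := by simp; ring
            map_smul' c x := by simp; ring }, by simp⟩
    · intro s u
      have h2 : ∀ t, MemLp (B t) 2 P := fun t =>
        (hB.isGaussianProcess.hasGaussianLaw_eval t).memLp_two
      have e : (fun ω => B Θ ω / Θ) = fun ω => (Θ : ℝ)⁻¹ * B Θ ω := by
        ext ω; rw [div_eq_inv_mul]
      simp only [e]
      rw [covariance_const_mul_right]
      unfold bridge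
      rw [covariance_fun_sub_left (h2 _) ((h2 _).const_mul _) (h2 _), covariance_const_mul_left,
        hB.covariance_eval, hB.covariance_eval, min_eq_left (min_le_right s Θ), min_self]
      have : (Θ : ℝ) ≠ 0 := by exact_mod_cast hΘ.ne'
      field_simp
      ring
  exact h.comp measurable_id (measurable_pi_apply ())

lemma hasLaw_div (hB : IsPreBrownianReal B P) {Θ : ℝ≥0} (hΘ : 0 < Θ) :
    HasLaw (fun ω => B Θ ω / Θ) (gaussianReal 0 Θ⁻¹) P := by
  have h := gaussianReal_div_const (hB.hasLaw_eval Θ) (Θ : ℝ)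
  convert h using 2
  · simp
  · ext
    have : (Θ : ℝ) ≠ 0 := by exact_mod_cast hΘ.ne'
    push_cast
    field_simp

lemma map_bridge_prod [IsProbabilityMeasure P] (hB : IsPreBrownianReal B P)
    (hm : ∀ t, Measurable (B t)) {Θ : ℝ≥0} (hΘ : 0 < Θ) :
    P.map (fun ω => ((bridge Θ B · ω), B Θ ω / Θ))
      = (P.prod (gaussianReal 0 Θ⁻¹)).map (fun p => ((bridge Θ B · p.1), p.2)) := by
  have mb : Measurable fun ω => (bridge Θ B · ω) := measurable_path (measurable_bridge hm Θ)
  rw [(indepFun_iff_map_prod_eq_prod_map_map mb.aemeasurable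
    ((hm Θ).div_const _).aemeasurable).1 (indepFun_bridge hB hm hΘ), (hasLaw_div hB hΘ).map_eq]
  have := Measure.map_prod_map P (gaussianReal 0 Θ⁻¹) mb measurable_id
  rw [Measure.map_id] at this
  exact this

section PathIntegral

variable [IsProbabilityMeasure P] {Θ : ℝ≥0} {Φ : (ℝ≥0 → ℝ) → ℝ}

/-- The bridge is frozen after `Θ`, so the decomposition stops there. Hence the functionals below
are required to depend on the path only up to `Θ`. -/
lemma driftPath_bridge (hΘ : 0 < Θ) (ω : Ω) {s : ℝ≥0} (hs : s ≤ Θ) :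
    driftPath (bridge Θ B · ω) (B Θ ω / Θ) s = B s ω := by
  have : (Θ : ℝ) ≠ 0 := by exact_mod_cast hΘ.ne'
  simp only [driftPath, bridge]
  rw [min_eq_left hs]
  field_simp
  ring

lemma map_driftPath_bridge (hB : IsPreBrownianReal B P)
    (hm : ∀ t, Measurable (B t)) (hΘ : 0 < Θ) :
    P.map (fun ω => driftPath (bridge Θ B · ω) (B Θ ω / Θ))
      = (P.prod (gaussianReal 0 Θ⁻¹)).map (fun p => driftPath (bridge Θ B · p.1) p.2) := by
  have mb : Measurable fun ω => (bridge Θ B · ω) := measurable_path (measurable_bridge hm Θ)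
  have h1 := Measure.map_map (μ := P) measurable_driftPath (mb.prodMk ((hm Θ).div_const (Θ : ℝ)))
  have h2 := Measure.map_map (μ := P.prod (gaussianReal 0 Θ⁻¹)) measurable_driftPath
    ((mb.comp measurable_fst).prodMk measurable_snd)
  rw [map_bridge_prod hB hm hΘ] at h1
  exact h1.symm.trans h2

lemma measurable_driftPath_bridge (hm : ∀ t, Measurable (B t)) :
    Measurable fun p : Ω × ℝ => driftPath (bridge Θ B · p.1) p.2 :=
  measurable_driftPath.comp
    (((measurable_path (measurable_bridge hm Θ)).comp measurable_fst).prodMk measurable_snd)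

/-- The expectation of a functional of the path up to `Θ`, by conditioning on the bridge. -/
lemma integral_path_eq_integral_bridge (hB : IsPreBrownianReal B P)
    (hm : ∀ t, Measurable (B t)) (hΘ : 0 < Θ) (hΦ : Measurable Φ)
    (hΦΘ : ∀ f g : ℝ≥0 → ℝ, (∀ s ≤ Θ, f s = g s) → Φ f = Φ g)
    (hint : Integrable (fun ω => Φ (B · ω)) P) :
    Integrable (fun p : Ω × ℝ => Φ (driftPath (bridge Θ B · p.1) p.2))
      (P.prod (gaussianReal 0 Θ⁻¹)) ∧
    ∫ ω, Φ (B · ω) ∂P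
      = ∫ ω, ∫ x, Φ (driftPath (bridge Θ B · ω) x) ∂(gaussianReal 0 Θ⁻¹) ∂P := by
  have e : (fun ω => Φ (B · ω)) = Φ ∘ fun ω => driftPath (bridge Θ B · ω) (B Θ ω / Θ) := by
    ext ω
    exact hΦΘ _ _ fun s hs => (driftPath_bridge hΘ ω hs).symm
  have mb : Measurable fun ω => (bridge Θ B · ω) := measurable_path (measurable_bridge hm Θ)
  have m1 : Measurable fun ω => driftPath (bridge Θ B · ω) (B Θ ω / Θ) :=
    measurable_driftPath.comp (mb.prodMk ((hm Θ).div_const (Θ : ℝ)))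
  have m2 := measurable_driftPath_bridge (Θ := Θ) hm
  have hi : Integrable (fun p : Ω × ℝ => Φ (driftPath (bridge Θ B · p.1) p.2))
      (P.prod (gaussianReal 0 Θ⁻¹)) := by
    rw [e, ← integrable_map_measure hΦ.aestronglyMeasurable m1.aemeasurable,
      map_driftPath_bridge hB hm hΘ,
      integrable_map_measure hΦ.aestronglyMeasurable m2.aemeasurable] at hint
    exact hint
  refine ⟨hi, ?_⟩
  rw [e, ← integral_prod _ hi]
  have h1 := integral_map (μ := P) m1.aemeasurable hΦ.aestronglyMeasurable
  have h2 := integral_map m2.aemeasurable (μ := P.prod (gaussianReal 0 Θ⁻¹))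
    hΦ.aestronglyMeasurable
  rw [map_driftPath_bridge hB hm hΘ] at h1
  exact h1.symm.trans h2

/-- An event of the path up to `Θ` that is almost sure for each bridge is almost sure. -/
lemma ae_path_of_ae_bridge (hB : IsPreBrownianReal B P)
    (hm : ∀ t, Measurable (B t)) (hΘ : 0 < Θ) {p : (ℝ≥0 → ℝ) → Prop} (hp : MeasurableSet {f | p f})
    (hpΘ : ∀ f g : ℝ≥0 → ℝ, (∀ s ≤ Θ, f s = g s) → (p f ↔ p g))
    (h : ∀ᵐ ω ∂P, ∀ᵐ x ∂(gaussianReal 0 Θ⁻¹), p (driftPath (bridge Θ B · ω) x)) :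
    ∀ᵐ ω ∂P, p (B · ω) := by
  have mb : Measurable fun ω => (bridge Θ B · ω) := measurable_path (measurable_bridge hm Θ)
  have m1 : Measurable fun ω => driftPath (bridge Θ B · ω) (B Θ ω / Θ) :=
    measurable_driftPath.comp (mb.prodMk ((hm Θ).div_const (Θ : ℝ)))
  have m2 := measurable_driftPath_bridge (Θ := Θ) hm
  have h1 : ∀ᵐ ω ∂P, p (driftPath (bridge Θ B · ω) (B Θ ω / Θ)) := by
    rw [← ae_map_iff m1.aemeasurable hp, map_driftPath_bridge hB hm hΘ,
      ae_map_iff m2.aemeasurable hp]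
    exact (Measure.ae_prod_iff_ae_ae (p := fun q : Ω × ℝ =>
      p (driftPath (bridge Θ B · q.1) q.2)) (m2 hp)).2 h
  filter_upwards [h1] with ω hω
  exact (hpΘ _ _ fun s hs => driftPath_bridge hΘ ω hs).1 hω

end PathIntegral

/-! ### Moments -/

lemma gbm_ae_eq (hB : IsBrownianReal B P) (δ σ : ℝ) :
    ∀ᵐ ω ∂P, ∀ w, gbm δ σ (B · ω) w
      = Real.exp (-(δ + σ ^ 2 / 2) * w + σ * B w.toNNReal ω) := by
  filter_upwards [hB.cont] with ω hω w
  rw [gbm, pathEval_of_continuous hω]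

lemma integrable_exp_mul (hB : IsPreBrownianReal B P) (t : ℝ≥0) (p : ℝ) :
    Integrable (fun ω => Real.exp (p * B t ω)) P := by
  have h := hB.hasLaw_eval t
  have := integrable_exp_mul_gaussianReal (μ := 0) (v := t) p
  rw [← h.map_eq] at this
  exact this.comp_aemeasurable h.aemeasurable

lemma integral_exp_mul (hB : IsPreBrownianReal B P) (t : ℝ≥0) (p : ℝ) :
    ∫ ω, Real.exp (p * B t ω) ∂P = Real.exp (t * p ^ 2 / 2) := by
  have := mgf_gaussianReal (hB.hasLaw_eval t).map_eq p
  rw [zero_mul, zero_add] at this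
  exact this

/-- Lognormal moments are explicit and nondecreasing in the offset and in the time, hence bounded by
their values at `A` and `Θ`. A sign of `β` is not imposed, so that the inverse of `gbm` is covered
too. -/
lemma boundedMoments_exp {ι : Type*} (hB : IsPreBrownianReal B P) {s : Set ι} {α : ι → ℝ}
    {w : ι → ℝ≥0} (β : ℝ) {A : ℝ} {Θ : ℝ≥0} (hα : ∀ i ∈ s, α i ≤ A) (hw : ∀ i ∈ s, w i ≤ Θ) :
    BoundedMoments P (fun i ω => Real.exp (α i + β * B (w i) ω)) s where
  aesm i _ := by
    have := hB.aemeasurable (w i)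
    exact (by fun_prop : AEMeasurable _ P).aestronglyMeasurable
  bound n := by
    refine ⟨(Real.exp (n * A) * Real.exp (Θ * (n * β) ^ 2 / 2)).toNNReal, fun i hi => ?_⟩
    have e : ∀ ω, ‖Real.exp (α i + β * B (w i) ω)‖ₑ ^ n
        = ENNReal.ofReal (Real.exp (n * α i) * Real.exp (n * β * B (w i) ω)) := fun ω => by
      rw [← ofReal_norm, Real.norm_of_nonneg (Real.exp_pos _).le,
        ← ENNReal.ofReal_pow (Real.exp_pos _).le, ← Real.exp_nat_mul, ← Real.exp_add]
      ring_nf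
    simp only [e]
    rw [← ofReal_integral_eq_lintegral_ofReal ((integrable_exp_mul hB _ _).const_mul _)
      (ae_of_all _ fun ω => by positivity), integral_const_mul, integral_exp_mul hB]
    refine ENNReal.ofReal_le_ofReal ?_
    have h1 := hα i hi
    have h2 : (w i : ℝ) ≤ Θ := by exact_mod_cast hw i hi
    gcongr

lemma integral_gbm_rpow [IsProbabilityMeasure P] (hB : IsBrownianReal B P) (δ σ : ℝ) {w : ℝ}
    (hw : 0 ≤ w) (n : ℕ) :
    Integrable (fun ω => gbm δ σ (B · ω) w ^ n) P ∧
    ∫ ω, gbm δ σ (B · ω) w ^ n ∂P = Real.exp (w * (-n * δ + σ ^ 2 * n * (n - 1) / 2)) := by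
  have h : (fun ω => gbm δ σ (B · ω) w ^ n) =ᵐ[P] fun ω =>
      Real.exp (-n * (δ + σ ^ 2 / 2) * w) * Real.exp (n * σ * B w.toNNReal ω) := by
    filter_upwards [gbm_ae_eq hB δ σ] with ω hω
    rw [hω, ← Real.exp_nat_mul, ← Real.exp_add]
    ring_nf
  have hi := (integrable_exp_mul hB.toIsPreBrownianReal w.toNNReal (n * σ)).const_mul
    (Real.exp (-n * (δ + σ ^ 2 / 2) * w))
  refine ⟨hi.congr h.symm, ?_⟩
  rw [integral_congr_ae h, integral_const_mul, integral_exp_mul hB.toIsPreBrownianReal,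
    Real.coe_toNNReal _ hw, ← Real.exp_add]
  ring_nf

lemma boundedMoments_gbm (hB : IsBrownianReal B P) (hm : ∀ t, Measurable (B t)) (δ σ : ℝ)
    (Θ : ℝ≥0) :
    BoundedMoments P (fun (τ : ℝ) ω => gbm δ σ (B · ω) τ) (Icc 0 Θ) := by
  refine (boundedMoments_exp hB.toIsPreBrownianReal (s := Icc 0 (Θ : ℝ))
    (α := fun τ => -(δ + σ ^ 2 / 2) * τ) (w := Real.toNNReal) σ
    (A := |δ + σ ^ 2 / 2| * Θ) (Θ := Θ) (fun τ hτ => ?_)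
    (fun τ hτ => Real.toNNReal_le_iff_le_coe.2 hτ.2)).mono (fun τ _ =>
      ((measurable_gbm_left δ σ τ).comp (measurable_path hm)).aestronglyMeasurable)
    fun τ _ => ?_
  · calc -(δ + σ ^ 2 / 2) * τ ≤ |-(δ + σ ^ 2 / 2) * τ| := le_abs_self _
      _ = |δ + σ ^ 2 / 2| * τ := by rw [abs_mul, abs_neg, abs_of_nonneg hτ.1]
      _ ≤ _ := by gcongr; exact hτ.2
  · filter_upwards [gbm_ae_eq hB δ σ] with ω hω
    rw [hω]

lemma boundedMoments_gbm_inv (hB : IsBrownianReal B P) (hm : ∀ t, Measurable (B t)) (δ σ : ℝ)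
    (Θ : ℝ≥0) :
    BoundedMoments P (fun (τ : ℝ) ω => (gbm δ σ (B · ω) τ)⁻¹) (Icc 0 Θ) := by
  refine (boundedMoments_exp hB.toIsPreBrownianReal (s := Icc 0 (Θ : ℝ))
    (α := fun τ => (δ + σ ^ 2 / 2) * τ) (w := Real.toNNReal) (-σ)
    (A := |δ + σ ^ 2 / 2| * Θ) (Θ := Θ) (fun τ hτ => ?_)
    (fun τ hτ => Real.toNNReal_le_iff_le_coe.2 hτ.2)).mono (fun τ _ =>
      ((measurable_gbm_left δ σ τ).comp (measurable_path hm)).inv.aestronglyMeasurable)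
    fun τ _ => ?_
  · calc (δ + σ ^ 2 / 2) * τ ≤ |(δ + σ ^ 2 / 2) * τ| := le_abs_self _
      _ = |δ + σ ^ 2 / 2| * τ := by rw [abs_mul, abs_of_nonneg hτ.1]
      _ ≤ _ := by gcongr; exact hτ.2
  · filter_upwards [gbm_ae_eq hB δ σ] with ω hω
    rw [hω, ← Real.exp_neg]
    refine le_of_eq ?_
    ring_nf

/-- Domination by `exp x + exp (-x)`, both of whose terms are already under control. -/
lemma boundedMoments_eval {ι : Type*} (hB : IsPreBrownianReal B P) (Θ : ℝ≥0) (s : Set ι) :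
    BoundedMoments P (fun (_ : ι) ω => B Θ ω) s := by
  have h1 := boundedMoments_exp hB (s := s) (α := fun _ => 0) (w := fun _ => Θ) 1 (A := 0) (Θ := Θ)
    (fun _ _ => le_rfl) (fun _ _ => le_rfl)
  have h2 := boundedMoments_exp hB (s := s) (α := fun _ => 0) (w := fun _ => Θ) (-1) (A := 0)
    (Θ := Θ) (fun _ _ => le_rfl) (fun _ _ => le_rfl)
  refine (h1.add h2).mono (fun _ _ => (hB.aemeasurable Θ).aestronglyMeasurable) fun _ _ =>
    ae_of_all _ fun ω => ?_
  simp only [zero_add, one_mul, neg_mul]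
  have e1 := Real.add_one_le_exp (B Θ ω)
  have e2 := Real.add_one_le_exp (-B Θ ω)
  have p1 := Real.exp_pos (B Θ ω)
  have p2 := Real.exp_pos (-B Θ ω)
  rw [abs_of_pos (add_pos p1 p2), abs_le]
  constructor <;> linarith

lemma lintegral_pow_le {α : Type*} {mα : MeasurableSpace α} {μ : Measure α} {g : α → ℝ≥0∞}
    (hg : AEMeasurable g μ) {n : ℕ} (hn : n ≠ 0) :
    (∫⁻ x, g x ∂μ) ^ n ≤ (∫⁻ x, g x ^ n ∂μ) * μ univ ^ (n - 1) := by
  have h := eLpNorm_le_eLpNorm_mul_rpow_measure_univ (p := 1) (q := ((n : ℝ≥0) : ℝ≥0∞))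
    (by exact_mod_cast Nat.one_le_iff_ne_zero.2 hn) hg.aestronglyMeasurable
  have h2 := eLpNorm_nnreal_pow_eq_lintegral (f := g) (μ := μ) (p := (n : ℝ≥0))
    (by exact_mod_cast hn)
  simp only [NNReal.coe_natCast, ENNReal.rpow_natCast, enorm_eq_self] at h2
  rw [eLpNorm_one_eq_lintegral_enorm] at h
  simp only [enorm_eq_self] at h
  calc (∫⁻ x, g x ∂μ) ^ n ≤ _ := pow_le_pow_left₀ (zero_le) h n
    _ = _ := by
      rw [mul_pow, h2, ← ENNReal.rpow_natCast (_ ^ (_ : ℝ)), ← ENNReal.rpow_mul,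
        ← ENNReal.rpow_natCast (μ univ)]
      congr 2
      have : (n : ℝ) ≠ 0 := by exact_mod_cast hn
      rw [Nat.cast_sub (Nat.one_le_iff_ne_zero.2 hn)]
      simp
      field_simp

/-- Jensen's inequality in the time variable, in the form `lintegral_pow_le`, followed by Tonelli
and the uniform moment bound for `gbm`. -/
lemma boundedMoments_gbmInt {ι : Type*} [IsProbabilityMeasure P] (hB : IsBrownianReal B P)
    (hm : ∀ t, Measurable (B t)) (δ σ : ℝ) (Θ : ℝ≥0) (s : Set ι) :
    BoundedMoments P (fun (_ : ι) ω => gbmInt δ σ 0 (B · ω) Θ) s where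
  aesm _ _ := ((measurable_gbmInt δ σ 0 Θ).comp (measurable_path hm)).aestronglyMeasurable
  bound n := by
    rcases eq_or_ne n 0 with rfl | hn
    · exact ⟨1, fun _ _ => by simp⟩
    obtain ⟨C, hC⟩ := (boundedMoments_gbm hB hm δ σ Θ).bound n
    refine ⟨C * Θ * Θ ^ (n - 1), fun _ _ => ?_⟩
    have hmeas : Measurable fun p : Ω × ℝ => ‖gbm δ σ (B · p.1) p.2‖ₑ :=
      ((measurable_gbm δ σ).comp
        (((measurable_path hm).comp measurable_fst).prodMk measurable_snd)).enorm
    have hvol : volume.restrict (Ioc 0 (Θ : ℝ)) univ = Θ := by simp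
    calc ∫⁻ ω, ‖gbmInt δ σ 0 (B · ω) Θ‖ₑ ^ n ∂P
        ≤ ∫⁻ ω, (∫⁻ w in Ioc 0 (Θ : ℝ), ‖gbm δ σ (B · ω) w‖ₑ) ^ n ∂P := by
          refine lintegral_mono fun ω => ?_
          gcongr
          unfold gbmInt
          rw [intervalIntegral.integral_of_le Θ.coe_nonneg]
          simpa using enorm_integral_le_lintegral_enorm (μ := volume.restrict (Ioc 0 (Θ : ℝ)))
            (fun w => gbm δ σ (B · ω) w)
      _ ≤ ∫⁻ ω, (∫⁻ w in Ioc 0 (Θ : ℝ), ‖gbm δ σ (B · ω) w‖ₑ ^ n) * Θ ^ (n - 1) ∂P := by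
          refine lintegral_mono fun ω => ?_
          refine (lintegral_pow_le (hmeas.comp measurable_prodMk_left).aemeasurable hn).trans ?_
          rw [hvol]
          rfl
      _ = (∫⁻ w in Ioc 0 (Θ : ℝ), ∫⁻ ω, ‖gbm δ σ (B · ω) w‖ₑ ^ n ∂P) * Θ ^ (n - 1) := by
          rw [lintegral_mul_const _ (hmeas.pow_const n).lintegral_prod_right',
            lintegral_lintegral_swap (hmeas.pow_const n).aemeasurable]
      _ ≤ (∫⁻ w in Ioc 0 (Θ : ℝ), C) * Θ ^ (n - 1) := by
          gcongr ?_ * _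
          refine setLIntegral_mono measurable_const fun w hw => hC w (Ioc_subset_Icc_self hw)
      _ = _ := by
          rw [lintegral_const, hvol]
          push_cast
          rfl

lemma boundedMoments_wealth [IsProbabilityMeasure P] (hB : IsBrownianReal B P)
    (hm : ∀ t, Measurable (B t)) (hδ : 0 ≤ δ) (σ : ℝ) (Θ : ℝ≥0) :
    BoundedMoments P (fun (τ : ℝ) ω => wealth δ σ 0 (B · ω) τ) (Icc 0 Θ) := by
  refine ((boundedMoments_gbm hB hm δ σ Θ).add
    ((boundedMoments_gbmInt hB hm δ σ Θ _).const_mul δ)).mono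
    (fun τ _ => ((measurable_wealth δ σ 0 τ).comp (measurable_path hm)).aestronglyMeasurable)
    fun τ hτ => ?_
  filter_upwards [hB.cont] with ω hω
  rw [abs_of_pos (wealth_zero_pos hδ _ hτ.1)]
  exact (wealth_zero_le hδ hω hτ.1 hτ.2).trans (le_abs_self _)

end

section

variable {Ω : Type*} {mΩ : MeasurableSpace Ω} {P : Measure Ω} {B : ℝ≥0 → Ω → ℝ} {δ σ : ℝ}

/-! ### The Heaviside function -/

/-- The indicator of the positive half-line. -/
def heaviside (x : ℝ) : ℝ := if 0 < x then 1 else 0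

lemma measurable_heaviside : Measurable heaviside :=
  Measurable.ite measurableSet_Ioi measurable_const measurable_const

lemma heaviside_of_pos {x : ℝ} (h : 0 < x) : heaviside x = 1 := if_pos h

lemma heaviside_of_nonpos {x : ℝ} (h : x ≤ 0) : heaviside x = 0 := if_neg h.not_gt

lemma abs_heaviside_le (x : ℝ) : |heaviside x| ≤ 1 := by
  unfold heaviside
  split_ifs <;> simp

lemma heaviside_mul_self (x : ℝ) : heaviside x * x = max x 0 := by
  rcases lt_or_ge 0 x with h | h
  · rw [heaviside_of_pos h, one_mul, max_eq_left h.le]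
  · rw [heaviside_of_nonpos h, zero_mul, max_eq_right h]

lemma continuousAt_heaviside {x : ℝ} (h : x ≠ 0) : ContinuousAt heaviside x := by
  rcases lt_or_gt_of_ne h with h | h
  · refine (continuousAt_const (y := (0 : ℝ))).congr ?_
    filter_upwards [eventually_lt_nhds h] with y hy using (heaviside_of_nonpos hy.le).symm
  · refine (continuousAt_const (y := (1 : ℝ))).congr ?_
    filter_upwards [eventually_gt_nhds h] with y hy using (heaviside_of_pos hy).symm

lemma hasDerivAt_max_zero {x : ℝ} (h : x ≠ 0) :
    HasDerivAt (fun y : ℝ => max y 0) (heaviside x) x := by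
  rcases lt_or_gt_of_ne h with h | h
  · rw [heaviside_of_nonpos h.le]
    refine (hasDerivAt_const x (0 : ℝ)).congr_of_eventuallyEq ?_
    filter_upwards [eventually_lt_nhds h] with y hy using max_eq_right hy.le
  · rw [heaviside_of_pos h]
    refine (hasDerivAt_id x).congr_of_eventuallyEq ?_
    filter_upwards [eventually_gt_nhds h] with y hy using max_eq_left hy.le

lemma abs_max_zero_sub_le (x y : ℝ) : |max x 0 - max y 0| ≤ |x - y| := by
  simpa using abs_max_sub_max_le_abs x y 0

/-- Differentiation of the expectation of a weighted positive part. -/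
lemma hasDerivAt_integral_max [IsProbabilityMeasure P] {X a w : Ω → ℝ} {s : ℝ}
    (hX : Measurable X) (ha : Measurable a) (hw : Measurable w)
    (hint : ∀ t, Integrable (fun ω => max (t * X ω + a ω) 0 * w ω) P)
    (hXw : Integrable (fun ω => X ω * w ω) P) (h0 : ∀ᵐ ω ∂P, s * X ω + a ω ≠ 0) :
    HasDerivAt (fun t => ∫ ω, max (t * X ω + a ω) 0 * w ω ∂P)
      (∫ ω, heaviside (s * X ω + a ω) * (X ω * w ω) ∂P) s := by
  -- For each `ω` the integrand is Lipschitz in `t` with constant `|X ω * w ω|`, and off a null set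
  -- `s` is not its kink.
  refine (hasDerivAt_integral_of_dominated_loc_of_lip (s := univ)
    (F := fun t ω => max (t * X ω + a ω) 0 * w ω) (bound := fun ω => |X ω * w ω|) univ_mem
    (Eventually.of_forall fun t => (hint t).aestronglyMeasurable) (hint s) ?_ ?_ hXw.abs ?_).2
  · exact ((measurable_heaviside.comp ((hX.const_mul s).add ha)).mul
      (hX.mul hw)).aestronglyMeasurable
  · refine ae_of_all _ fun ω => ?_
    refine LipschitzOnWith.of_dist_le_mul fun x _ y _ => ?_
    rw [Real.dist_eq, Real.dist_eq, ← sub_mul, abs_mul, Real.coe_nnabs, abs_abs, abs_mul]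
    have h1 := abs_max_zero_sub_le (x * X ω + a ω) (y * X ω + a ω)
    have h2 : x * X ω + a ω - (y * X ω + a ω) = X ω * (x - y) := by ring
    rw [h2, abs_mul] at h1
    calc _ ≤ |X ω| * |x - y| * |w ω| := by gcongr
      _ = _ := by ring
  · filter_upwards [h0] with ω hω
    have h1 : HasDerivAt (fun t => t * X ω + a ω) (X ω) s := by
      simpa using ((hasDerivAt_id s).mul_const (X ω)).add_const (a ω)
    exact ((HasDerivAt.comp s (h₂ := fun y : ℝ => max y 0) (hasDerivAt_max_zero hω) h1).mul_const
      (w ω)).congr_deriv (by ring)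

/-! ### The score -/

/-- The weight of the integration by parts formula for the expectation of a function of the wealth
at the time `τ`. -/
def score (δ σ : ℝ) (Θ : ℝ≥0) (f : ℝ≥0 → ℝ) (τ : ℝ) : ℝ :=
  -- With `Y k` the wealth of index `k` and `x = f Θ / Θ` the drift, of variance `1 / Θ`, this is `Θ
  -- x G - G'` for `G = Y 0 / (σ Y 1)`, whose derivative in the drift is `G' = 1 - Y 0 Y 2 / (Y 1) ^
  -- 2`.
  f Θ * (wealth δ σ 0 f τ / (σ * wealth δ σ 1 f τ)) - 1
    + wealth δ σ 0 f τ * wealth δ σ 2 f τ / wealth δ σ 1 f τ ^ 2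

lemma measurable_score (δ σ : ℝ) (Θ : ℝ≥0) (τ : ℝ) : Measurable fun f => score δ σ Θ f τ := by
  have h0 := measurable_wealth δ σ 0 τ
  have h1 := measurable_wealth δ σ 1 τ
  have h2 := measurable_wealth δ σ 2 τ
  have h3 : Measurable fun f : ℝ≥0 → ℝ => f Θ := measurable_pi_apply _
  unfold score
  fun_prop

lemma continuousOn_score (hδ : 0 ≤ δ) (hσ : σ ≠ 0) (Θ : ℝ≥0) {f : ℝ≥0 → ℝ} (hf : Continuous f) :
    ContinuousOn (score δ σ Θ f) (Ioi 0) := by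
  have h0 := (continuous_wealth (δ := δ) (σ := σ) hf 0).continuousOn (s := Ioi 0)
  have h1 := (continuous_wealth (δ := δ) (σ := σ) hf 1).continuousOn (s := Ioi 0)
  have h2 := (continuous_wealth (δ := δ) (σ := σ) hf 2).continuousOn (s := Ioi 0)
  have hne : ∀ τ ∈ Ioi (0 : ℝ), wealth δ σ 1 f τ ≠ 0 := fun τ hτ => (wealth_pos hδ f 1 hτ).ne'
  unfold score
  refine ((continuousOn_const.mul (h0.div (continuousOn_const.mul h1) fun τ hτ =>
    mul_ne_zero hσ (hne τ hτ))).sub continuousOn_const).add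
    ((h0.mul h2).div (h1.pow 2) fun τ hτ => pow_ne_zero 2 (hne τ hτ))

lemma wealth_congr {f g : ℝ≥0 → ℝ} (k : ℕ) {τ : ℝ} (hτ : 0 ≤ τ) {Θ : ℝ≥0} (hτΘ : τ ≤ Θ)
    (h : ∀ s ≤ Θ, f s = g s) : wealth δ σ k f τ = wealth δ σ k g τ := by
  lift τ to ℝ≥0 using hτ
  rw [← wealth_min f k τ, ← wealth_min g k τ]
  congr 1
  ext s
  exact h _ ((min_le_right _ _).trans (by exact_mod_cast hτΘ))

lemma score_congr {f g : ℝ≥0 → ℝ} {τ : ℝ} (hτ : 0 ≤ τ) {Θ : ℝ≥0} (hτΘ : τ ≤ Θ)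
    (h : ∀ s ≤ Θ, f s = g s) : score δ σ Θ f τ = score δ σ Θ g τ := by
  simp only [score, wealth_congr _ hτ hτΘ h, h Θ le_rfl]

/-- The denominator is at least `τ` times `gbm` at `τ`, hence at least `a` times it. The bound
degenerates as `a` tends to zero, which is why smoothness is claimed only for `τ > 0`. -/
lemma wealth_div_wealth_le (hδ : 0 ≤ δ) {Θ : ℝ≥0} {f : ℝ≥0 → ℝ} (hf : Continuous f)
    {a τ : ℝ} (ha : 0 < a) (haτ : a ≤ τ) (hτ : τ ≤ Θ) :
    wealth δ σ 0 f τ / wealth δ σ 1 f τ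
      ≤ a⁻¹ * (1 + δ * gbmInt δ σ 0 f Θ * (gbm δ σ f τ)⁻¹) := by
  have hτ0 : 0 < τ := ha.trans_le haτ
  have p0 := wealth_pos (σ := σ) hδ f 0 hτ0
  have px := gbm_pos δ σ f τ
  have h1 : a * gbm δ σ f τ ≤ wealth δ σ 1 f τ := by
    refine le_trans ?_ (pow_mul_gbm_le_wealth hδ f 1 hτ0.le)
    rw [pow_one]
    gcongr
  calc wealth δ σ 0 f τ / wealth δ σ 1 f τ
      ≤ (gbm δ σ f τ + δ * gbmInt δ σ 0 f Θ) / (a * gbm δ σ f τ) := by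
        have := wealth_zero_le (σ := σ) hδ hf hτ0.le hτ
        gcongr
        exact p0.le.trans this
    _ = _ := by field_simp

/-- The score is dominated by variables all of whose moments are finite. -/
lemma abs_score_le (hδ : 0 ≤ δ) (hσ : 0 < σ) {Θ : ℝ≥0} {f : ℝ≥0 → ℝ} (hf : Continuous f)
    {a τ : ℝ} (ha : 0 < a) (haτ : a ≤ τ) (hτ : τ ≤ Θ) :
    |score δ σ Θ f τ| ≤ (|f Θ| * σ⁻¹ + Θ)
      * (a⁻¹ * (1 + δ * gbmInt δ σ 0 f Θ * (gbm δ σ f τ)⁻¹)) + 1 := by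
  have hτ0 : 0 < τ := ha.trans_le haτ
  have p1 := wealth_pos (σ := σ) hδ f 1 hτ0
  have p0 := wealth_pos (σ := σ) hδ f 0 hτ0
  have p2 := wealth_pos (σ := σ) hδ f 2 hτ0
  have hG := wealth_div_wealth_le (σ := σ) hδ hf ha haτ hτ
  have h2 : wealth δ σ 2 f τ / wealth δ σ 1 f τ ≤ Θ := by
    rw [div_le_iff₀ p1]
    refine (wealth_succ_le hδ hf 1 hτ0.le).trans ?_
    gcongr
  set G := wealth δ σ 0 f τ / wealth δ σ 1 f τ with hGdef
  have hG0 : 0 ≤ G := (div_pos p0 p1).le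
  have e : score δ σ Θ f τ = f Θ * σ⁻¹ * G - 1 + G * (wealth δ σ 2 f τ / wealth δ σ 1 f τ) := by
    unfold score
    rw [hGdef]
    field_simp
  have hH0 : 0 ≤ wealth δ σ 2 f τ / wealth δ σ 1 f τ := (div_pos p2 p1).le
  calc |score δ σ Θ f τ| ≤ |f Θ * σ⁻¹ * G| + 1 + |G * (wealth δ σ 2 f τ / wealth δ σ 1 f τ)| := by
        rw [e]
        refine (abs_add_le _ _).trans ?_
        gcongr
        refine (abs_sub _ _).trans ?_
        simp
    _ ≤ |f Θ| * σ⁻¹ * G + 1 + G * Θ := by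
        rw [abs_mul, abs_mul, abs_of_pos (inv_pos.2 hσ), abs_of_nonneg hG0,
          abs_of_nonneg (mul_nonneg hG0 hH0)]
        gcongr
    _ = (|f Θ| * σ⁻¹ + Θ) * G + 1 := by ring
    _ ≤ _ := by gcongr

lemma boundedMoments_wealth_div [IsProbabilityMeasure P] (hB : IsBrownianReal B P)
    (hm : ∀ t, Measurable (B t)) (hδ : 0 ≤ δ) (σ : ℝ) (Θ : ℝ≥0) {a : ℝ} (ha : 0 < a) :
    BoundedMoments P (fun (τ : ℝ) ω => wealth δ σ 0 (B · ω) τ / wealth δ σ 1 (B · ω) τ)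
      (Icc a Θ) := by
  have hx := (boundedMoments_gbm_inv hB hm δ σ Θ).subset (Icc_subset_Icc_left ha.le)
  have hA := boundedMoments_gbmInt hB hm δ σ Θ (Icc a (Θ : ℝ))
  refine (((BoundedMoments.const 1).add ((hA.const_mul δ).mul hx)).const_mul a⁻¹).mono
    (fun τ _ => (((measurable_wealth δ σ 0 τ).div (measurable_wealth δ σ 1 τ)).comp
      (measurable_path hm)).aestronglyMeasurable) fun τ hτ => ?_
  filter_upwards [hB.cont] with ω hω
  have hτ0 := ha.trans_le hτ.1
  rw [abs_of_pos (div_pos (wealth_pos hδ _ 0 hτ0) (wealth_pos hδ _ 1 hτ0))]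
  exact (wealth_div_wealth_le hδ hω ha hτ.1 hτ.2).trans (le_abs_self _)

lemma boundedMoments_score [IsProbabilityMeasure P] (hB : IsBrownianReal B P)
    (hm : ∀ t, Measurable (B t)) (hδ : 0 ≤ δ) (hσ : 0 < σ) (Θ : ℝ≥0) {a : ℝ} (ha : 0 < a) :
    BoundedMoments P (fun (τ : ℝ) ω => score δ σ Θ (B · ω) τ) (Icc a Θ) := by
  have hsub : Icc a (Θ : ℝ) ⊆ Icc 0 Θ := Icc_subset_Icc_left ha.le
  have hx := (boundedMoments_gbm_inv hB hm δ σ Θ).subset hsub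
  have hA := boundedMoments_gbmInt hB hm δ σ Θ (Icc a (Θ : ℝ))
  have hW := boundedMoments_eval hB.toIsPreBrownianReal Θ (Icc a (Θ : ℝ))
  have h1 : BoundedMoments P (fun (τ : ℝ) ω => (σ⁻¹ * |B Θ ω| + Θ)
      * (a⁻¹ * (1 + δ * gbmInt δ σ 0 (B · ω) Θ * (gbm δ σ (B · ω) τ)⁻¹)) + 1) (Icc a Θ) :=
    (((hW.abs.const_mul σ⁻¹).add (BoundedMoments.const _)).mul (((BoundedMoments.const 1).add
      ((hA.const_mul δ).mul hx)).const_mul a⁻¹)).add (BoundedMoments.const 1)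
  refine h1.mono (fun τ _ =>
    ((measurable_score δ σ Θ τ).comp (measurable_path hm)).aestronglyMeasurable) fun τ hτ => ?_
  filter_upwards [hB.cont] with ω hω
  refine (abs_score_le hδ hσ hω ha hτ.1 hτ.2).trans ?_
  rw [mul_comm σ⁻¹]
  exact le_abs_self _

/-! ### Integration by parts -/

/-- Almost surely, the wealth avoids each given level. -/
lemma ae_mul_wealth_add_ne_zero [IsProbabilityMeasure P] (hB : IsBrownianReal B P)
    (hm : ∀ t, Measurable (B t)) (hδ : 0 ≤ δ) (hσ : 0 < σ) {S : ℝ} (hS : 0 < S) (c : ℝ) {τ : ℝ}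
    (hτ : 0 < τ) : ∀ᵐ ω ∂P, S * wealth δ σ 0 (B · ω) τ + c ≠ 0 := by
  have hΘ : 0 < τ.toNNReal := Real.toNNReal_pos.2 hτ
  have hms : MeasurableSet {f : ℝ≥0 → ℝ | S * wealth δ σ 0 f τ + c = 0} :=
    measurableSet_eq_fun (((measurable_wealth δ σ 0 τ).const_mul S).add_const c) measurable_const
  refine ae_path_of_ae_bridge (p := fun f => S * wealth δ σ 0 f τ + c ≠ 0)
    hB.toIsPreBrownianReal hm hΘ hms.compl ?_ ?_
  · intro f g hfg
    rw [wealth_congr 0 hτ.le (Real.coe_toNNReal τ hτ.le).ge hfg]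
  · filter_upwards [hB.cont] with ω hω
    have : NullSingletonClass (gaussianReal 0 (τ.toNNReal)⁻¹) :=
      nullSingletonClass_gaussianReal (inv_pos.2 hΘ).ne'
    refine measure_mono_null (t := {x | S * wealth δ σ 0
      (driftPath (bridge τ.toNNReal B · ω) x) τ + c = 0}) (fun x hx => by simpa using hx) ?_
    -- For a fixed bridge the level is attained for at most one drift, and the Gaussian law has no
    -- atoms.
    refine Set.Subsingleton.measure_zero (fun x hx y hy => ?_) _
    refine (strictMono_wealth_driftPath (continuous_bridge hω τ.toNNReal) hδ hσ 0 hτ).injective ?_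
    have h1 : S * wealth δ σ 0 (driftPath (bridge τ.toNNReal B · ω) x) τ + c = 0 := hx
    have h2 : S * wealth δ σ 0 (driftPath (bridge τ.toNNReal B · ω) y) τ + c = 0 := hy
    exact mul_left_cancel₀ hS.ne' (by linarith)

/-- Integration by parts for the Gaussian drift of a fixed path. -/
lemma integral_driftPath_score {b : ℝ≥0 → ℝ} (hb : Continuous b) (hδ : 0 ≤ δ) (hσ : 0 < σ)
    {S : ℝ} (hS : 0 < S) (c : ℝ) {τ : ℝ} (hτ : 0 < τ) {Θ : ℝ≥0} (hΘ : 0 < Θ) (hbΘ : b Θ = 0)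
    (h1 : Integrable (fun x => max (S * wealth δ σ 0 (driftPath b x) τ + c) 0
      * (wealth δ σ 0 (driftPath b x) τ / (σ * wealth δ σ 1 (driftPath b x) τ)))
      (gaussianReal 0 Θ⁻¹))
    (h2 : Integrable (fun x => heaviside (S * wealth δ σ 0 (driftPath b x) τ + c)
      * (S * wealth δ σ 0 (driftPath b x) τ)
      - max (S * wealth δ σ 0 (driftPath b x) τ + c) 0 * score δ σ Θ (driftPath b x) τ)
      (gaussianReal 0 Θ⁻¹)) :
    ∫ x, (heaviside (S * wealth δ σ 0 (driftPath b x) τ + c)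
      * (S * wealth δ σ 0 (driftPath b x) τ)
      - max (S * wealth δ σ 0 (driftPath b x) τ + c) 0 * score δ σ Θ (driftPath b x) τ)
      ∂(gaussianReal 0 Θ⁻¹) = 0 := by
  set y : ℕ → ℝ → ℝ := fun k x => wealth δ σ k (driftPath b x) τ with hy
  have dy : ∀ k x, HasDerivAt (y k) (σ * y (k + 1) x) x := fun k x =>
    hasDerivAt_wealth_driftPath hb k x hτ.le
  have py : ∀ k x, 0 < y k x := fun k x => wealth_pos hδ _ k hτ
  have cy : ∀ k, Continuous (y k) := fun k =>
    continuous_iff_continuousAt.2 fun x => (dy k x).continuousAt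
  have ne : ∀ x, σ * y 1 x ≠ 0 := fun x => (mul_pos hσ (py 1 x)).ne'
  set s : Set ℝ := {x | S * y 0 x + c = 0} with hs
  have hsub : s.Subsingleton := fun u hu v hv => by
    refine (strictMono_wealth_driftPath hb hδ hσ 0 hτ).injective ?_
    have h1 : S * y 0 u + c = 0 := hu
    have h2 : S * y 0 v + c = 0 := hv
    exact mul_left_cancel₀ hS.ne' (by linarith)
  -- Since `σ * y 1` is the derivative of `y 0`, dividing by it makes the derivative of the positive
  -- part contribute exactly the indicator times `S * y 0`.
  set G : ℝ → ℝ := fun x => max (S * y 0 x + c) 0 * (y 0 x / (σ * y 1 x)) with hG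
  set G' : ℝ → ℝ := fun x => heaviside (S * y 0 x + c) * (S * y 0 x)
    + max (S * y 0 x + c) 0 * (1 - y 0 x * y 2 x / y 1 x ^ 2) with hG'
  have dG : ∀ x ∉ s, HasDerivAt G (G' x) x := by
    intro x hx
    have d1 : HasDerivAt (fun z => S * y 0 z + c) (S * (σ * y 1 x)) x :=
      ((dy 0 x).const_mul S).add_const c
    have d2 : HasDerivAt (fun z => max (S * y 0 z + c) 0)
        (heaviside (S * y 0 x + c) * (S * (σ * y 1 x))) x :=
      HasDerivAt.comp x (h₂ := fun y : ℝ => max y 0) (hasDerivAt_max_zero hx) d1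
    have d3 := (dy 0 x).fun_div ((dy 1 x).const_mul σ) (ne x)
    refine (d2.mul d3).congr_deriv ?_
    have := (py 1 x).ne'
    simp only [hG', zero_add, Nat.reduceAdd]
    field_simp
  have cG : Continuous G :=
    (((continuous_const.mul (cy 0)).add continuous_const).max continuous_const).mul
      ((cy 0).div (continuous_const.mul (cy 1)) ne)
  have e : ∀ x, heaviside (S * y 0 x + c) * (S * y 0 x)
      - max (S * y 0 x + c) 0 * score δ σ Θ (driftPath b x) τ
      = G' x - x / ((Θ⁻¹ : ℝ≥0) : ℝ) * G x := by
    intro x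
    have hdΘ : driftPath b x Θ = x * Θ := by simp [driftPath, hbΘ]
    simp only [hG', hG, score, hdΘ, NNReal.coe_inv, div_inv_eq_mul]
    change _ - _ * (x * Θ * (y 0 x / (σ * y 1 x)) - 1 + y 0 x * y 2 x / y 1 x ^ 2) = _
    ring
  have key := integral_gaussianReal_deriv_sub (inv_pos.2 hΘ).ne' (G := G) (G' := G')
    hsub.countable cG dG h1 (h2.congr (ae_of_all _ e))
  exact (integral_congr_ae (ae_of_all _ e)).trans key

lemma integrable_heaviside_mul {X Z : Ω → ℝ} (hX : Measurable X) (hZ : Integrable Z P) :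
    Integrable (fun ω => heaviside (X ω) * Z ω) P :=
  hZ.bdd_mul (c := 1) (measurable_heaviside.comp hX).aestronglyMeasurable
    (ae_of_all _ fun _ => abs_heaviside_le _)

section Regularity

variable [IsProbabilityMeasure P]

/-- The parameters `(S, c, τ)` with `|S|, |c| ≤ R` and `a ≤ τ ≤ Θ`. -/
def paramBox (R a Θ : ℝ) : Set (ℝ × ℝ × ℝ) := Icc (-R) R ×ˢ Icc (-R) R ×ˢ Icc a Θ

lemma boundedMoments_max (hB : IsBrownianReal B P) (hm : ∀ t, Measurable (B t))
    (hδ : 0 ≤ δ) (σ R : ℝ) {a : ℝ} (ha : 0 ≤ a) (Θ : ℝ≥0) :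
    BoundedMoments P (fun (p : ℝ × ℝ × ℝ) ω => max (p.1 * wealth δ σ 0 (B · ω) p.2.2 + p.2.1) 0)
      (paramBox R a Θ) := by
  have hY : BoundedMoments P (fun (p : ℝ × ℝ × ℝ) ω => wealth δ σ 0 (B · ω) p.2.2)
      (paramBox R a Θ) := (boundedMoments_wealth hB hm hδ σ Θ).comp (fun p : ℝ × ℝ × ℝ => p.2.2)
        fun _ hp => ⟨ha.trans hp.2.2.1, hp.2.2.2⟩
  refine (((hY.const_mul R).add (BoundedMoments.const R))).mono (fun p _ => ?_) fun p hp =>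
    ae_of_all _ fun ω => ?_
  · have := (measurable_wealth δ σ 0 p.2.2).comp (measurable_path hm)
    exact ((((this.const_mul p.1).add_const p.2.1)).max measurable_const).aestronglyMeasurable
  · have h0 := (wealth_zero_pos (σ := σ) hδ (B · ω) (ha.trans hp.2.2.1)).le
    have h1 : p.1 ≤ R := hp.1.2
    have h2 : p.2.1 ≤ R := hp.2.1.2
    have hR : 0 ≤ R := by linarith [hp.1.1, hp.1.2]
    have h3 := mul_le_mul_of_nonneg_right h1 h0
    have h4 := mul_nonneg hR h0
    rw [abs_of_nonneg (le_max_right _ _), abs_of_nonneg (by positivity)]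
    exact max_le (by linarith) (by linarith)

lemma mem_paramBox {S c τ a Θ : ℝ} (h : a ≤ τ) (h' : τ ≤ Θ) :
    (S, c, τ) ∈ paramBox (|S| + |c|) a Θ := by
  exact ⟨abs_le.1 (by simp), abs_le.1 (by simp), h, h'⟩

section Integrability

variable (hB : IsBrownianReal B P) (hm : ∀ t, Measurable (B t)) (hδ : 0 ≤ δ)

include hB hm hδ

lemma integrable_wealth (σ : ℝ) {τ : ℝ} (hτ : 0 ≤ τ) :
    Integrable (fun ω => wealth δ σ 0 (B · ω) τ) P :=
  (boundedMoments_wealth hB hm hδ σ τ.toNNReal).integrable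
    ⟨hτ, (Real.coe_toNNReal τ hτ).ge⟩

lemma integrable_max (σ S c : ℝ) {τ : ℝ} (hτ : 0 ≤ τ) :
    Integrable (fun ω => max (S * wealth δ σ 0 (B · ω) τ + c) 0) P :=
  (boundedMoments_max hB hm hδ σ (|S| + |c|) hτ τ.toNNReal).integrable
    (i := (S, c, τ)) (mem_paramBox le_rfl (Real.coe_toNNReal τ hτ).ge)

variable (hσ : 0 < σ)

include hσ

lemma integrable_max_mul_score (S c : ℝ) {τ : ℝ} (hτ : 0 < τ) {Θ : ℝ≥0} (hτΘ : τ ≤ Θ) :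
    Integrable (fun ω => max (S * wealth δ σ 0 (B · ω) τ + c) 0 * score δ σ Θ (B · ω) τ) P :=
  ((boundedMoments_max hB hm hδ σ (|S| + |c|) hτ.le Θ).mul
    ((boundedMoments_score hB hm hδ hσ Θ hτ).comp (fun p : ℝ × ℝ × ℝ => p.2.2)
      fun _ hp => hp.2.2)).integrable (i := (S, c, τ)) (mem_paramBox le_rfl hτΘ)

lemma integrable_wealth_mul_score {τ : ℝ} (hτ : 0 < τ) {Θ : ℝ≥0} (hτΘ : τ ≤ Θ) :
    Integrable (fun ω => wealth δ σ 0 (B · ω) τ * score δ σ Θ (B · ω) τ) P :=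
  (((boundedMoments_wealth hB hm hδ σ Θ).subset (Icc_subset_Icc_left hτ.le)).mul
    (boundedMoments_score hB hm hδ hσ Θ hτ)).integrable ⟨le_rfl, hτΘ⟩

end Integrability

/-- The integration by parts formula for the expectation of the positive part. -/
lemma integral_heaviside_mul_wealth (hB : IsBrownianReal B P) (hm : ∀ t, Measurable (B t))
    (hδ : 0 ≤ δ) (hσ : 0 < σ) {S : ℝ} (hS : 0 < S) (c : ℝ) {τ : ℝ} (hτ : 0 < τ) {Θ : ℝ≥0}
    (hτΘ : τ ≤ Θ) :
    ∫ ω, heaviside (S * wealth δ σ 0 (B · ω) τ + c) * (S * wealth δ σ 0 (B · ω) τ) ∂P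
      = ∫ ω, max (S * wealth δ σ 0 (B · ω) τ + c) 0 * score δ σ Θ (B · ω) τ ∂P := by
  have hΘ : 0 < Θ := by exact_mod_cast hτ.trans_le hτΘ
  have mY := measurable_wealth δ σ 0 τ
  have mp := measurable_path hm
  have mSYc : Measurable fun f => S * wealth δ σ 0 f τ + c := (mY.const_mul S).add_const c
  have i1 : Integrable (fun ω => heaviside (S * wealth δ σ 0 (B · ω) τ + c)
      * (S * wealth δ σ 0 (B · ω) τ)) P :=
    integrable_heaviside_mul (mSYc.comp mp) ((integrable_wealth hB hm hδ σ hτ.le).const_mul S)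
  have i2 := integrable_max_mul_score hB hm hδ hσ S c hτ hτΘ
  have i3 : Integrable (fun ω => max (S * wealth δ σ 0 (B · ω) τ + c) 0
      * (wealth δ σ 0 (B · ω) τ / (σ * wealth δ σ 1 (B · ω) τ))) P := by
    have := ((boundedMoments_max hB hm hδ σ (|S| + |c|) hτ.le Θ).mul
      (((boundedMoments_wealth_div hB hm hδ σ Θ hτ).const_mul σ⁻¹).comp
        (fun p : ℝ × ℝ × ℝ => p.2.2) fun p hp => hp.2.2)).integrable (i := (S, c, τ))
        (mem_paramBox le_rfl hτΘ)
    refine this.congr (ae_of_all _ fun ω => ?_)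
    simp only
    rw [mul_comm σ, ← div_div, div_eq_mul_inv _ σ, mul_comm _ σ⁻¹]
  rw [← sub_eq_zero, ← integral_sub i1 i2]
  have b1 := integral_path_eq_integral_bridge hB.toIsPreBrownianReal hm hΘ
    (Φ := fun f => heaviside (S * wealth δ σ 0 f τ + c) * (S * wealth δ σ 0 f τ)
      - max (S * wealth δ σ 0 f τ + c) 0 * score δ σ Θ f τ)
    (((measurable_heaviside.comp mSYc).mul (mY.const_mul S)).sub
      ((mSYc.max measurable_const).mul (measurable_score δ σ Θ τ)))
    (fun f g hfg => by
      simp only [wealth_congr 0 hτ.le hτΘ hfg, score_congr hτ.le hτΘ hfg]) (i1.sub i2)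
  have b3 := integral_path_eq_integral_bridge hB.toIsPreBrownianReal hm hΘ
    (Φ := fun f => max (S * wealth δ σ 0 f τ + c) 0
      * (wealth δ σ 0 f τ / (σ * wealth δ σ 1 f τ)))
    ((mSYc.max measurable_const).mul (mY.div ((measurable_wealth δ σ 1 τ).const_mul σ)))
    (fun f g hfg => by
      simp only [wealth_congr _ hτ.le hτΘ hfg]) i3
  rw [b1.2]
  refine integral_eq_zero_of_ae ?_
  -- By Fubini, for almost every bridge the two functions are integrable in the drift, as the
  -- one-dimensional formula requires.
  filter_upwards [hB.cont, b1.1.prod_right_ae, b3.1.prod_right_ae] with ω hω h1 h3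
  have hΘ' : (Θ : ℝ) ≠ 0 := by exact_mod_cast hΘ.ne'
  exact integral_driftPath_score (continuous_bridge hω Θ) hδ hσ hS c hτ hΘ
    (by simp [bridge, hΘ']) h3 h1

/-! ### The value of a call and its derivatives -/

/-- The expected positive part of `S Y + c`, where `Y` is the wealth at the time `τ`. -/
def callValue (P : Measure Ω) (B : ℝ≥0 → Ω → ℝ) (δ σ S c τ : ℝ) : ℝ :=
  ∫ ω, max (S * wealth δ σ 0 (B · ω) τ + c) 0 ∂P

/-- The derivative of `callValue` with respect to `c`. -/
def callProb (P : Measure Ω) (B : ℝ≥0 → Ω → ℝ) (δ σ S c τ : ℝ) : ℝ :=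
  ∫ ω, heaviside (S * wealth δ σ 0 (B · ω) τ + c) ∂P

/-- The derivative of `callValue` with respect to `S`. -/
def callDelta (P : Measure Ω) (B : ℝ≥0 → Ω → ℝ) (δ σ S c τ : ℝ) : ℝ :=
  ∫ ω, heaviside (S * wealth δ σ 0 (B · ω) τ + c) * wealth δ σ 0 (B · ω) τ ∂P

/-- The second derivative of `callValue` with respect to `S`. -/
def callGamma (P : Measure Ω) (B : ℝ≥0 → Ω → ℝ) (δ σ : ℝ) (Θ : ℝ≥0) (S c τ : ℝ) : ℝ :=
  -- Integration by parts writes `S * callDelta` as the expectation of the positive part times the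
  -- score. Differentiating both sides in `S` and solving for the second derivative gives this
  -- formula.
  (∫ ω, heaviside (S * wealth δ σ 0 (B · ω) τ + c)
    * (wealth δ σ 0 (B · ω) τ * score δ σ Θ (B · ω) τ) ∂P - callDelta P B δ σ S c τ) / S

section Derivatives

variable (hB : IsBrownianReal B P) (hm : ∀ t, Measurable (B t)) (hδ : 0 ≤ δ)

include hB hm hδ

/-- Euler's identity, since the positive part of `S * Y + c` is homogeneous of degree one in `(S,
c)`. It is what finally closes the differential equation. -/
lemma callValue_eq_add (σ S c : ℝ) {τ : ℝ} (hτ : 0 ≤ τ) :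
    callValue P B δ σ S c τ = S * callDelta P B δ σ S c τ + c * callProb P B δ σ S c τ := by
  have mSYc : Measurable fun ω => S * wealth δ σ 0 (B · ω) τ + c :=
    (((measurable_wealth δ σ 0 τ).comp (measurable_path hm)).const_mul S).add_const c
  have i1 := integrable_heaviside_mul mSYc (integrable_wealth hB hm hδ σ hτ)
  have i2 : Integrable (fun ω => heaviside (S * wealth δ σ 0 (B · ω) τ + c)) P := by
    simpa using integrable_heaviside_mul mSYc (integrable_const (1 : ℝ))
  unfold callValue callDelta callProb
  rw [← integral_const_mul, ← integral_const_mul,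
    ← integral_add (i1.const_mul S) (i2.const_mul c)]
  refine integral_congr_ae (ae_of_all _ fun ω => ?_)
  simp only [← heaviside_mul_self]
  ring

lemma abs_callValue_sub_le (σ : ℝ) {τ : ℝ} (hτ : 0 ≤ τ) (S S' c c' : ℝ) :
    |callValue P B δ σ S c τ - callValue P B δ σ S' c' τ|
      ≤ |S - S'| * ∫ ω, wealth δ σ 0 (B · ω) τ ∂P + |c - c'| := by
  have iY := integrable_wealth hB hm hδ σ hτ
  unfold callValue
  rw [← integral_sub (integrable_max hB hm hδ σ S c hτ) (integrable_max hB hm hδ σ S' c' hτ)]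
  refine abs_integral_le_integral_abs.trans ?_
  have e : |S - S'| * ∫ ω, wealth δ σ 0 (B · ω) τ ∂P + |c - c'|
      = ∫ ω, (|S - S'| * wealth δ σ 0 (B · ω) τ + |c - c'|) ∂P := by
    rw [integral_add (iY.const_mul _) (integrable_const _), integral_const_mul]
    simp
  rw [e]
  refine integral_mono ((integrable_max hB hm hδ σ S c hτ).sub
    (integrable_max hB hm hδ σ S' c' hτ)).abs ((iY.const_mul _).add (integrable_const _))
    fun ω => ?_
  have h0 := (wealth_zero_pos (σ := σ) hδ (B · ω) hτ).le
  refine (abs_max_zero_sub_le _ _).trans ?_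
  calc |S * wealth δ σ 0 (B · ω) τ + c - (S' * wealth δ σ 0 (B · ω) τ + c')|
      = |(S - S') * wealth δ σ 0 (B · ω) τ + (c - c')| := by ring_nf
    _ ≤ _ := (abs_add_le _ _).trans (by rw [abs_mul, abs_of_nonneg h0])

variable (hσ : 0 < σ)

include hσ

lemma hasDerivAt_callValue_right {S : ℝ} (hS : 0 < S) (c : ℝ) {τ : ℝ} (hτ : 0 < τ) :
    HasDerivAt (fun c => callValue P B δ σ S c τ) (callProb P B δ σ S c τ) c := by
  have mSY : Measurable fun ω => S * wealth δ σ 0 (B · ω) τ :=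
    ((measurable_wealth δ σ 0 τ).comp (measurable_path hm)).const_mul S
  have h := hasDerivAt_integral_max (P := P) (X := fun _ => 1)
    (a := fun ω => S * wealth δ σ 0 (B · ω) τ) (w := fun _ => 1) (s := c) measurable_const mSY
    measurable_const (fun t => by
      simpa [add_comm] using integrable_max hB hm hδ σ S t hτ.le) (by simp) (by
      filter_upwards [ae_mul_wealth_add_ne_zero hB hm hδ hσ hS c hτ] with ω hω
      rwa [mul_one, add_comm])
  simpa [callValue, callProb, add_comm] using h

lemma hasDerivAt_callValue_left {S : ℝ} (hS : 0 < S) (c : ℝ) {τ : ℝ} (hτ : 0 < τ) :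
    HasDerivAt (fun S => callValue P B δ σ S c τ) (callDelta P B δ σ S c τ) S := by
  have h := hasDerivAt_integral_max (P := P) (X := fun ω => wealth δ σ 0 (B · ω) τ)
    (a := fun _ => c) (w := fun _ => 1) (s := S)
    ((measurable_wealth δ σ 0 τ).comp (measurable_path hm)) measurable_const
    measurable_const (fun t => by simpa using integrable_max hB hm hδ σ t c hτ.le)
    (by simpa using integrable_wealth hB hm hδ σ hτ.le)
    (ae_mul_wealth_add_ne_zero hB hm hδ hσ hS c hτ)
  simpa [callValue, callDelta] using h

/-- The indicator in `callDelta` cannot be differentiated under the expectation. After integration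
by parts a positive part stands in its place, and that can. -/
lemma hasDerivAt_callDelta {S : ℝ} (hS : 0 < S) (c : ℝ) {τ : ℝ} (hτ : 0 < τ) {Θ : ℝ≥0}
    (hτΘ : τ ≤ Θ) :
    HasDerivAt (fun S => callDelta P B δ σ S c τ) (callGamma P B δ σ Θ S c τ) S := by
  have h := hasDerivAt_integral_max (P := P) (X := fun ω => wealth δ σ 0 (B · ω) τ)
    (a := fun _ => c) (w := fun ω => score δ σ Θ (B · ω) τ) (s := S)
    ((measurable_wealth δ σ 0 τ).comp (measurable_path hm)) measurable_const
    ((measurable_score δ σ Θ τ).comp (measurable_path hm))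
    (fun t => integrable_max_mul_score hB hm hδ hσ t c hτ hτΘ)
    (integrable_wealth_mul_score hB hm hδ hσ hτ hτΘ)
    (ae_mul_wealth_add_ne_zero hB hm hδ hσ hS c hτ)
  have e : ∀ s : ℝ, 0 < s → s * callDelta P B δ σ s c τ
      = ∫ ω, max (s * wealth δ σ 0 (B · ω) τ + c) 0 * score δ σ Θ (B · ω) τ ∂P := by
    intro s hs
    rw [← integral_heaviside_mul_wealth hB hm hδ hσ hs c hτ hτΘ, callDelta, ← integral_const_mul]
    refine integral_congr_ae (ae_of_all _ fun ω => ?_)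
    simp only
    ring
  have h2 := h.fun_div (hasDerivAt_id S) hS.ne'
  rw [← e S hS] at h2
  refine (h2.congr_of_eventuallyEq ?_).congr_deriv ?_
  · filter_upwards [eventually_gt_nhds hS] with s hs
    rw [← e s hs, id]
    field_simp
  · unfold callGamma
    simp only [id]
    field_simp

end Derivatives

/-! ### Joint continuity -/

lemma continuousOn_integral {Z : ℝ × ℝ × ℝ → Ω → ℝ} {D : Set (ℝ × ℝ × ℝ)}
    (hbox : ∀ p₀ ∈ D, ∃ s, BoundedMoments P Z s ∧ ∀ᶠ p in 𝓝[D] p₀, p ∈ s)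
    (hc : ∀ p₀ ∈ D, ∀ᵐ ω ∂P, ContinuousWithinAt (Z · ω) D p₀) :
    ContinuousOn (fun p => ∫ ω, Z p ω ∂P) D := fun p₀ hp₀ => by
  obtain ⟨s, hs, hev⟩ := hbox p₀ hp₀
  exact hs.tendsto_integral hev (hc p₀ hp₀)

lemma eventually_mem_paramBox {D : Set (ℝ × ℝ × ℝ)} {a Θ : ℝ} (p₀ : ℝ × ℝ × ℝ)
    (ha : ∀ᶠ p in 𝓝[D] p₀, a ≤ p.2.2) (hΘ : ∀ p ∈ D, p.2.2 ≤ Θ) :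
    ∀ᶠ p in 𝓝[D] p₀, p ∈ paramBox (|p₀.1| + |p₀.2.1| + 1) a Θ := by
  have h1 : ∀ᶠ p in 𝓝[D] p₀, |p.1| < |p₀.1| + |p₀.2.1| + 1 :=
    (continuous_fst.abs.continuousAt.eventually_lt continuousAt_const
      (by have := abs_nonneg p₀.2.1; linarith)).filter_mono nhdsWithin_le_nhds
  have h2 : ∀ᶠ p in 𝓝[D] p₀, |p.2.1| < |p₀.1| + |p₀.2.1| + 1 :=
    ((continuous_fst.comp continuous_snd).abs.continuousAt.eventually_lt continuousAt_const
      (by have := abs_nonneg p₀.1; simp only [Function.comp]; linarith)).filter_mono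
        nhdsWithin_le_nhds
  filter_upwards [h1, h2, ha, self_mem_nhdsWithin] with p h1 h2 h3 h4
  exact ⟨abs_le.1 h1.le, abs_le.1 h2.le, h3, hΘ p h4⟩

/-- The parameters `(S, c, τ)` at which `callValue` is smooth. -/
def smoothRegion (Θ : ℝ) : Set (ℝ × ℝ × ℝ) := Ioi 0 ×ˢ univ ×ˢ Ioc 0 Θ

section Continuity

variable (hB : IsBrownianReal B P) (hm : ∀ t, Measurable (B t)) (hδ : 0 ≤ δ)

include hB hm hδ

lemma continuousOn_callValue (σ : ℝ) (Θ : ℝ≥0) :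
    ContinuousOn (fun p : ℝ × ℝ × ℝ => callValue P B δ σ p.1 p.2.1 p.2.2)
      (univ ×ˢ univ ×ˢ Icc 0 (Θ : ℝ)) := by
  refine continuousOn_integral (fun p₀ _ => ⟨_, boundedMoments_max hB hm hδ σ
    (|p₀.1| + |p₀.2.1| + 1) le_rfl Θ, eventually_mem_paramBox p₀ ?_ fun p hp => hp.2.2.2⟩)
    fun p₀ _ => ?_
  · filter_upwards [self_mem_nhdsWithin] with p hp using hp.2.2.1
  · filter_upwards [hB.cont] with ω hω
    have := continuous_wealth (δ := δ) (σ := σ) hω 0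
    exact Continuous.continuousWithinAt (by fun_prop)

variable (hσ : 0 < σ)

include hσ

/-- At a given parameter the jump of the indicator is met with probability zero, so the integrand
converges almost surely, and the moments of `X` allow passing to the limit. Half the time of the
base point serves as the lower bound `a` nearby. -/
lemma continuousOn_integral_heaviside {Θ : ℝ≥0} {X : ℝ → Ω → ℝ}
    (hX : ∀ a : ℝ, 0 < a → BoundedMoments P X (Icc a Θ))
    (hXc : ∀ᵐ ω ∂P, ContinuousOn (X · ω) (Ioi 0)) :
    ContinuousOn (fun p : ℝ × ℝ × ℝ =>
      ∫ ω, heaviside (p.1 * wealth δ σ 0 (B · ω) p.2.2 + p.2.1) * X p.2.2 ω ∂P)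
      (smoothRegion Θ) := by
  refine continuousOn_integral (fun p₀ hp₀ => ⟨paramBox (|p₀.1| + |p₀.2.1| + 1) (p₀.2.2 / 2) Θ,
    ?_, eventually_mem_paramBox p₀ ?_ fun p hp => hp.2.2.2⟩) fun p₀ hp₀ => ?_
  · have h1 : BoundedMoments P (fun (p : ℝ × ℝ × ℝ) ω => X p.2.2 ω)
        (paramBox (|p₀.1| + |p₀.2.1| + 1) (p₀.2.2 / 2) Θ) :=
      (hX (p₀.2.2 / 2) (half_pos hp₀.2.2.1)).comp (fun p : ℝ × ℝ × ℝ => p.2.2) fun p hp => hp.2.2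
    refine h1.mono (fun p hp => ?_) fun p _ => ae_of_all _ fun ω => ?_
    · have := (measurable_wealth δ σ 0 p.2.2).comp (measurable_path hm)
      exact (measurable_heaviside.comp
        ((this.const_mul p.1).add_const p.2.1)).aestronglyMeasurable.mul (h1.aesm p hp)
    · rw [abs_mul]
      exact mul_le_of_le_one_left (abs_nonneg _) (abs_heaviside_le _)
  · refine Eventually.filter_mono nhdsWithin_le_nhds ?_
    have h : p₀.2.2 / 2 < p₀.2.2 := half_lt_self hp₀.2.2.1
    filter_upwards [(continuous_snd.comp continuous_snd).continuousAt.eventually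
      (lt_mem_nhds h)] with p hp using le_of_lt hp
  · filter_upwards [hB.cont, hXc, ae_mul_wealth_add_ne_zero hB hm hδ hσ hp₀.1 p₀.2.1 hp₀.2.2.1]
      with ω hω hXω hne
    have hc : Continuous fun p : ℝ × ℝ × ℝ => p.1 * wealth δ σ 0 (B · ω) p.2.2 + p.2.1 := by
      have := continuous_wealth (δ := δ) (σ := σ) hω 0
      fun_prop
    have h1 : ContinuousAt (fun p : ℝ × ℝ × ℝ =>
        heaviside (p.1 * wealth δ σ 0 (B · ω) p.2.2 + p.2.1)) p₀ :=
      ContinuousAt.comp (f := fun p : ℝ × ℝ × ℝ => p.1 * wealth δ σ 0 (B · ω) p.2.2 + p.2.1)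
        (continuousAt_heaviside hne) hc.continuousAt
    have h2 : ContinuousAt (fun p : ℝ × ℝ × ℝ => X p.2.2 ω) p₀ :=
      ContinuousAt.comp (g := (X · ω)) (f := fun p : ℝ × ℝ × ℝ => p.2.2)
        (hXω.continuousAt (Ioi_mem_nhds hp₀.2.2.1))
        (continuous_snd.comp continuous_snd).continuousAt
    exact (h1.mul h2).continuousWithinAt

lemma continuousOn_callProb (Θ : ℝ≥0) :
    ContinuousOn (fun p : ℝ × ℝ × ℝ => callProb P B δ σ p.1 p.2.1 p.2.2) (smoothRegion Θ) := by
  have := continuousOn_integral_heaviside hB hm hδ hσ (Θ := Θ) (X := fun _ _ => 1)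
    (fun a _ => BoundedMoments.const 1) (ae_of_all _ fun ω => continuousOn_const)
  simpa [callProb] using this

lemma continuousOn_callDelta (Θ : ℝ≥0) :
    ContinuousOn (fun p : ℝ × ℝ × ℝ => callDelta P B δ σ p.1 p.2.1 p.2.2) (smoothRegion Θ) :=
  continuousOn_integral_heaviside hB hm hδ hσ
    (fun a ha => (boundedMoments_wealth hB hm hδ σ Θ).subset (Icc_subset_Icc_left ha.le))
    (by filter_upwards [hB.cont] with ω hω using (continuous_wealth hω 0).continuousOn)

lemma continuousOn_callGamma (Θ : ℝ≥0) :
    ContinuousOn (fun p : ℝ × ℝ × ℝ => callGamma P B δ σ Θ p.1 p.2.1 p.2.2)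
      (smoothRegion Θ) := by
  refine ((continuousOn_integral_heaviside hB hm hδ hσ
    (X := fun τ ω => wealth δ σ 0 (B · ω) τ * score δ σ Θ (B · ω) τ) (fun a ha =>
    ((boundedMoments_wealth hB hm hδ σ Θ).subset (Icc_subset_Icc_left ha.le)).mul
    (boundedMoments_score hB hm hδ hσ Θ ha)) ?_).sub
    (continuousOn_callDelta hB hm hδ hσ Θ)).div continuousOn_fst fun p hp => (ne_of_gt hp.1)
  filter_upwards [hB.cont] with ω hω
  exact (continuous_wealth hω 0).continuousOn.mul (continuousOn_score hδ hσ.ne' Θ hω)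

end Continuity

end Regularity

end

section

/-! ### Two calculus lemmas -/

/-- A continuous function with a continuous right derivative is differentiable. -/
lemma hasDerivAt_of_hasDerivWithinAt_Ici {f f' : ℝ → ℝ} {l u : ℝ} (hf : ContinuousOn f (Ioo l u))
    (hf' : ContinuousOn f' (Ioo l u))
    (h : ∀ x ∈ Ioo l u, HasDerivWithinAt f (f' x) (Ici x) x) {x : ℝ} (hx : x ∈ Ioo l u) :
    HasDerivAt f (f' x) x := by
  obtain ⟨a, ha⟩ := exists_between hx.1
  obtain ⟨b, hb⟩ := exists_between hx.2
  have hsub : Icc a b ⊆ Ioo l u := fun y hy => ⟨ha.1.trans_le hy.1, hy.2.trans_lt hb.2⟩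
  have hint : ∀ y ∈ Icc a b, IntervalIntegrable f' volume a y := fun y hy =>
    (hf'.mono (by
      rw [uIcc_of_le hy.1]
      exact (Icc_subset_Icc_right hy.2).trans hsub)).intervalIntegrable
  have hd : ∀ y ∈ Icc a b, HasDerivAt (fun z => ∫ w in a..z, f' w) (f' y) y := fun y hy =>
    intervalIntegral.integral_hasDerivAt_right (hint y hy)
      (hf'.stronglyMeasurableAtFilter isOpen_Ioo y (hsub hy))
      (hf'.continuousAt (Ioo_mem_nhds (hsub hy).1 (hsub hy).2))
  -- The difference between `f` and a primitive of `f'` has vanishing right derivative, hence is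
  -- constant.
  have hconst := constant_of_has_deriv_right_zero (f := fun z => f z - ∫ w in a..z, f' w)
    (a := a) (b := b) ((hf.mono hsub).sub fun y hy => (hd y hy).continuousAt.continuousWithinAt)
    fun y hy => by
      simpa using (h y (hsub ⟨hy.1, hy.2.le⟩)).fun_sub (hd y ⟨hy.1, hy.2.le⟩).hasDerivWithinAt
  have hx' : x ∈ Icc a b := ⟨ha.2.le, hb.1.le⟩
  refine ((hd x hx').const_add (f a)).congr_of_eventuallyEq ?_
  filter_upwards [Icc_mem_nhds ha.2 hb.1] with y hy
  have := hconst y hy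
  simp only [intervalIntegral.integral_same, sub_zero] at this
  linarith

/-- A second order Taylor estimate. -/
lemma abs_taylor_two_le {f f' f'' : ℝ → ℝ} {x₀ η k ε : ℝ}
    (h1 : ∀ x ∈ Metric.ball x₀ η, HasDerivAt f (f' x) x)
    (h2 : ∀ x ∈ Metric.ball x₀ η, HasDerivAt f' (f'' x) x)
    (hk : ∀ x ∈ Metric.ball x₀ η, |f'' x - k| ≤ ε) {x : ℝ} (hx : x ∈ Metric.ball x₀ η) :
    |f x - f x₀ - f' x₀ * (x - x₀) - k / 2 * (x - x₀) ^ 2| ≤ ε * (x - x₀) ^ 2 := by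
  have hη : 0 < η := dist_nonneg.trans_lt hx
  have hx₀ : x₀ ∈ Metric.ball x₀ η := Metric.mem_ball_self hη
  have hε : 0 ≤ ε := (abs_nonneg _).trans (hk x hx)
  -- The mean value inequality is used twice, here for `f'` and below for `f`; this yields the
  -- constant `ε` rather than `ε / 2`.
  have b1 : ∀ y ∈ Metric.ball x₀ η, |f' y - f' x₀ - k * (y - x₀)| ≤ ε * |y - x₀| := by
    intro y hy
    have d : ∀ z ∈ Metric.ball x₀ η,
        HasDerivWithinAt (fun z => f' z - k * z) (f'' z - k) (Metric.ball x₀ η) z := fun z hz => by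
      simpa using ((h2 z hz).fun_sub ((hasDerivAt_id z).const_mul k)).hasDerivWithinAt
    have := Convex.norm_image_sub_le_of_norm_hasDerivWithin_le d hk (convex_ball x₀ η) hx₀ hy
    simp only [Real.norm_eq_abs] at this
    calc |f' y - f' x₀ - k * (y - x₀)| = |f' y - k * y - (f' x₀ - k * x₀)| := by ring_nf
      _ ≤ _ := this
  have hsub : uIcc x₀ x ⊆ Metric.ball x₀ η := by
    rw [← segment_eq_uIcc]
    exact (convex_ball x₀ η).segment_subset hx₀ hx
  have d : ∀ z ∈ uIcc x₀ x, HasDerivWithinAt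
      (fun z => f z - f' x₀ * (z - x₀) - k / 2 * (z - x₀) ^ 2)
      (f' z - f' x₀ - k * (z - x₀)) (uIcc x₀ x) z := fun z hz => by
    have e1 := (hasDerivAt_id z).sub_const x₀
    have e2 := ((h1 z (hsub hz)).sub (e1.const_mul (f' x₀))).sub ((e1.pow 2).const_mul (k / 2))
    refine HasDerivAt.hasDerivWithinAt (e2.congr_deriv ?_)
    simp only [id]
    push_cast
    ring
  have hb : ∀ z ∈ uIcc x₀ x, ‖f' z - f' x₀ - k * (z - x₀)‖ ≤ ε * |x - x₀| := fun z hz => by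
    refine (b1 z (hsub hz)).trans ?_
    exact mul_le_mul_of_nonneg_left (abs_sub_left_of_mem_uIcc hz) hε
  have := Convex.norm_image_sub_le_of_norm_hasDerivWithin_le d hb (convex_uIcc x₀ x)
    left_mem_uIcc right_mem_uIcc
  simp only [Real.norm_eq_abs, sub_self, mul_zero, ne_eq, OfNat.ofNat_ne_zero, not_false_eq_true,
    zero_pow, sub_zero] at this
  calc |f x - f x₀ - f' x₀ * (x - x₀) - k / 2 * (x - x₀) ^ 2|
      = |f x - f' x₀ * (x - x₀) - k / 2 * (x - x₀) ^ 2 - f x₀| := by ring_nf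
    _ ≤ ε * |x - x₀| * |x - x₀| := this
    _ = ε * (x - x₀) ^ 2 := by rw [mul_assoc, ← sq, sq_abs]

variable {Ω : Type*} {mΩ : MeasurableSpace Ω} {P : Measure Ω} {B : ℝ≥0 → Ω → ℝ} {δ σ : ℝ}

/-! ### The Markov property -/

lemma indepFun_wealth_shiftPath (hB : IsPreBrownianReal B P) (δ σ τ : ℝ) (h : ℝ≥0) :
    IndepFun (fun ω => (gbm δ σ (B · ω) h, gbmInt δ σ 0 (B · ω) h))
      (fun ω => wealth δ σ 0 (shiftPath h (B · ω)) τ) P := by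
  -- A path on `[0, h]` is continued as a constant, which does not change the functionals at the
  -- time `h`.
  set ext : (Iic h → ℝ) → ℝ≥0 → ℝ := fun x s => x ⟨min s h, min_le_right s h⟩
  have hext : Measurable ext := measurable_pi_lambda _ fun s => measurable_pi_apply _
  have h1 := (hB.indepFun_shift h).symm.comp
    (((measurable_gbm_left δ σ h).prodMk (measurable_gbmInt δ σ 0 h)).comp hext)
    (measurable_wealth δ σ 0 τ)
  have e : (fun ω => (gbm δ σ (B · ω) h, gbmInt δ σ 0 (B · ω) h))
      = ((fun f : ℝ≥0 → ℝ => (gbm δ σ f h, gbmInt δ σ 0 f h)) ∘ ext)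
        ∘ fun ω (t : Iic h) => B t ω := by
    ext ω
    · exact (gbm_min (B · ω) le_rfl).symm
    · exact (gbmInt_min (B · ω) 0 h).symm
  rw [e]
  exact h1

/-- The Markov property: the increments after `h` are independent of the past and again Brownian,
and `wealth_add` absorbs the past into the arguments `S` and `c`. -/
lemma callValue_add [IsProbabilityMeasure P] (hB : IsBrownianReal B P)
    (hm : ∀ t, Measurable (B t)) (hδ : 0 ≤ δ) (σ S c : ℝ) (h : ℝ≥0) {τ : ℝ} (hτ : 0 ≤ τ) :
    callValue P B δ σ S c (h + τ)
      = ∫ ω, callValue P B δ σ (S * gbm δ σ (B · ω) h)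
          (c + S * δ * gbmInt δ σ 0 (B · ω) h) τ ∂P := by
  have mp := measurable_path hm
  have mX : Measurable fun ω => (gbm δ σ (B · ω) h, gbmInt δ σ 0 (B · ω) h) :=
    ((measurable_gbm_left δ σ h).comp mp).prodMk ((measurable_gbmInt δ σ 0 h).comp mp)
  have mY : Measurable fun ω => wealth δ σ 0 (shiftPath h (B · ω)) τ :=
    (measurable_wealth δ σ 0 τ).comp (measurable_path (measurable_shiftPath hm h))
  set Ψ : (ℝ × ℝ) × ℝ → ℝ := fun q => max (S * q.1.1 * q.2 + (c + S * δ * q.1.2)) 0 with hΨ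
  have mΨ : Measurable Ψ := by fun_prop
  have e1 : (fun ω => max (S * wealth δ σ 0 (B · ω) (h + τ) + c) 0) =ᵐ[P]
      fun ω => Ψ ((gbm δ σ (B · ω) h, gbmInt δ σ 0 (B · ω) h),
        wealth δ σ 0 (shiftPath h (B · ω)) τ) := by
    filter_upwards [hB.cont] with ω hω
    simp only [hΨ]
    rw [wealth_add hω h hτ]
    ring_nf
  have hlaw := (indepFun_iff_map_prod_eq_prod_map_map mX.aemeasurable mY.aemeasurable).1
    (indepFun_wealth_shiftPath hB.toIsPreBrownianReal δ σ τ h)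
  have mXY := mX.prodMk mY
  have hint : Integrable Ψ ((P.map fun ω => (gbm δ σ (B · ω) h, gbmInt δ σ 0 (B · ω) h)).prod
      (P.map fun ω => wealth δ σ 0 (shiftPath h (B · ω)) τ)) := by
    rw [← hlaw, integrable_map_measure mΨ.aestronglyMeasurable mXY.aemeasurable]
    exact (integrable_max hB hm hδ σ S c (add_nonneg h.coe_nonneg hτ)).congr e1
  have e2 := integral_map mXY.aemeasurable (mΨ.aestronglyMeasurable (μ := P.map fun ω =>
    ((gbm δ σ (B · ω) h, gbmInt δ σ 0 (B · ω) h), wealth δ σ 0 (shiftPath h (B · ω)) τ)))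
  unfold callValue
  rw [integral_congr_ae e1, ← e2, hlaw, integral_prod _ hint,
    integral_map mX.aemeasurable hint.aestronglyMeasurable.integral_prod_right']
  refine integral_congr_ae (ae_of_all _ fun ω => ?_)
  simp only
  have e3 := integral_map mY.aemeasurable ((mΨ.comp (measurable_prodMk_left
    (x := (gbm δ σ (B · ω) h, gbmInt δ σ 0 (B · ω) h)))).aestronglyMeasurable
      (μ := P.map fun ω => wealth δ σ 0 (shiftPath h (B · ω)) τ))
  refine e3.trans ?_
  exact (integral_path_eq hB.toIsPreBrownianReal
    (isBrownianReal_shiftPath hB h).toIsPreBrownianReal hm (measurable_shiftPath hm h)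
    (Φ := fun f => max (S * gbm δ σ (B · ω) h * wealth δ σ 0 f τ
      + (c + S * δ * gbmInt δ σ 0 (B · ω) h)) 0)
    ((((measurable_wealth δ σ 0 τ).const_mul _).add_const _).max measurable_const)).symm

/-! ### Short time moments -/

/-- The second moment of the return of the discounted stock. -/
def secondMoment (δ σ h : ℝ) : ℝ :=
  Real.exp (h * (-2 * δ + σ ^ 2)) - 2 * Real.exp (-h * δ) + 1

/-- The fourth moment of the return of the discounted stock. -/
def fourthMoment (δ σ h : ℝ) : ℝ :=
  Real.exp (h * (-4 * δ + 6 * σ ^ 2)) - 4 * Real.exp (h * (-3 * δ + 3 * σ ^ 2))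
    + 6 * Real.exp (h * (-2 * δ + σ ^ 2)) - 4 * Real.exp (-h * δ) + 1

lemma hasDerivAt_exp_mul_zero (a : ℝ) : HasDerivAt (fun h : ℝ => Real.exp (h * a)) a 0 := by
  simpa using ((hasDerivAt_id (0 : ℝ)).mul_const a).exp

lemma hasDerivAt_exp_neg_mul_zero (a : ℝ) : HasDerivAt (fun h : ℝ => Real.exp (-h * a)) (-a) 0 := by
  simpa using ((hasDerivAt_id (0 : ℝ)).neg.mul_const a).exp

lemma hasDerivAt_secondMoment (δ σ : ℝ) : HasDerivAt (secondMoment δ σ) (σ ^ 2) 0 :=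
  (((hasDerivAt_exp_mul_zero (-2 * δ + σ ^ 2)).sub
    ((hasDerivAt_exp_neg_mul_zero δ).const_mul 2)).add_const 1).congr_deriv (by ring)

/-- The fourth moment is `o(h)`, which makes large moves of the stock negligible in the Taylor
expansion. -/
lemma hasDerivAt_fourthMoment (δ σ : ℝ) : HasDerivAt (fourthMoment δ σ) 0 0 :=
  (((((hasDerivAt_exp_mul_zero (-4 * δ + 6 * σ ^ 2)).sub
    ((hasDerivAt_exp_mul_zero (-3 * δ + 3 * σ ^ 2)).const_mul 4)).add
    ((hasDerivAt_exp_mul_zero (-2 * δ + σ ^ 2)).const_mul 6)).sub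
    ((hasDerivAt_exp_neg_mul_zero δ).const_mul 4)).add_const 1).congr_deriv (by ring)

section ShortTime

variable [IsProbabilityMeasure P] (hB : IsBrownianReal B P)

include hB

lemma integral_gbm (δ σ : ℝ) {h : ℝ} (hh : 0 ≤ h) :
    Integrable (fun ω => gbm δ σ (B · ω) h) P ∧
      ∫ ω, gbm δ σ (B · ω) h ∂P = Real.exp (-h * δ) := by
  have := integral_gbm_rpow hB δ σ hh 1
  norm_num at this
  refine ⟨this.1, this.2.trans (by ring_nf)⟩

lemma integral_gbm_sub_one_sq (δ σ : ℝ) {h : ℝ} (hh : 0 ≤ h) :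
    Integrable (fun ω => (gbm δ σ (B · ω) h - 1) ^ 2) P ∧
      ∫ ω, (gbm δ σ (B · ω) h - 1) ^ 2 ∂P = secondMoment δ σ h := by
  obtain ⟨i1, e1⟩ := integral_gbm hB δ σ hh
  obtain ⟨i2, e2⟩ := integral_gbm_rpow hB δ σ hh 2
  have e : ∀ ω, (gbm δ σ (B · ω) h - 1) ^ 2
      = gbm δ σ (B · ω) h ^ 2 - 2 * gbm δ σ (B · ω) h + 1 := fun ω => by ring
  simp only [e]
  have i12 := i2.sub (i1.const_mul 2)
  refine ⟨i12.add (integrable_const 1), ?_⟩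
  rw [integral_add (f := fun ω => _ - _) i12 (integrable_const 1),
    integral_sub i2 (i1.const_mul 2), integral_const_mul, e1, e2]
  simp only [integral_const, probReal_univ, smul_eq_mul, mul_one, secondMoment]
  push_cast
  ring_nf

lemma integral_gbm_sub_one_fourth (δ σ : ℝ) {h : ℝ} (hh : 0 ≤ h) :
    Integrable (fun ω => (gbm δ σ (B · ω) h - 1) ^ 4) P ∧
      ∫ ω, (gbm δ σ (B · ω) h - 1) ^ 4 ∂P = fourthMoment δ σ h := by
  obtain ⟨i1, e1⟩ := integral_gbm hB δ σ hh
  obtain ⟨i2, e2⟩ := integral_gbm_rpow hB δ σ hh 2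
  obtain ⟨i3, e3⟩ := integral_gbm_rpow hB δ σ hh 3
  obtain ⟨i4, e4⟩ := integral_gbm_rpow hB δ σ hh 4
  have e : ∀ ω, (gbm δ σ (B · ω) h - 1) ^ 4 = gbm δ σ (B · ω) h ^ 4 - 4 * gbm δ σ (B · ω) h ^ 3
      + 6 * gbm δ σ (B · ω) h ^ 2 - 4 * gbm δ σ (B · ω) h + 1 := fun ω => by ring
  simp only [e]
  have j1 := i4.sub (i3.const_mul 4)
  have j2 := j1.add (i2.const_mul 6)
  have j3 := j2.sub (i1.const_mul 4)
  refine ⟨j3.add (integrable_const 1), ?_⟩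
  rw [integral_add (f := fun ω => _ - _) j3 (integrable_const 1),
    integral_sub (f := fun ω => _ + _) j2 (i1.const_mul 4),
    integral_add (f := fun ω => _ - _) j1 (i2.const_mul 6),
    integral_sub i4 (i3.const_mul 4), integral_const_mul, integral_const_mul, integral_const_mul,
    e1, e2, e3, e4]
  simp only [integral_const, probReal_univ, smul_eq_mul, mul_one, fourthMoment]
  push_cast
  ring_nf

variable (hm : ∀ t, Measurable (B t))

include hm

/-- The accumulated discounted stock over a short time `h` is `h` to first order, in mean. -/
lemma eventually_integral_abs_gbmInt_sub_le (δ σ : ℝ) {ε : ℝ} (hε : 0 < ε) :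
    ∀ᶠ h in 𝓝[≥] (0 : ℝ), ∫ ω, |gbmInt δ σ 0 (B · ω) h - h| ∂P ≤ ε * h := by
  -- Continuity in mean square at time zero. Truncation at `M = ε / 2` then bounds the mean of `|gbm
  -- - 1|` by `ε / 2 + ε / 2`.
  have hq : ∀ᶠ w in 𝓝 (0 : ℝ), secondMoment δ σ w < (ε / 2) ^ 2 := by
    refine (hasDerivAt_secondMoment δ σ).continuousAt.eventually_lt continuousAt_const ?_
    have : secondMoment δ σ 0 = 0 := by norm_num [secondMoment]
    rw [this]
    positivity
  obtain ⟨η, hη, hqη⟩ := Metric.eventually_nhds_iff.1 hq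
  have h1 : ∀ w, 0 ≤ w → w < η → ∫⁻ ω, ‖gbm δ σ (B · ω) w - 1‖ₑ ∂P ≤ ENNReal.ofReal ε := by
    intro w hw hwη
    obtain ⟨i2, e2⟩ := integral_gbm_sub_one_sq hB δ σ hw
    have i1 := (integral_gbm hB δ σ hw).1.sub (integrable_const (1 : ℝ))
    have h2 : ∫ ω, |gbm δ σ (B · ω) w - 1| ∂P ≤ ε := by
      calc ∫ ω, |gbm δ σ (B · ω) w - 1| ∂P
          ≤ ∫ ω, (ε / 2 + (gbm δ σ (B · ω) w - 1) ^ 2 / (ε / 2)) ∂P := by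
            refine integral_mono i1.abs ((integrable_const _).add (i2.div_const _)) fun ω => ?_
            refine (sub_le_min_add_sq _ (half_pos hε)).trans ?_
            gcongr
            exact min_le_right _ _
        _ = ε / 2 + secondMoment δ σ w / (ε / 2) := by
            rw [integral_add (integrable_const _) (i2.div_const _), integral_div (ε / 2) (fun ω =>
              (gbm δ σ (B · ω) w - 1) ^ 2), e2]
            simp
        _ ≤ ε / 2 + (ε / 2) ^ 2 / (ε / 2) := by
            gcongr
            exact (hqη (by rwa [Real.dist_eq, sub_zero, abs_of_nonneg hw])).le
        _ = ε := by field_simp; ring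
    have h3 := ofReal_integral_norm_eq_lintegral_enorm i1
    simp only [Real.norm_eq_abs] at h3
    exact h3.symm.le.trans (ENNReal.ofReal_le_ofReal h2)
  have hmeas : Measurable fun p : Ω × ℝ => ‖gbm δ σ (B · p.1) p.2 - 1‖ₑ :=
    (((measurable_gbm δ σ).comp
      (((measurable_path hm).comp measurable_fst).prodMk measurable_snd)).sub_const 1).enorm
  filter_upwards [self_mem_nhdsWithin, nhdsWithin_le_nhds (Iio_mem_nhds hη)] with h hh0 hhη
  have hh : 0 ≤ h := hh0
  have mA : AEStronglyMeasurable (fun ω => gbmInt δ σ 0 (B · ω) h - h) P :=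
    (((measurable_gbmInt δ σ 0 h).comp (measurable_path hm)).sub_const h).aestronglyMeasurable
  rw [integral_eq_lintegral_of_nonneg_ae (ae_of_all _ fun _ => abs_nonneg _) mA.norm]
  refine ENNReal.toReal_le_of_le_ofReal (by positivity) ?_
  calc ∫⁻ ω, ENNReal.ofReal |gbmInt δ σ 0 (B · ω) h - h| ∂P
      ≤ ∫⁻ ω, (∫⁻ w in Ioc 0 h, ‖gbm δ σ (B · ω) w - 1‖ₑ) ∂P := by
        refine lintegral_mono_ae ?_
        filter_upwards [hB.cont] with ω hω
        have e : gbmInt δ σ 0 (B · ω) h - h = ∫ w in Ioc 0 h, (gbm δ σ (B · ω) w - 1) := by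
          rw [← intervalIntegral.integral_of_le hh, intervalIntegral.integral_sub
            ((continuous_gbm hω).intervalIntegrable _ _) intervalIntegrable_const]
          simp [gbmInt]
        rw [e, ← Real.norm_eq_abs, ofReal_norm]
        exact enorm_integral_le_lintegral_enorm _
    _ = ∫⁻ w in Ioc (0 : ℝ) h, ∫⁻ ω, ‖gbm δ σ (B · ω) w - 1‖ₑ ∂P :=
        lintegral_lintegral_swap hmeas.aemeasurable
    _ ≤ ∫⁻ _ in Ioc (0 : ℝ) h, ENNReal.ofReal ε :=
        setLIntegral_mono (μ := volume) measurable_const fun w hw => h1 w hw.1.le (hw.2.trans_lt hhη)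
    _ = ENNReal.ofReal (ε * h) := by
        rw [lintegral_const]
        simp [ENNReal.ofReal_mul hε.le]

end ShortTime

end

/-! ### The derivative in time. -/

section

lemma hasDerivWithinAt_zero_of_eventually_le {e : ℝ → ℝ}
    (h : ∀ ε > 0, ∀ᶠ x in 𝓝[≥] (0 : ℝ), |e x| ≤ ε * x) : HasDerivWithinAt e 0 (Ici 0) 0 := by
  have h0 : e 0 = 0 := by
    have := (h 1 one_pos).self_of_nhdsWithin (mem_Ici.2 le_rfl)
    simpa using this
  rw [hasDerivWithinAt_iff_isLittleO, Asymptotics.isLittleO_iff]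
  intro ε hε
  filter_upwards [h ε hε, self_mem_nhdsWithin] with x hx hx0
  simpa [h0, abs_of_nonneg (mem_Ici.1 hx0)] using hx

/-- As `a` vanishes at `x`, the factor `g` need not be differentiable. It is applied to `callDelta`
as a function of `c`, of which only continuity is known. -/
lemma hasDerivAt_mul_of_continuousAt {g a : ℝ → ℝ} {a' x : ℝ} (hg : ContinuousAt g x)
    (ha : HasDerivAt a a' x) (h0 : a x = 0) : HasDerivAt (fun y => g y * a y) (g x * a') x := by
  rw [hasDerivAt_iff_tendsto_slope] at ha ⊢
  refine ((hg.tendsto.mono_left nhdsWithin_le_nhds).mul ha).congr fun y => ?_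
  simp only [slope_def_field, h0, mul_zero, sub_zero]
  ring

variable {Ω : Type*} {mΩ : MeasurableSpace Ω} {P : Measure Ω} {B : ℝ≥0 → Ω → ℝ} {δ σ : ℝ}
  [IsProbabilityMeasure P]

/-- The derivative of `callValue` with respect to the time `τ`. -/
def callTheta (P : Measure Ω) (B : ℝ≥0 → Ω → ℝ) (δ σ : ℝ) (Θ : ℝ≥0) (S c τ : ℝ) : ℝ :=
  S * δ * callProb P B δ σ S c τ - δ * S * callDelta P B δ σ S c τ
    + 1 / 2 * σ ^ 2 * S ^ 2 * callGamma P B δ σ Θ S c τ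

section

variable (hB : IsBrownianReal B P) (hm : ∀ t, Measurable (B t)) (hδ : 0 ≤ δ)

include hB hm hδ

lemma abs_callDelta_le (σ S c : ℝ) {τ : ℝ} (hτ : 0 ≤ τ) :
    |callDelta P B δ σ S c τ| ≤ ∫ ω, wealth δ σ 0 (B · ω) τ ∂P := by
  have mSYc : Measurable fun ω => S * wealth δ σ 0 (B · ω) τ + c :=
    (((measurable_wealth δ σ 0 τ).comp (measurable_path hm)).const_mul S).add_const c
  have iY := integrable_wealth hB hm hδ σ hτ
  unfold callDelta
  refine abs_integral_le_integral_abs.trans (integral_mono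
    (integrable_heaviside_mul mSYc iY).abs iY fun ω => ?_)
  have h0 := (wealth_zero_pos (σ := σ) hδ (B · ω) hτ).le
  simp only
  rw [abs_mul, abs_of_nonneg h0]
  exact mul_le_of_le_one_left h0 (abs_heaviside_le _)

lemma continuous_callValue (σ : ℝ) {τ : ℝ} (hτ : 0 ≤ τ) :
    Continuous fun q : ℝ × ℝ => callValue P B δ σ q.1 q.2 τ :=
  (continuousOn_callValue hB hm hδ σ τ.toNNReal).comp_continuous
    (f := fun q : ℝ × ℝ => (q.1, q.2, τ)) (by fun_prop)
    fun _ => ⟨trivial, trivial, hτ, (Real.coe_toNNReal τ hτ).ge⟩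

lemma integrable_callValue_comp (σ : ℝ) {τ : ℝ} (hτ : 0 ≤ τ) {X Z : Ω → ℝ} (hX : Integrable X P)
    (hZ : Integrable Z P) : Integrable (fun ω => callValue P B δ σ (X ω) (Z ω) τ) P := by
  refine Integrable.mono' ((hX.abs.mul_const (∫ ω, wealth δ σ 0 (B · ω) τ ∂P)).add hZ.abs)
    ((continuous_callValue hB hm hδ σ hτ).comp_aestronglyMeasurable
      (hX.aestronglyMeasurable.prodMk hZ.aestronglyMeasurable)) (ae_of_all _ fun ω => ?_)
  have := abs_callValue_sub_le hB hm hδ σ hτ (X ω) 0 (Z ω) 0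
  have h0 : callValue P B δ σ 0 0 τ = 0 := by simp [callValue]
  rw [h0] at this
  simpa using this

variable (hσ : 0 < σ)

include hσ

/-- A Taylor estimate for `callValue` in `S`, local in `S` and `c` to second order, and global in
`S` at the price of a fourth order term. -/
lemma exists_taylor_callValue {S : ℝ} (hS : 0 < S) (c : ℝ) {τ : ℝ} (hτ : 0 < τ) {Θ : ℝ≥0}
    (hτΘ : τ ≤ Θ) {ε : ℝ} (hε : 0 < ε) :
    ∃ η > 0, ∃ C ≥ 0, ∀ c', |c' - c| < η → ∀ S' > 0,
      |callValue P B δ σ S' c' τ - callValue P B δ σ S c' τ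
        - callDelta P B δ σ S c' τ * (S' - S) - callGamma P B δ σ Θ S c τ / 2 * (S' - S) ^ 2|
      ≤ ε * (S' - S) ^ 2 + C * (S' - S) ^ 4 := by
  set k := callGamma P B δ σ Θ S c τ with hk
  set m := ∫ ω, wealth δ σ 0 (B · ω) τ ∂P with hm'
  have hm0 : 0 ≤ m := integral_nonneg fun ω => (wealth_zero_pos (σ := σ) hδ (B · ω) hτ.le).le
  have hcont := continuousOn_callGamma hB hm hδ hσ Θ (S, c, τ) ⟨hS, trivial, hτ, hτΘ⟩
  obtain ⟨η₀, hη₀, hΓ⟩ := Metric.continuousWithinAt_iff.1 hcont ε hε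
  -- The bound by `S` keeps the ball around `S` inside the positive half-line.
  set η := min η₀ S with hη
  have hη0 : 0 < η := lt_min hη₀ hS
  -- When `d = S' - S` has `|d| ≥ η`, linear terms are at most `d ^ 4 / η ^ 3` and quadratic ones at
  -- most `d ^ 4 / η ^ 2`. The value and its Taylor term are each Lipschitz with constant `m`,
  -- whence `2 * m`.
  refine ⟨η, hη0, 2 * m / η ^ 3 + |k| / (2 * η ^ 2), by positivity, fun c' hc' S' hS' => ?_⟩
  rcases lt_or_ge |S' - S| η with hd | hd
  · have hpos : ∀ s ∈ Metric.ball S η, 0 < s := fun s hs => by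
      have h1 : |s - S| < η := by simpa [Real.dist_eq] using hs
      have h2 : η ≤ S := min_le_right _ _
      have := (abs_lt.1 h1).1
      linarith
    have h1 := abs_taylor_two_le (f := fun s => callValue P B δ σ s c' τ)
      (f' := fun s => callDelta P B δ σ s c' τ) (f'' := fun s => callGamma P B δ σ Θ s c' τ)
      (x₀ := S) (η := η) (k := k) (ε := ε)
      (fun s hs => hasDerivAt_callValue_left hB hm hδ hσ (hpos s hs) c' hτ)
      (fun s hs => hasDerivAt_callDelta hB hm hδ hσ (hpos s hs) c' hτ hτΘ)
      (fun s hs => by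
        have := hΓ (x := (s, c', τ)) ⟨hpos s hs, trivial, hτ, hτΘ⟩ (by
          rw [Prod.dist_eq, Prod.dist_eq, dist_self]
          refine max_lt (lt_of_lt_of_le hs (min_le_left _ _)) (max_lt ?_ hη₀)
          rw [Real.dist_eq]
          exact lt_of_lt_of_le hc' (min_le_left _ _))
        rw [Real.dist_eq] at this
        exact this.le) (x := S') (by simpa [Real.dist_eq] using hd)
    refine h1.trans (le_add_of_nonneg_right (by positivity))
  · have h1 := abs_callValue_sub_le hB hm hδ σ hτ.le S' S c' c'
    rw [sub_self, abs_zero, add_zero] at h1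
    have h2 := abs_callDelta_le hB hm hδ σ S c' hτ.le
    set d := S' - S with hd'
    have hd4 : d ^ 4 = |d| ^ 4 := by rw [pow_abs, abs_of_nonneg (by positivity)]
    have hd2 : d ^ 2 = |d| ^ 2 := (sq_abs d).symm
    have a1 : |d| ≤ d ^ 4 / η ^ 3 := by
      rw [le_div_iff₀ (by positivity), hd4]
      calc |d| * η ^ 3 ≤ |d| * |d| ^ 3 := by gcongr
        _ = _ := by ring
    have a2 : d ^ 2 ≤ d ^ 4 / η ^ 2 := by
      rw [le_div_iff₀ (by positivity), hd4, hd2]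
      calc |d| ^ 2 * η ^ 2 ≤ |d| ^ 2 * |d| ^ 2 := by gcongr
        _ = _ := by ring
    calc _ ≤ |callValue P B δ σ S' c' τ - callValue P B δ σ S c' τ|
          + |callDelta P B δ σ S c' τ * d| + |k / 2 * d ^ 2| :=
        (abs_sub _ _).trans (by gcongr; exact abs_sub _ _)
      _ ≤ |d| * m + m * |d| + |k| / 2 * d ^ 2 := by
        rw [abs_mul, abs_mul, abs_div, abs_of_nonneg (sq_nonneg d), abs_two]
        gcongr
      _ = 2 * m * |d| + |k| / 2 * d ^ 2 := by ring
      _ ≤ 2 * m * (d ^ 4 / η ^ 3) + |k| / 2 * (d ^ 4 / η ^ 2) := by gcongr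
      _ = (2 * m / η ^ 3 + |k| / (2 * η ^ 2)) * d ^ 4 := by field_simp
      _ ≤ _ := le_add_of_nonneg_left (by positivity)

/-- The right derivative of `callValue` in time. -/
lemma hasDerivWithinAt_callValue_time {S : ℝ} (hS : 0 < S) (c : ℝ) {τ : ℝ} (hτ : 0 < τ) {Θ : ℝ≥0}
    (hτΘ : τ ≤ Θ) :
    HasDerivWithinAt (fun t => callValue P B δ σ S c t) (callTheta P B δ σ Θ S c τ) (Ici τ) τ := by
  set k := callGamma P B δ σ Θ S c τ with hk
  set cc : ℝ → ℝ := fun h => c + S * δ * h with hcc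
  have dcc : HasDerivAt cc (S * δ) 0 :=
    (((hasDerivAt_id (0 : ℝ)).const_mul (S * δ)).const_add c).congr_deriv (by simp)
  have hcc0 : cc 0 = c := by simp [hcc]
  -- The expectation of the second order Taylor polynomial in the stock after the time `h`, with the
  -- accumulated discounted stock replaced by `h`. Its derivative at zero is `callTheta`.
  set main : ℝ → ℝ := fun h => callValue P B δ σ S (cc h) τ
    + callDelta P B δ σ S (cc h) τ * (S * (Real.exp (-h * δ) - 1))
    + k / 2 * (S ^ 2 * secondMoment δ σ h) with hmain
  have dmain : HasDerivAt main (callTheta P B δ σ Θ S c τ) 0 := by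
    have d1 : HasDerivAt (fun h => callValue P B δ σ S (cc h) τ)
        (callProb P B δ σ S c τ * (S * δ)) 0 := by
      have := hasDerivAt_callValue_right hB hm hδ hσ hS c hτ
      rw [← hcc0] at this
      have h2 := HasDerivAt.comp (0 : ℝ) this dcc
      rwa [hcc0] at h2
    have d2 : HasDerivAt (fun h => callDelta P B δ σ S (cc h) τ * (S * (Real.exp (-h * δ) - 1)))
        (callDelta P B δ σ S (cc 0) τ * (S * -δ)) 0 := by
      refine hasDerivAt_mul_of_continuousAt (g := fun h => callDelta P B δ σ S (cc h) τ) ?_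
        (((hasDerivAt_exp_neg_mul_zero δ).sub_const 1).const_mul S) (by simp)
      have h1 : ContinuousOn (fun x => callDelta P B δ σ S x τ) univ :=
        (continuousOn_callDelta hB hm hδ hσ Θ).comp (f := fun x : ℝ => (S, x, τ))
          (by fun_prop) fun x _ => ⟨hS, trivial, hτ, hτΘ⟩
      exact ContinuousAt.comp (f := cc) (h1.continuousAt univ_mem) dcc.continuousAt
    have d3 := ((hasDerivAt_secondMoment δ σ).const_mul (S ^ 2)).const_mul (k / 2)
    refine ((d1.add d2).add d3).congr_deriv ?_
    rw [hcc0, callTheta]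
    ring
  have hφ : HasDerivWithinAt (fun h => callValue P B δ σ S c (h + τ))
      (callTheta P B δ σ Θ S c τ) (Ici 0) 0 := by
    have herr : HasDerivWithinAt (fun h => callValue P B δ σ S c (h + τ) - main h) 0 (Ici 0) 0 := by
      refine hasDerivWithinAt_zero_of_eventually_le fun ε hε => ?_
      -- The error from the dividends and the second and fourth order Taylor remainders may each
      -- cost `ε / 3 * h`. Any slope above `σ ^ 2` would do for the second moment.
      set ε₁ := ε / (3 * (S ^ 2 * (σ ^ 2 + 1))) with hε₁
      have hε₁0 : 0 < ε₁ := by positivity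
      obtain ⟨η, hη, C, hC, hT⟩ := exists_taylor_callValue hB hm hδ hσ hS c hτ hτΘ hε₁0
      have e1 := eventually_integral_abs_gbmInt_sub_le hB hm δ σ (ε := ε / (3 * (S * δ + 1)))
        (by positivity)
      have e2 : ∀ᶠ h in 𝓝[≥] (0 : ℝ), secondMoment δ σ h ≤ (σ ^ 2 + 1) * h := by
        have := ((hasDerivAt_iff_isLittleO.1 (hasDerivAt_secondMoment δ σ)).def one_pos).filter_mono
          (nhdsWithin_le_nhds (s := Ici 0))
        filter_upwards [this, self_mem_nhdsWithin] with h hh hh0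
        have z : secondMoment δ σ 0 = 0 := by norm_num [secondMoment]
        simp only [z, sub_zero, smul_eq_mul, Real.norm_eq_abs, one_mul,
          abs_of_nonneg (mem_Ici.1 hh0)] at hh
        linarith [(abs_le.1 hh).2]
      have e4 : ∀ᶠ h in 𝓝[≥] (0 : ℝ), fourthMoment δ σ h ≤ ε / (3 * (C * S ^ 4 + 1)) * h := by
        have := ((hasDerivAt_iff_isLittleO.1 (hasDerivAt_fourthMoment δ σ)).def
          (c := ε / (3 * (C * S ^ 4 + 1))) (by positivity)).filter_mono
          (nhdsWithin_le_nhds (s := Ici 0))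
        filter_upwards [this, self_mem_nhdsWithin] with h hh hh0
        have z : fourthMoment δ σ 0 = 0 := by norm_num [fourthMoment]
        simp only [z, sub_zero, smul_eq_mul, Real.norm_eq_abs, mul_zero,
          abs_of_nonneg (mem_Ici.1 hh0)] at hh
        exact (abs_le.1 hh).2
      have e5 : ∀ᶠ h in 𝓝[≥] (0 : ℝ), |cc h - c| < η := by
        have h1 : ContinuousAt (fun h => |cc h - c|) 0 := (dcc.continuousAt.sub_const c).abs
        exact (h1.eventually_lt continuousAt_const (by simpa [hcc0] using hη)).filter_mono
          nhdsWithin_le_nhds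
      filter_upwards [e1, e2, e4, e5, self_mem_nhdsWithin] with h h1 h2 h4 h5 hh0
      have hh : 0 ≤ h := hh0
      obtain ⟨ix, ex⟩ := integral_gbm hB δ σ hh
      obtain ⟨i2, ex2⟩ := integral_gbm_sub_one_sq hB δ σ hh
      obtain ⟨i4, ex4⟩ := integral_gbm_sub_one_fourth hB δ σ hh
      have iA : Integrable (fun ω => gbmInt δ σ 0 (B · ω) h) P := by
        have := (boundedMoments_gbmInt hB hm δ σ h.toNNReal (univ : Set Unit)).integrable
          (i := ()) trivial
        rwa [Real.coe_toNNReal h hh] at this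
      have iu0 : Integrable (fun ω => callValue P B δ σ (S * gbm δ σ (B · ω) h)
          (c + S * δ * gbmInt δ σ 0 (B · ω) h) τ) P := integrable_callValue_comp hB hm hδ σ hτ.le (ix.const_mul S)
        ((integrable_const c).add (iA.const_mul (S * δ)))
      have iu1 := integrable_callValue_comp hB hm hδ σ hτ.le (ix.const_mul S)
        (integrable_const (μ := P) (cc h))
      have hM : callValue P B δ σ S c (h + τ) = ∫ ω, callValue P B δ σ (S * gbm δ σ (B · ω) h)
          (c + S * δ * gbmInt δ σ 0 (B · ω) h) τ ∂P := by
        have := callValue_add hB hm hδ σ S c h.toNNReal hτ.le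
        rwa [Real.coe_toNNReal h hh] at this
      have s1 : |callValue P B δ σ S c (h + τ)
          - ∫ ω, callValue P B δ σ (S * gbm δ σ (B · ω) h) (cc h) τ ∂P| ≤ ε / 3 * h := by
        rw [hM, ← integral_sub iu0 iu1]
        have iAh : Integrable (fun ω => gbmInt δ σ 0 (B · ω) h - h) P :=
          iA.sub (integrable_const h)
        calc _ ≤ ∫ ω, S * δ * |gbmInt δ σ 0 (B · ω) h - h| ∂P := by
              refine abs_integral_le_integral_abs.trans (integral_mono (iu0.sub iu1).abs
                (iAh.abs.const_mul (S * δ)) fun ω => ?_)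
              have := abs_callValue_sub_le hB hm hδ σ hτ.le (S * gbm δ σ (B · ω) h)
                (S * gbm δ σ (B · ω) h) (c + S * δ * gbmInt δ σ 0 (B · ω) h) (cc h)
              rw [sub_self, abs_zero, zero_mul, zero_add] at this
              refine this.trans (le_of_eq ?_)
              have e : c + S * δ * gbmInt δ σ 0 (B · ω) h - cc h
                  = S * δ * (gbmInt δ σ 0 (B · ω) h - h) := by simp only [hcc]; ring
              rw [e, abs_mul, abs_of_nonneg (mul_nonneg hS.le hδ)]
          _ = S * δ * ∫ ω, |gbmInt δ σ 0 (B · ω) h - h| ∂P := integral_const_mul _ _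
          _ ≤ (S * δ + 1) * (ε / (3 * (S * δ + 1)) * h) := by
              gcongr
              linarith
          _ = ε / 3 * h := by
              have : S * δ + 1 ≠ 0 := by positivity
              field_simp
      have s2 : |(∫ ω, callValue P B δ σ (S * gbm δ σ (B · ω) h) (cc h) τ ∂P) - main h|
          ≤ ε / 3 * h + ε / 3 * h := by
        have j1 : Integrable (fun ω => callDelta P B δ σ S (cc h) τ
            * (S * (gbm δ σ (B · ω) h - 1))) P :=
          (((ix.sub (integrable_const 1)).const_mul S).const_mul _)
        have j2 : Integrable (fun ω => k / 2 * (S ^ 2 * (gbm δ σ (B · ω) h - 1) ^ 2)) P :=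
          (i2.const_mul _).const_mul _
        have em : main h = ∫ ω, (callValue P B δ σ S (cc h) τ
            + callDelta P B δ σ S (cc h) τ * (S * (gbm δ σ (B · ω) h - 1))
            + k / 2 * (S ^ 2 * (gbm δ σ (B · ω) h - 1) ^ 2)) ∂P := by
          rw [integral_add (f := fun ω => _ + _) ((integrable_const _).add j1) j2,
            integral_add (integrable_const _) j1, integral_const_mul, integral_const_mul,
            integral_const_mul, integral_const_mul, ex2, integral_sub ix (integrable_const 1), ex]
          simp [hmain]
        have jm : Integrable (fun ω => callValue P B δ σ S (cc h) τ
            + callDelta P B δ σ S (cc h) τ * (S * (gbm δ σ (B · ω) h - 1))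
            + k / 2 * (S ^ 2 * (gbm δ σ (B · ω) h - 1) ^ 2)) P := ((integrable_const (μ := P) (callValue P B δ σ S (cc h) τ)).add j1).add j2
        rw [em, ← integral_sub iu1 jm]
        have jr : Integrable (fun ω => ε₁ * (S ^ 2 * (gbm δ σ (B · ω) h - 1) ^ 2)
            + C * (S ^ 4 * (gbm δ σ (B · ω) h - 1) ^ 4)) P :=
          ((i2.const_mul _).const_mul _).add ((i4.const_mul _).const_mul _)
        calc _ ≤ ∫ ω, (ε₁ * (S ^ 2 * (gbm δ σ (B · ω) h - 1) ^ 2)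
              + C * (S ^ 4 * (gbm δ σ (B · ω) h - 1) ^ 4)) ∂P := by
              refine abs_integral_le_integral_abs.trans (integral_mono (iu1.sub jm).abs jr
                fun ω => ?_)
              have := hT (cc h) h5 (S * gbm δ σ (B · ω) h) (mul_pos hS (gbm_pos _ _ _ _))
              have e : S * gbm δ σ (B · ω) h - S = S * (gbm δ σ (B · ω) h - 1) := by ring
              rw [e, mul_pow, mul_pow] at this
              refine le_trans (le_of_eq ?_) this
              simp only
              congr 1
              ring
          _ = ε₁ * (S ^ 2 * secondMoment δ σ h) + C * (S ^ 4 * fourthMoment δ σ h) := by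
              rw [integral_add ((i2.const_mul _).const_mul _) ((i4.const_mul _).const_mul _),
                integral_const_mul, integral_const_mul, integral_const_mul, integral_const_mul,
                ex2, ex4]
          _ ≤ ε₁ * (S ^ 2 * ((σ ^ 2 + 1) * h))
              + (C * S ^ 4 + 1) * (ε / (3 * (C * S ^ 4 + 1)) * h) := by
              have q0 : 0 ≤ ε / (3 * (C * S ^ 4 + 1)) * h := by positivity
              have q1 : C * (S ^ 4 * fourthMoment δ σ h)
                  ≤ C * S ^ 4 * (ε / (3 * (C * S ^ 4 + 1)) * h) := by
                rw [mul_assoc C]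
                gcongr
              have q2 : ε₁ * (S ^ 2 * secondMoment δ σ h) ≤ ε₁ * (S ^ 2 * ((σ ^ 2 + 1) * h)) := by
                gcongr
              linarith
          _ = ε / 3 * h + ε / 3 * h := by
              have : C * S ^ 4 + 1 ≠ 0 := by positivity
              rw [hε₁]
              field_simp
      calc _ = |(callValue P B δ σ S c (h + τ)
            - ∫ ω, callValue P B δ σ (S * gbm δ σ (B · ω) h) (cc h) τ ∂P)
            + ((∫ ω, callValue P B δ σ (S * gbm δ σ (B · ω) h) (cc h) τ ∂P) - main h)| := by
            congr 1; ring
        _ ≤ ε / 3 * h + (ε / 3 * h + ε / 3 * h) := (abs_add_le _ _).trans (add_le_add s1 s2)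
        _ = ε * h := by ring
    simpa using herr.fun_add (dmain.hasDerivWithinAt (s := Ici 0))
  have hsub : HasDerivWithinAt (fun t : ℝ => t - τ) 1 (Ici τ) τ :=
    ((hasDerivAt_id τ).sub_const τ).hasDerivWithinAt
  have hφ' : HasDerivWithinAt (fun h => callValue P B δ σ S c (h + τ))
      (callTheta P B δ σ Θ S c τ) (Ici 0) (τ - τ) := by rwa [sub_self]
  have := HasDerivWithinAt.comp (h := fun t => t - τ) τ hφ' hsub fun t ht =>
    mem_Ici.2 (sub_nonneg.2 ht)
  simpa [Function.comp_def] using this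

lemma continuousOn_callTheta (Θ : ℝ≥0) :
    ContinuousOn (fun p : ℝ × ℝ × ℝ => callTheta P B δ σ Θ p.1 p.2.1 p.2.2)
      (smoothRegion Θ) := by
  have h1 := continuousOn_callProb hB hm hδ hσ Θ
  have h2 := continuousOn_callDelta hB hm hδ hσ Θ
  have h3 := continuousOn_callGamma hB hm hδ hσ Θ
  unfold callTheta
  fun_prop

/-- The Markov expansion only sees later times; continuity of `callTheta` makes the right derivative
two-sided. For this `τ` has to be interior to `(0, Θ)`. -/
lemma hasDerivAt_callValue_time {S : ℝ} (hS : 0 < S) (c : ℝ) {τ : ℝ} (hτ : 0 < τ) {Θ : ℝ≥0}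
    (hτΘ : τ < Θ) :
    HasDerivAt (fun t => callValue P B δ σ S c t) (callTheta P B δ σ Θ S c τ) τ := by
  refine hasDerivAt_of_hasDerivWithinAt_Ici (l := 0) (u := Θ) ?_ ?_
    (fun t ht => hasDerivWithinAt_callValue_time hB hm hδ hσ hS c ht.1 ht.2.le) ⟨hτ, hτΘ⟩
  · exact (continuousOn_callValue hB hm hδ σ Θ).comp (f := fun t : ℝ => (S, c, t))
      (by fun_prop) fun t ht => ⟨trivial, trivial, ht.1.le, ht.2.le⟩
  · exact (continuousOn_callTheta hB hm hδ hσ Θ).comp (f := fun t : ℝ => (S, c, t))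
      (by fun_prop) fun t ht => ⟨hS, trivial, ht.1, ht.2.le⟩

end

end

section

variable {Ω : Type*} {mΩ : MeasurableSpace Ω} {P : Measure Ω} {𝓕 : Filtration ℝ≥0 mΩ}

/-! ### Optional stopping for processes with continuous paths -/

lemma measurable_of_isStoppingTime {v : Ω → ℝ≥0}
    (hv : IsStoppingTime 𝓕 (fun ω => (v ω : WithTop ℝ≥0))) : Measurable v :=
  measurable_of_Iic fun i => by
    have := 𝓕.le i _ (hv.measurableSet_le i)
    simp only [WithTop.coe_le_coe] at this
    exact this

/-- The time `x` rounded up to the next multiple of `1 / (n + 1)`, capped at `b`. -/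
def roundUp (b : ℝ≥0) (n : ℕ) (x : ℝ≥0) : ℝ≥0 :=
  min b (((⌊((n : ℝ≥0) + 1) * x⌋₊ : ℝ≥0) + 1) / ((n : ℝ≥0) + 1))

lemma tendsto_roundUp {b x : ℝ≥0} (hx : x ≤ b) :
    Tendsto (fun n => roundUp b n x) atTop (𝓝 x) := by
  have h1 : Tendsto (fun n : ℕ => x + 1 / ((n : ℝ≥0) + 1)) atTop (𝓝 x) := by
    simpa using (tendsto_const_nhds (x := x)).add tendsto_one_div_add_atTop_nhds_zero_nat
  refine tendsto_of_tendsto_of_tendsto_of_le_of_le tendsto_const_nhds h1 (fun n => ?_) fun n => ?_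
  · refine le_min hx ((le_div_iff₀ (by positivity)).2 ?_)
    rw [mul_comm]
    exact (Nat.lt_floor_add_one _).le
  · refine (min_le_right _ _).trans ?_
    rw [add_div]
    gcongr
    rw [div_le_iff₀ (by positivity), mul_comm]
    exact Nat.floor_le zero_le

lemma measurable_stopped_roundUp {E : Type*} [MeasurableSpace E] {G : ℝ≥0 → Ω → E}
    (hG : ∀ s, Measurable (G s)) {v : Ω → ℝ≥0} (hv : Measurable v) (b : ℝ≥0) (n : ℕ) :
    Measurable fun ω => G (roundUp b n (v ω)) ω := by
  have hk : Measurable fun ω => ⌊((n : ℝ≥0) + 1) * v ω⌋₊ :=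
    Nat.measurable_floor.comp (hv.const_mul _)
  have h : ∀ (d : ℕ → ℝ≥0) (k : Ω → ℕ), Measurable k → Measurable fun ω => G (d (k ω)) ω := by
    intro d k hk
    have h : Measurable fun q : ℕ × Ω => G (d q.1) q.2 :=
      measurable_from_prod_countable_right fun k => hG (d k)
    exact h.comp (hk.prodMk measurable_id)
  have := h (fun k => min b (((k : ℝ≥0) + 1) / ((n : ℝ≥0) + 1))) _ hk
  unfold roundUp
  exact this

lemma aemeasurable_stopped {E : Type*} [TopologicalSpace E] [TopologicalSpace.PseudoMetrizableSpace E]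
    [MeasurableSpace E] [BorelSpace E] {G : ℝ≥0 → Ω → E} (hG : ∀ s, Measurable (G s))
    (hc : ∀ᵐ ω ∂P, Continuous (G · ω)) {v : Ω → ℝ≥0} (hv : Measurable v) {b : ℝ≥0}
    (hb : ∀ ω, v ω ≤ b) : AEMeasurable (fun ω => G (v ω) ω) P := by
  refine aemeasurable_of_tendsto_metrizable_ae atTop
    (fun n => (measurable_stopped_roundUp hG hv b n).aemeasurable) ?_
  filter_upwards [hc] with ω hω
  exact (hω.tendsto _).comp (tendsto_roundUp (hb ω))

/-- The rounded time takes countably many values, and the event that it is rounded to `s` is known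
at `s`. On each such event the submartingale inequality between `s` and `b` applies. -/
lemma setLIntegral_stopped_roundUp_le {G : ℝ≥0 → Ω → ℝ≥0∞}
    (hsub : ∀ a b, a ≤ b → ∀ A, MeasurableSet[𝓕 a] A → ∫⁻ ω in A, G a ω ∂P ≤ ∫⁻ ω in A, G b ω ∂P)
    {v : Ω → ℝ≥0} (hv : IsStoppingTime 𝓕 (fun ω => (v ω : WithTop ℝ≥0))) {a b : ℝ≥0}
    (ha : ∀ ω, a ≤ v ω) {C : Set Ω} (hC : MeasurableSet[𝓕 a] C) (n : ℕ) :
    ∫⁻ ω in C, G (roundUp b n (v ω)) ω ∂P ≤ ∫⁻ ω in C, G b ω ∂P := by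
  have hn : (0 : ℝ≥0) < (n : ℝ≥0) + 1 := by positivity
  set D : ℕ → Set Ω := fun k => C ∩ {ω | ⌊((n : ℝ≥0) + 1) * v ω⌋₊ = k} with hD
  have mD : ∀ k, MeasurableSet (D k) := fun k => (𝓕.le a _ hC).inter
    ((Nat.measurable_floor.comp ((measurable_of_isStoppingTime hv).const_mul _))
      (measurableSet_singleton k))
  have hU : C = ⋃ k, D k := by
    ext ω
    simp [hD]
  have hdisj : Pairwise (Function.onFun Disjoint D) := fun i j hij =>
    Set.disjoint_left.2 fun ω h1 h2 => hij (h1.2.symm.trans h2.2)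
  rw [hU, lintegral_iUnion mD hdisj, lintegral_iUnion mD hdisj]
  refine ENNReal.tsum_le_tsum fun k => ?_
  set s : ℝ≥0 := ((k : ℝ≥0) + 1) / ((n : ℝ≥0) + 1) with hs
  have e : ∫⁻ ω in D k, G (roundUp b n (v ω)) ω ∂P = ∫⁻ ω in D k, G (min b s) ω ∂P := by
    refine setLIntegral_congr_fun (mD k) fun ω hω => ?_
    have : ⌊((n : ℝ≥0) + 1) * v ω⌋₊ = k := hω.2
    simp only [roundUp, this, hs]
  rw [e]
  rcases le_total b s with hbs | hbs
  · rw [min_eq_left hbs]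
  rw [min_eq_right hbs]
  rcases (D k).eq_empty_or_nonempty with h0 | ⟨ω₀, hω₀⟩
  · simp [h0]
  have has : a ≤ s := by
    have h1 : ⌊((n : ℝ≥0) + 1) * v ω₀⌋₊ = k := hω₀.2
    refine (ha ω₀).trans ((le_div_iff₀ hn).2 ?_)
    rw [mul_comm, ← h1]
    exact (Nat.lt_floor_add_one _).le
  refine hsub s b hbs _ ((𝓕.mono has _ hC).inter ?_)
  have h2 : {ω | ⌊((n : ℝ≥0) + 1) * v ω⌋₊ = k}
      = {ω | (v ω : WithTop ℝ≥0) < ((k / ((n : ℝ≥0) + 1) : ℝ≥0) : WithTop ℝ≥0)}ᶜ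
        ∩ {ω | (v ω : WithTop ℝ≥0) < (s : WithTop ℝ≥0)} := by
    ext ω
    simp only [mem_ofPred_eq, mem_inter_iff, mem_compl_iff, WithTop.coe_lt_coe, not_lt,
      Nat.floor_eq_iff (show 0 ≤ ((n : ℝ≥0) + 1) * v ω from zero_le), hs, lt_div_iff₀ hn]
    rw [mul_comm (v ω)]
  rw [h2]
  refine MeasurableSet.inter (MeasurableSet.compl ?_) (hv.measurableSet_lt s)
  refine 𝓕.mono ?_ _ (hv.measurableSet_lt _)
  rw [hs]
  gcongr
  exact le_self_add

/-- Optional stopping for a nonnegative submartingale with continuous paths. -/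
lemma setLIntegral_stopped_le {G : ℝ≥0 → Ω → ℝ≥0∞} (hG : ∀ s, Measurable (G s))
    (hc : ∀ᵐ ω ∂P, Continuous (G · ω))
    (hsub : ∀ a b, a ≤ b → ∀ A, MeasurableSet[𝓕 a] A → ∫⁻ ω in A, G a ω ∂P ≤ ∫⁻ ω in A, G b ω ∂P)
    {v : Ω → ℝ≥0} (hv : IsStoppingTime 𝓕 (fun ω => (v ω : WithTop ℝ≥0))) {a b : ℝ≥0}
    (ha : ∀ ω, a ≤ v ω) (hb : ∀ ω, v ω ≤ b) {C : Set Ω} (hC : MeasurableSet[𝓕 a] C) :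
    ∫⁻ ω in C, G (v ω) ω ∂P ≤ ∫⁻ ω in C, G b ω ∂P := by
  have e : ∫⁻ ω in C, G (v ω) ω ∂P
      = ∫⁻ ω in C, liminf (fun n => G (roundUp b n (v ω)) ω) atTop ∂P := by
    refine lintegral_congr_ae (ae_restrict_of_ae ?_)
    filter_upwards [hc] with ω hω
    exact ((hω.tendsto _).comp (tendsto_roundUp (hb ω))).liminf_eq.symm
  rw [e]
  -- Nonnegativity makes Fatou's lemma enough, with no uniform integrability.
  refine (lintegral_liminf_le fun n =>
    measurable_stopped_roundUp hG (measurable_of_isStoppingTime hv) b n).trans ?_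
  refine liminf_le_of_le (by isBoundedDefault) fun x hx => ?_
  obtain ⟨n, hn⟩ := hx.exists
  exact hn.trans (setLIntegral_stopped_roundUp_le hsub hv ha hC n)

/-- Working with extended nonnegative integrals first makes integrability of the stopped value a
conclusion rather than an assumption. -/
lemma integrable_stopped_and_setIntegral_le {g : ℝ≥0 → Ω → ℝ} (hg : ∀ s, Measurable (g s))
    (h0 : ∀ s ω, 0 ≤ g s ω) (hi : ∀ s, Integrable (g s) P) (hc : ∀ᵐ ω ∂P, Continuous (g · ω))
    (hsub : ∀ a b, a ≤ b → ∀ A, MeasurableSet[𝓕 a] A → ∫ ω in A, g a ω ∂P ≤ ∫ ω in A, g b ω ∂P)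
    {v : Ω → ℝ≥0} (hv : IsStoppingTime 𝓕 (fun ω => (v ω : WithTop ℝ≥0))) {b : ℝ≥0}
    (hb : ∀ ω, v ω ≤ b) :
    Integrable (fun ω => g (v ω) ω) P ∧ ∀ a, (∀ ω, a ≤ v ω) → ∀ C, MeasurableSet[𝓕 a] C →
      ∫ ω in C, g (v ω) ω ∂P ≤ ∫ ω in C, g b ω ∂P := by
  have hof : ∀ s A, ENNReal.ofReal (∫ ω in A, g s ω ∂P)
      = ∫⁻ ω in A, ENNReal.ofReal (g s ω) ∂P := fun s A =>
    ofReal_integral_eq_lintegral_ofReal (hi s).integrableOn (ae_of_all _ (h0 s))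
  have key : ∀ a, (∀ ω, a ≤ v ω) → ∀ C, MeasurableSet[𝓕 a] C →
      ∫⁻ ω in C, ENNReal.ofReal (g (v ω) ω) ∂P ≤ ∫⁻ ω in C, ENNReal.ofReal (g b ω) ∂P :=
    fun a ha C hC => setLIntegral_stopped_le (G := fun s ω => ENNReal.ofReal (g s ω))
      (fun s => (hg s).ennreal_ofReal)
      (by filter_upwards [hc] with ω hω using ENNReal.continuous_ofReal.comp hω)
      (fun a b hab A hA => by
        rw [← hof, ← hof]
        exact ENNReal.ofReal_le_ofReal (hsub a b hab A hA)) hv ha hb hC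
  have am : AEMeasurable (fun ω => g (v ω) ω) P :=
    aemeasurable_stopped hg hc (measurable_of_isStoppingTime hv) hb
  have iv : Integrable (fun ω => g (v ω) ω) P := by
    refine ⟨am.aestronglyMeasurable, ?_⟩
    rw [hasFiniteIntegral_iff_ofReal (ae_of_all _ fun ω => h0 _ _)]
    have h1 := key 0 (fun ω => zero_le) univ MeasurableSet.univ
    rw [setLIntegral_univ, setLIntegral_univ] at h1
    refine h1.trans_lt ?_
    rw [← hasFiniteIntegral_iff_ofReal (ae_of_all _ fun ω => h0 _ _)]
    exact (hi b).2
  refine ⟨iv, fun a ha C hC => ?_⟩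
  have h1 := key a ha C hC
  rw [← hof, ← ofReal_integral_eq_lintegral_ofReal iv.integrableOn
    (ae_of_all _ fun ω => h0 _ _)] at h1
  exact (ENNReal.ofReal_le_ofReal_iff (integral_nonneg fun ω => h0 _ _)).1 h1

end

section

variable {Ω : Type*} {mΩ : MeasurableSpace Ω} {P : Measure Ω} {𝓕 : Filtration ℝ≥0 mΩ}
  {B : ℝ≥0 → Ω → ℝ} {δ σ : ℝ}

/-! ### The wealth process is a martingale -/

lemma _root_.IsBrownianWrt.measurable (hW : IsBrownianWrt B 𝓕 P) (t : ℝ≥0) : Measurable (B t) :=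
  (hW.adapted t).mono (𝓕.le t) le_rfl

lemma _root_.IsBrownianWrt.measurable_path_min (hW : IsBrownianWrt B 𝓕 P) (a : ℝ≥0) :
    Measurable[𝓕 a] fun ω s => B (min s a) ω :=
  @measurable_pi_lambda _ _ _ (𝓕 a) _ _ fun s =>
    (hW.adapted (min s a)).mono (𝓕.mono (min_le_right s a)) le_rfl

lemma _root_.IsBrownianWrt.measurable_gbm (hW : IsBrownianWrt B 𝓕 P) (δ σ : ℝ) (a : ℝ≥0) :
    Measurable[𝓕 a] fun ω => gbm δ σ (B · ω) a := by
  have := (measurable_gbm_left δ σ (a : ℝ)).comp (hW.measurable_path_min a)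
  have e : (fun ω => gbm δ σ (B · ω) a)
      = (fun f => gbm δ σ f a) ∘ fun ω s => B (min s a) ω :=
    funext fun ω => (gbm_min (B · ω) le_rfl).symm
  rwa [e]

lemma _root_.IsBrownianWrt.measurable_wealth (hW : IsBrownianWrt B 𝓕 P) (δ σ : ℝ) (k : ℕ) (a : ℝ≥0) :
    Measurable[𝓕 a] fun ω => wealth δ σ k (B · ω) a := by
  have := (StockLoan.measurable_wealth δ σ k (a : ℝ)).comp (hW.measurable_path_min a)
  have e : (fun ω => wealth δ σ k (B · ω) a)
      = (fun f => wealth δ σ k f a) ∘ fun ω s => B (min s a) ω :=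
    funext fun ω => (wealth_min (B · ω) k a).symm
  rwa [e]

/-- The filtration from the time `t` on. -/
def shiftFiltration (𝓕 : Filtration ℝ≥0 mΩ) (t : ℝ≥0) : Filtration ℝ≥0 mΩ where
  seq s := 𝓕 (t + s)
  mono' _ _ h := 𝓕.mono (by gcongr)
  le' _ := 𝓕.le _

lemma _root_.IsBrownianWrt.shift (hW : IsBrownianWrt B 𝓕 P) (t : ℝ≥0) :
    IsBrownianWrt (fun s ω => shiftPath t (B · ω) s) (shiftFiltration 𝓕 t) P where
  isBrownian := isBrownianReal_shiftPath hW.isBrownian t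
  adapted s := (hW.adapted (t + s)).sub ((hW.adapted t).mono (𝓕.mono le_self_add) le_rfl)
  indep s u hsu := by
    have := hW.indep (t + s) (t + u) (by gcongr)
    have e : (fun ω => shiftPath t (B · ω) u - shiftPath t (B · ω) s)
        = fun ω => B (t + u) ω - B (t + s) ω := funext fun ω => by simp [shiftPath]
    rw [e]
    exact this

section

variable [IsProbabilityMeasure P] (hW : IsBrownianWrt B 𝓕 P)

include hW

/-- The growth factor after `a` is independent of `𝓕 a` and has mean `exp (-s * δ)`. -/
lemma setIntegral_gbm_add (δ σ : ℝ) (a : ℝ≥0) {s : ℝ} (hs : 0 ≤ s) {A : Set Ω}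
    (hA : MeasurableSet[𝓕 a] A) :
    ∫ ω in A, gbm δ σ (B · ω) (a + s) ∂P
      = Real.exp (-s * δ) * ∫ ω in A, gbm δ σ (B · ω) a ∂P := by
  lift s to ℝ≥0 using hs
  have mA : MeasurableSet A := 𝓕.le a _ hA
  set f : Ω → ℝ := A.indicator fun ω => gbm δ σ (B · ω) a with hf
  have mf : Measurable[𝓕 a] f := (hW.measurable_gbm δ σ a).indicator hA
  set g : Ω → ℝ := fun ω => Real.exp (-(δ + σ ^ 2 / 2) * s + σ * (B (a + s) ω - B a ω)) with hg
  have hind : IndepFun f g P := by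
    have h1 : IndepFun f (fun ω => B (a + s) ω - B a ω) P := by
      rw [IndepFun_iff_Indep]
      exact (indep_of_indep_of_le_right (hW.indep a (a + s) le_self_add) mf.comap_le).symm
    exact h1.comp (φ := id) (ψ := fun x => Real.exp (-(δ + σ ^ 2 / 2) * s + σ * x))
      measurable_id (by fun_prop)
  have hgE : ∫ ω, g ω ∂P = Real.exp (-s * δ) := by
    rw [← (integral_gbm (isBrownianReal_shiftPath hW.isBrownian a) δ σ s.coe_nonneg).2]
    refine integral_congr_ae ?_
    filter_upwards [hW.isBrownian.cont] with ω hω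
    simp only [hg, gbm, pathEval_of_continuous (continuous_shiftPath hω a), Real.toNNReal_coe]
    rfl
  calc ∫ ω in A, gbm δ σ (B · ω) (a + s) ∂P = ∫ ω in A, gbm δ σ (B · ω) a * g ω ∂P := by
        refine integral_congr_ae (ae_restrict_of_ae ?_)
        filter_upwards [hW.isBrownian.cont] with ω hω
        rw [gbm_add hω a s.coe_nonneg]
        simp only [hg, gbm, pathEval_of_continuous (continuous_shiftPath hω a), Real.toNNReal_coe]
        rfl
    _ = ∫ ω, f ω * g ω ∂P := by
        rw [← integral_indicator mA]
        refine integral_congr_ae (ae_of_all _ fun ω => ?_)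
        simp only [hf, indicator_mul_left]
    _ = (∫ ω, f ω ∂P) * ∫ ω, g ω ∂P := hind.integral_fun_mul_eq_mul_integral
        (mf.mono (𝓕.le a) le_rfl).aestronglyMeasurable
        (by
          have := hW.measurable
          have : Measurable g := by fun_prop
          exact this.aestronglyMeasurable)
    _ = _ := by rw [hgE, hf, integral_indicator mA, mul_comm]

lemma setIntegral_gbmInt (δ σ : ℝ) {b : ℝ} (hb : 0 ≤ b) (A : Set Ω) :
    IntervalIntegrable (fun w => ∫ ω in A, gbm δ σ (B · ω) w ∂P) volume 0 b ∧
      ∫ ω in A, gbmInt δ σ 0 (B · ω) b ∂P = ∫ w in 0..b, ∫ ω in A, gbm δ σ (B · ω) w ∂P := by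
  have hm := hW.measurable
  have mg : Measurable fun p : ℝ × Ω => gbm δ σ (B · p.2) p.1 :=
    (StockLoan.measurable_gbm δ σ).comp
      (((measurable_path hm).comp measurable_snd).prodMk measurable_fst)
  have hint : Integrable (fun p : ℝ × Ω => gbm δ σ (B · p.2) p.1)
      ((volume.restrict (uIoc 0 b)).prod (P.restrict A)) := by
    refine ⟨mg.aestronglyMeasurable, ?_⟩
    rw [uIoc_of_le hb, HasFiniteIntegral, lintegral_prod _ mg.enorm.aemeasurable]
    obtain ⟨C, hC⟩ := (boundedMoments_gbm hW.isBrownian hm δ σ b.toNNReal).bound 1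
    calc ∫⁻ w in Ioc 0 b, ∫⁻ ω in A, ‖gbm δ σ (B · ω) w‖ₑ ∂P
        ≤ ∫⁻ _ in Ioc 0 b, C := by
          refine setLIntegral_mono measurable_const fun w hw => ?_
          have := hC w ⟨hw.1.le, by rw [Real.coe_toNNReal b hb]; exact hw.2⟩
          simp only [pow_one] at this
          exact (setLIntegral_le_lintegral _ _).trans this
      _ < ⊤ := by
          rw [lintegral_const]
          exact ENNReal.mul_lt_top ENNReal.coe_lt_top (by simp)
  refine ⟨intervalIntegrable_iff.2 hint.integral_prod_left, ?_⟩
  rw [intervalIntegral_integral_swap (f := fun w ω => gbm δ σ (B · ω) w) hint]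
  simp [gbmInt]

lemma setIntegral_wealth (δ σ : ℝ) {a b : ℝ≥0} (hab : a ≤ b) {A : Set Ω}
    (hA : MeasurableSet[𝓕 a] A) :
    ∫ ω in A, wealth δ σ 0 (B · ω) b ∂P = ∫ ω in A, wealth δ σ 0 (B · ω) a ∂P := by
  have hm := hW.measurable
  have iI : ∀ c : ℝ≥0, Integrable (fun ω => gbmInt δ σ 0 (B · ω) c) P := fun c =>
    (boundedMoments_gbmInt hW.isBrownian hm δ σ c (univ : Set Unit)).integrable (i := ()) trivial
  have ig : ∀ c : ℝ≥0, Integrable (fun ω => gbm δ σ (B · ω) c) P := fun c =>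
    (integral_gbm hW.isBrownian δ σ c.coe_nonneg).1
  have hsplit : ∀ c : ℝ≥0, ∫ ω in A, wealth δ σ 0 (B · ω) c ∂P
      = (∫ ω in A, gbm δ σ (B · ω) c ∂P)
        + δ * ∫ w in (0 : ℝ)..c, ∫ ω in A, gbm δ σ (B · ω) w ∂P := fun c => by
    rw [← (setIntegral_gbmInt hW δ σ c.coe_nonneg A).2, ← integral_const_mul,
      ← integral_add (ig c).integrableOn ((iI c).integrableOn.const_mul δ)]
    simp [wealth]
  set m := ∫ ω in A, gbm δ σ (B · ω) a ∂P with hm'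
  set M : ℝ → ℝ := fun w => ∫ ω in A, gbm δ σ (B · ω) w ∂P with hM
  have hMw : ∀ w : ℝ, a ≤ w → M w = Real.exp (-(w - a) * δ) * m := fun w hw => by
    have := setIntegral_gbm_add hW δ σ a (sub_nonneg.2 hw) hA
    rwa [add_sub_cancel] at this
  have hab' : (a : ℝ) ≤ b := by exact_mod_cast hab
  have i0a : IntervalIntegrable M volume 0 a := (setIntegral_gbmInt hW δ σ a.coe_nonneg A).1
  have iab : IntervalIntegrable M volume a b :=
    (setIntegral_gbmInt hW δ σ b.coe_nonneg A).1.mono_set (by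
      rw [uIcc_of_le hab', uIcc_of_le b.coe_nonneg]
      exact Icc_subset_Icc_left a.coe_nonneg)
  -- The mean of the stock over `A` decays like `exp (-δ w)`, and the dividends collect exactly what
  -- is lost.
  have hd : δ * ∫ w in (a : ℝ)..b, M w = m - M b := by
    have e1 : ∫ w in (a : ℝ)..b, M w = ∫ w in (a : ℝ)..b, Real.exp (-(w - a) * δ) * m :=
      intervalIntegral.integral_congr fun w hw => hMw w (by
        rw [uIcc_of_le hab'] at hw; exact hw.1)
    rw [e1, ← intervalIntegral.integral_const_mul, intervalIntegral.integral_eq_sub_of_hasDerivAt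
      (f := fun w => -(Real.exp (-(w - a) * δ) * m)) (fun w _ => ?_)
      (Continuous.intervalIntegrable (by fun_prop) _ _), hMw b hab']
    · simp; ring
    · have := ((((hasDerivAt_id w).sub_const (a : ℝ)).neg.mul_const δ).exp.mul_const m).neg
      refine this.congr_deriv ?_
      simp; ring
  rw [hsplit, hsplit, ← intervalIntegral.integral_add_adjacent_intervals i0a iab, mul_add, hd]
  ring

end

end

section

variable {Ω : Type*} {mΩ : MeasurableSpace Ω} {P : Measure Ω} {𝓕 : Filtration ℝ≥0 mΩ}
  {B : ℝ≥0 → Ω → ℝ} {δ σ S I : ℝ} {k : ℝ≥0 → ℝ}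

/-! ### The reward process -/

/-- The discounted reward at the time `s` when the discounted repayment is `k s`. -/
def reward (δ σ S I : ℝ) (k : ℝ≥0 → ℝ) (B : ℝ≥0 → Ω → ℝ) (s : ℝ≥0) (ω : Ω) : ℝ :=
  max (S * wealth δ σ 0 (B · ω) s + I - k s) 0

lemma reward_nonneg (s : ℝ≥0) (ω : Ω) : 0 ≤ reward δ σ S I k B s ω := le_max_right _ _

lemma continuous_reward (hk : Continuous k) {ω : Ω} (hω : Continuous (B · ω)) :
    Continuous (reward δ σ S I k B · ω) := by
  have := (continuous_wealth (δ := δ) (σ := σ) hω 0).comp NNReal.continuous_coe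
  have h : Continuous fun s : ℝ≥0 => wealth δ σ 0 (B · ω) s := this
  unfold reward
  fun_prop

section

variable (hW : IsBrownianWrt B 𝓕 P)

include hW

lemma measurable_reward (s : ℝ≥0) : Measurable (reward δ σ S I k B s) := by
  have : Measurable fun ω => wealth δ σ 0 (B · ω) s :=
    (hW.measurable_wealth δ σ 0 s).mono (𝓕.le s) le_rfl
  unfold reward
  fun_prop

lemma measurableSet_exercise (a : ℝ≥0) (c : ℝ) :
    MeasurableSet[𝓕 a] {ω | 0 < S * wealth δ σ 0 (B · ω) a + I - c} := by
  have h : Measurable[𝓕 a] fun ω => S * wealth δ σ 0 (B · ω) a + I - c :=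
    (((hW.measurable_wealth δ σ 0 a).const_mul S).add_const I).sub_const c
  exact h measurableSet_Ioi

/-- From every event of the past, the stock price exceeds every level with positive probability. -/
lemma measure_inter_lt_gbm_ne_zero (δ : ℝ) (hσ : 0 < σ) {a b : ℝ≥0} (hab : a < b) {A : Set Ω}
    (hA : MeasurableSet[𝓕 a] A) (h0 : P A ≠ 0) (M : ℝ) :
    P (A ∩ {ω | M < gbm δ σ (B · ω) b}) ≠ 0 := by
  -- On part of `A` the stock at `a` is bounded below by a constant. A large increment, independent
  -- of `𝓕 a` and of positive probability, then lifts it above `M`.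
  obtain ⟨n, hn⟩ : ∃ n : ℕ, P (A ∩ {ω | 1 / ((n : ℝ) + 1) < gbm δ σ (B · ω) a}) ≠ 0 := by
    by_contra! h
    refine h0 (measure_mono_null (fun ω hω => ?_) (measure_iUnion_null h))
    obtain ⟨n, hn⟩ := exists_nat_one_div_lt (gbm_pos δ σ (B · ω) a)
    exact mem_iUnion.2 ⟨n, hω, hn⟩
  set A' := A ∩ {ω | 1 / ((n : ℝ) + 1) < gbm δ σ (B · ω) a} with hA'
  have mA' : MeasurableSet[𝓕 a] A' :=
    hA.inter (hW.measurable_gbm δ σ a measurableSet_Ioi)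
  set e : ℝ → ℝ := fun y =>
    1 / ((n : ℝ) + 1) * Real.exp (-(δ + σ ^ 2 / 2) * ((b : ℝ) - a) + σ * y) with he
  have hlim : Tendsto e atTop atTop :=
    (Real.tendsto_exp_atTop.comp (tendsto_atTop_add_const_left _ _
      (tendsto_id.const_mul_atTop hσ))).const_mul_atTop (by positivity)
  obtain ⟨x, hx⟩ := (tendsto_atTop.1 hlim (M + 1)).exists_forall_of_atTop
  have hinc : P {ω | B b ω - B a ω ∈ Ioi x} ≠ 0 := by
    have hl := hW.isBrownian.toIsPreBrownianReal.hasLaw_sub b a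
    have h1 : gaussianReal 0 (nndist b.1 a.1) (Ioi x) ≠ 0 := by
      have hv : nndist b.1 a.1 ≠ 0 := by
        rw [ne_eq, nndist_eq_zero]
        exact fun h => hab.ne' (NNReal.coe_injective h)
      exact fun h => by simpa using gaussianReal_absolutelyContinuous' 0 hv h
    rw [← hl.map_eq, Measure.map_apply_of_aemeasurable hl.aemeasurable measurableSet_Ioi] at h1
    exact h1
  have hprod : P (A' ∩ {ω | B b ω - B a ω ∈ Ioi x}) ≠ 0 := by
    have := (Indep_iff _ _ P).1 (hW.indep a b hab.le) {ω | B b ω - B a ω ∈ Ioi x} A'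
      ⟨Ioi x, measurableSet_Ioi, rfl⟩ mA'
    rw [inter_comm, this]
    exact mul_ne_zero hinc hn
  refine fun h => hprod (measure_mono_null_ae ?_ h)
  filter_upwards [hW.isBrownian.cont] with ω hω hω'
  refine ⟨hω'.1.1, ?_⟩
  have h1 : gbm δ σ (B · ω) b = gbm δ σ (B · ω) a
      * Real.exp (-(δ + σ ^ 2 / 2) * ((b : ℝ) - a) + σ * (B b ω - B a ω)) := by
    simp only [gbm, pathEval_of_continuous hω, Real.toNNReal_coe, ← Real.exp_add]
    ring_nf
  have h2 : M + 1 ≤ e (B b ω - B a ω) := hx _ (le_of_lt hω'.2)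
  have h3 : e (B b ω - B a ω) ≤ gbm δ σ (B · ω) b := by
    rw [h1, he]
    exact mul_le_mul_of_nonneg_right (le_of_lt hω'.1.2) (Real.exp_pos _).le
  exact lt_of_lt_of_le (by linarith) (h2.trans h3)

variable [IsProbabilityMeasure P]

lemma integrable_wealth_add (hδ : 0 ≤ δ) (σ S I : ℝ) (s : ℝ≥0) (c : ℝ) :
    Integrable (fun ω => S * wealth δ σ 0 (B · ω) s + I - c) P :=
  (((integrable_wealth hW.isBrownian hW.measurable hδ σ s.coe_nonneg).const_mul S).add
    (integrable_const I)).sub (integrable_const c)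

lemma integrable_reward (hδ : 0 ≤ δ) (s : ℝ≥0) : Integrable (reward δ σ S I k B s) P :=
  (integrable_wealth_add hW hδ σ S I s (k s)).sup (integrable_const 0)

lemma setIntegral_wealth_add (hδ : 0 ≤ δ) (σ S I : ℝ) {a b : ℝ≥0} (hab : a ≤ b) (c : ℝ) {A : Set Ω}
    (hA : MeasurableSet[𝓕 a] A) :
    ∫ ω in A, (S * wealth δ σ 0 (B · ω) b + I - c) ∂P
      = ∫ ω in A, (S * wealth δ σ 0 (B · ω) a + I - c) ∂P := by
  have h : ∀ s : ℝ≥0, ∫ ω in A, (S * wealth δ σ 0 (B · ω) s + I - c) ∂P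
      = S * (∫ ω in A, wealth δ σ 0 (B · ω) s ∂P) + ∫ ω in A, (I - c) ∂P := fun s => by
    rw [← integral_const_mul, ← integral_add]
    · simp only [add_sub_assoc]
    · exact ((integrable_wealth hW.isBrownian hW.measurable hδ σ s.coe_nonneg).const_mul
        S).integrableOn
    · exact integrable_const _
  rw [h, h, setIntegral_wealth hW δ σ hab hA]

/-- The gain from waiting until `b` is at least the interest saved on the set where redemption at
`a` has a positive reward. -/
lemma setIntegral_reward_add_le (hδ : 0 ≤ δ) {a b : ℝ≥0} (hab : a ≤ b) {A : Set Ω}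
    (hA : MeasurableSet[𝓕 a] A) :
    (∫ ω in A, reward δ σ S I k B a ω ∂P)
      + (k a - k b) * P.real (A ∩ {ω | 0 < S * wealth δ σ 0 (B · ω) a + I - k a})
      ≤ ∫ ω in A, reward δ σ S I k B b ω ∂P := by
  set E := {ω | 0 < S * wealth δ σ 0 (B · ω) a + I - k a} with hE
  have mE : MeasurableSet[𝓕 a] E := measurableSet_exercise hW a (k a)
  have mD : MeasurableSet (A ∩ E) := 𝓕.le a _ (hA.inter mE)
  have h1 : ∫ ω in A, reward δ σ S I k B a ω ∂P
      = ∫ ω in A ∩ E, (S * wealth δ σ 0 (B · ω) a + I - k a) ∂P := by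
    rw [inter_comm, ← Measure.restrict_restrict (𝓕.le a _ mE),
      ← integral_indicator (𝓕.le a _ mE)]
    refine integral_congr_ae (ae_of_all _ fun ω => ?_)
    by_cases h : ω ∈ E
    · rw [indicator_of_mem h]
      exact max_eq_left (le_of_lt h)
    · rw [indicator_of_notMem h]
      exact max_eq_right (not_lt.1 h)
  have h2 : (k a - k b) * P.real (A ∩ E) = ∫ ω in A ∩ E, (k a - k b) ∂P := by
    rw [setIntegral_const, smul_eq_mul, mul_comm]
  have i1 := integrable_wealth_add hW hδ σ S I b
  -- On the exercise event the reward at `a` is linear in the wealth, so the martingale property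
  -- moves it to `b`.
  rw [h1, ← setIntegral_wealth_add hW hδ σ S I hab (k a) (hA.inter mE), h2,
    ← integral_add (i1 (k a)).integrableOn (integrable_const _)]
  calc _ ≤ ∫ ω in A ∩ E, reward δ σ S I k B b ω ∂P := by
        refine integral_mono ((i1 (k a)).integrableOn.add (integrable_const _))
          (integrable_reward hW hδ b).integrableOn fun ω => ?_
        refine le_trans (le_of_eq ?_) (le_max_left _ _)
        ring
    _ ≤ _ := setIntegral_mono_set (integrable_reward hW hδ b).integrableOn
        (ae_of_all _ fun ω => reward_nonneg b ω) (LE.le.eventuallyLE inter_subset_left)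

lemma setIntegral_reward_le (hδ : 0 ≤ δ) (hk : Antitone k) (a b : ℝ≥0) (hab : a ≤ b) (A : Set Ω)
    (hA : MeasurableSet[𝓕 a] A) :
    ∫ ω in A, reward δ σ S I k B a ω ∂P ≤ ∫ ω in A, reward δ σ S I k B b ω ∂P :=
  (le_add_of_nonneg_right (mul_nonneg (sub_nonneg.2 (hk hab)) measureReal_nonneg)).trans
    (setIntegral_reward_add_le hW hδ hab hA)

lemma setIntegral_reward_pos (hδ : 0 ≤ δ) (hσ : 0 < σ) (hS : 0 < S) (hI : 0 ≤ I)
    {a b : ℝ≥0} (hab : a < b) {A : Set Ω} (hA : MeasurableSet[𝓕 a] A) (h0 : P A ≠ 0) :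
    0 < ∫ ω in A, reward δ σ S I k B b ω ∂P := by
  rw [setIntegral_pos_iff_support_of_nonneg_ae (ae_of_all _ fun ω => reward_nonneg b ω)
    (integrable_reward hW hδ b).integrableOn, inter_comm, pos_iff_ne_zero]
  refine fun h => measure_inter_lt_gbm_ne_zero hW δ hσ hab hA h0 (k b / S)
    (measure_mono_null ?_ h)
  refine inter_subset_inter_right _ fun ω hω => ?_
  have h1 : k b / S < wealth δ σ 0 (B · ω) b :=
    lt_of_lt_of_le hω (gbm_le_wealth hδ _ b.coe_nonneg)
  rw [div_lt_iff₀ hS] at h1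
  exact (lt_max_of_lt_left (by linarith)).ne'

/-- Either the reward at `a` is positive on part of `A`, and the falling repayment is a gain, or it
vanishes almost surely there, and the chance of a high stock price at `b` is the gain. -/
lemma setIntegral_reward_lt (hδ : 0 ≤ δ) (hσ : 0 < σ) (hS : 0 < S) (hI : 0 ≤ I)
    (hk : StrictAnti k) {a b : ℝ≥0} (hab : a < b) {A : Set Ω} (hA : MeasurableSet[𝓕 a] A)
    (h0 : P A ≠ 0) :
    ∫ ω in A, reward δ σ S I k B a ω ∂P < ∫ ω in A, reward δ σ S I k B b ω ∂P := by
  set E := {ω | 0 < S * wealth δ σ 0 (B · ω) a + I - k a} with hE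
  have mE : MeasurableSet[𝓕 a] E := measurableSet_exercise hW a (k a)
  rcases eq_or_ne (P (A ∩ E)) 0 with h | h
  · refine lt_of_eq_of_lt ?_ (setIntegral_reward_pos hW hδ hσ hS hI hab hA h0)
    refine setIntegral_eq_zero_of_ae_eq_zero ?_
    have : ∀ᵐ ω ∂P, ω ∉ A ∩ E := measure_eq_zero_iff_ae_notMem.1 h
    filter_upwards [this] with ω hω hωA
    exact max_eq_right (not_lt.1 fun hE => hω ⟨hωA, hE⟩)
  · refine lt_of_lt_of_le ?_ (setIntegral_reward_add_le hW hδ hab.le hA)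
    refine lt_add_of_pos_right _ (mul_pos (sub_pos.2 (hk hab)) ?_)
    exact ENNReal.toReal_pos h (measure_ne_top _ _)

/-- Dropping the repayment only increases the reward and leaves a submartingale whatever the
monotonicity of `k`. This gives well-posedness for every loan rate. -/
lemma integrable_reward_stopped (hδ : 0 ≤ δ) (hk : Continuous k)
    (hk0 : ∀ s, 0 ≤ k s) {v : Ω → ℝ≥0} (hv : IsStoppingTime 𝓕 (fun ω => (v ω : WithTop ℝ≥0)))
    {b : ℝ≥0} (hb : ∀ ω, v ω ≤ b) :
    Integrable (fun ω => reward δ σ S I k B (v ω) ω) P ∧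
      ∫ ω, reward δ σ S I k B (v ω) ω ∂P ≤ ∫ ω, reward δ σ S I 0 B b ω ∂P := by
  obtain ⟨i0, h0⟩ := integrable_stopped_and_setIntegral_le (g := reward δ σ S I 0 B)
    (measurable_reward hW) reward_nonneg (integrable_reward hW hδ)
    (hW.isBrownian.cont.mono fun ω hω => continuous_reward continuous_const hω)
    (setIntegral_reward_le hW hδ antitone_const) hv hb
  have hle : ∀ ω, reward δ σ S I k B (v ω) ω ≤ reward δ σ S I 0 B (v ω) ω := fun ω =>
    max_le_max (sub_le_sub_left (hk0 _) _) le_rfl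
  have am : AEMeasurable (fun ω => reward δ σ S I k B (v ω) ω) P :=
    aemeasurable_stopped (measurable_reward hW)
      (hW.isBrownian.cont.mono fun ω hω => continuous_reward hk hω)
      (measurable_of_isStoppingTime hv) hb
  have ik : Integrable (fun ω => reward δ σ S I k B (v ω) ω) P :=
    i0.mono' am.aestronglyMeasurable (ae_of_all _ fun ω => by
      rw [Real.norm_of_nonneg (reward_nonneg _ _)]
      exact hle ω)
  refine ⟨ik, (integral_mono ik i0 hle).trans ?_⟩
  simpa using h0 0 (fun _ => zero_le) univ MeasurableSet.univ

lemma setIntegral_reward_stopped_le (hδ : 0 ≤ δ) (hk : Continuous k) (hk' : Antitone k)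
    {v : Ω → ℝ≥0} (hv : IsStoppingTime 𝓕 (fun ω => (v ω : WithTop ℝ≥0))) {a b : ℝ≥0}
    (ha : ∀ ω, a ≤ v ω) (hb : ∀ ω, v ω ≤ b) {C : Set Ω} (hC : MeasurableSet[𝓕 a] C) :
    ∫ ω in C, reward δ σ S I k B (v ω) ω ∂P ≤ ∫ ω in C, reward δ σ S I k B b ω ∂P :=
  (integrable_stopped_and_setIntegral_le (g := reward δ σ S I k B)
    (measurable_reward hW) reward_nonneg (integrable_reward hW hδ)
    (hW.isBrownian.cont.mono fun ω hω => continuous_reward hk hω)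
    (setIntegral_reward_le hW hδ hk') hv hb).2 a ha C hC

/-- Stopping early with positive probability loses value when the discounted repayment is strictly
decreasing. -/
lemma integral_reward_stopped_lt (hδ : 0 ≤ δ) (hσ : 0 < σ) (hS : 0 < S) (hI : 0 ≤ I)
    (hk : Continuous k) (hk' : StrictAnti k) (hk0 : ∀ s, 0 ≤ k s) {v : Ω → ℝ≥0}
    (hv : IsStoppingTime 𝓕 (fun ω => (v ω : WithTop ℝ≥0))) {b : ℝ≥0} (hb : ∀ ω, v ω ≤ b)
    (hne : P {ω | v ω < b} ≠ 0) :
    ∫ ω, reward δ σ S I k B (v ω) ω ∂P < ∫ ω, reward δ σ S I k B b ω ∂P := by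
  -- A deterministic time `q < b` is needed by which `v` has occurred with positive probability.
  obtain ⟨n, hn⟩ : ∃ n : ℕ, P {ω | v ω < b ∧ v ω ≤ b - 1 / ((n : ℝ≥0) + 1)} ≠ 0 := by
    by_contra! h
    refine hne (measure_mono_null (fun ω hω => ?_) (measure_iUnion_null h))
    have hω' : v ω < b := hω
    obtain ⟨n, hn⟩ := exists_nat_one_div_lt (tsub_pos_of_lt hω')
    exact mem_iUnion.2 ⟨n, hω', le_tsub_of_add_le_left (by
      rw [add_comm]; exact (le_tsub_iff_left hω'.le).1 hn.le)⟩
  set q : ℝ≥0 := b - 1 / ((n : ℝ≥0) + 1) with hq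
  set A : Set Ω := {ω | v ω ≤ q} with hA
  have hA0 : P A ≠ 0 := fun h => hn (measure_mono_null (fun ω hω => hω.2) h)
  have hqb : q < b := by
    obtain ⟨ω, hω⟩ := nonempty_of_measure_ne_zero hn
    exact tsub_lt_self (zero_le.trans_lt hω.1) (by positivity)
  have mA : MeasurableSet[𝓕 q] A := by
    have := hv.measurableSet_le q
    simp only [WithTop.coe_le_coe] at this
    exact this
  have mA' : MeasurableSet A := 𝓕.le q _ mA
  have hAc : ∀ ω ∈ Aᶜ, q ≤ v ω := fun ω hω => (not_le.1 (show ¬ v ω ≤ q from hω)).le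
  have iv := (integrable_reward_stopped (σ := σ) (S := S) (I := I) hW hδ hk hk0 hv hb).1
  have iq := integrable_reward (σ := σ) (S := S) (I := I) (k := k) hW hδ
  -- Optional stopping for `min v q` on the whole space; off `A` both sides of that inequality agree
  -- and cancel.
  have h1 : ∫ ω in A, reward δ σ S I k B (v ω) ω ∂P ≤ ∫ ω in A, reward δ σ S I k B q ω ∂P := by
    have hmin : IsStoppingTime 𝓕 (fun ω => ((min (v ω) q : ℝ≥0) : WithTop ℝ≥0)) := by
      simpa using hv.min_const q
    have j := (integrable_reward_stopped (σ := σ) (S := S) (I := I) hW hδ hk hk0 hmin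
      (fun ω => min_le_right _ _)).1
    have h := setIntegral_reward_stopped_le (σ := σ) (S := S) (I := I) hW hδ hk hk'.antitone hmin
      (a := 0) (fun ω => zero_le) (fun ω => min_le_right _ _) MeasurableSet.univ
    rw [setIntegral_univ, setIntegral_univ, ← integral_add_compl mA' j,
      ← integral_add_compl mA' (iq q)] at h
    have e1 : ∫ ω in A, reward δ σ S I k B (min (v ω) q) ω ∂P
        = ∫ ω in A, reward δ σ S I k B (v ω) ω ∂P :=
      setIntegral_congr_fun mA' fun ω hω => by
        rw [min_eq_left hω]
    have e2 : ∫ ω in Aᶜ, reward δ σ S I k B (min (v ω) q) ω ∂P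
        = ∫ ω in Aᶜ, reward δ σ S I k B q ω ∂P :=
      setIntegral_congr_fun mA'.compl fun ω hω => by
        rw [min_eq_right (hAc ω hω)]
    rw [e1, e2] at h
    linarith
  -- Off `A`, an event known at `q`, the time `v` equals `max v q`.
  have h2 : ∫ ω in Aᶜ, reward δ σ S I k B (v ω) ω ∂P ≤ ∫ ω in Aᶜ, reward δ σ S I k B b ω ∂P := by
    have hmax : IsStoppingTime 𝓕 (fun ω => ((max (v ω) q : ℝ≥0) : WithTop ℝ≥0)) := by
      simpa using hv.max_const q
    have h := setIntegral_reward_stopped_le (σ := σ) (S := S) (I := I) hW hδ hk hk'.antitone hmax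
      (a := q) (fun ω => le_max_right _ _) (fun ω => max_le (hb ω) hqb.le) mA.compl
    refine le_trans (le_of_eq (setIntegral_congr_fun mA'.compl fun ω hω => ?_)) h
    rw [max_eq_left (hAc ω hω)]
  have h3 := setIntegral_reward_lt hW hδ hσ hS hI hk' hqb mA hA0
  rw [← integral_add_compl mA' iv, ← integral_add_compl mA' (iq b)]
  linarith

end

end

/-! ### The chain rule, and the stock loan as a reward process. -/

section

/-- The chain rule for a function of two variables with continuous partial derivatives. -/
lemma hasDerivAt_comp_of_partial {f f₁ f₂ : ℝ → ℝ → ℝ} {c τ : ℝ → ℝ} {c' τ' t : ℝ}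
    (h₁ : ∀ᶠ p in 𝓝 (c t, τ t), HasDerivAt (fun x => f x p.2) (f₁ p.1 p.2) p.1)
    (h₂ : ∀ᶠ p in 𝓝 (c t, τ t), HasDerivAt (fun y => f p.1 y) (f₂ p.1 p.2) p.2)
    (hc₁ : ContinuousAt (fun p : ℝ × ℝ => f₁ p.1 p.2) (c t, τ t))
    (hc₂ : ContinuousAt (fun p : ℝ × ℝ => f₂ p.1 p.2) (c t, τ t))
    (hc : HasDerivAt c c' t) (hτ : HasDerivAt τ τ' t) :
    HasDerivAt (fun s => f (c s) (τ s)) (f₁ (c t) (τ t) * c' + f₂ (c t) (τ t) * τ') t := by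
  have hL : Continuous fun x : ℝ => ContinuousLinearMap.toSpanSingleton ℝ x :=
    (ContinuousLinearMap.toSpanSingletonCLE (𝕜 := ℝ) (E := ℝ)).continuous
  have h := hasStrictFDerivAt_uncurry_coprod (𝕜 := ℝ) (f := f) (u := (c t, τ t))
    (f₁ := fun x y => ContinuousLinearMap.toSpanSingleton ℝ (f₁ x y))
    (f₂ := fun x y => ContinuousLinearMap.toSpanSingleton ℝ (f₂ x y))
    (h₁.mono fun p hp => hp.hasFDerivAt) (h₂.mono fun p hp => hp.hasFDerivAt)
    (hL.continuousAt.comp hc₁) (hL.continuousAt.comp hc₂)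
  have h3 := h.hasFDerivAt.comp_hasDerivAt t (hc.prodMk hτ)
  refine h3.congr_deriv ?_
  simp [Function.HasUncurry.uncurry, mul_comm]

variable {Ω : Type*} {mΩ : MeasurableSpace Ω} {P : Measure Ω} {𝓕 : Filtration ℝ≥0 mΩ}
  {W : ℝ≥0 → Ω → ℝ} {L : StockLoan} {S I : ℝ}

/-! ### The stopping problem in terms of the reward process -/

/-- The repayment at the time `t + s`, discounted to the time `t`. -/
def repayment (L : StockLoan) (t s : ℝ) : ℝ := L.K * Real.exp (L.γ * (t + s) - L.r * s)

lemma continuous_repayment (t : ℝ) : Continuous fun s : ℝ≥0 => L.repayment t s := by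
  unfold repayment
  fun_prop

lemma repayment_nonneg (hK : 0 < L.K) (t s : ℝ) : 0 ≤ L.repayment t s :=
  mul_nonneg hK.le (Real.exp_pos _).le

lemma antitone_repayment (hK : 0 < L.K) (h : L.γ ≤ L.r) (t : ℝ) :
    Antitone fun s : ℝ≥0 => L.repayment t s := fun a b hab => by
  refine mul_le_mul_of_nonneg_left (Real.exp_le_exp.2 ?_) hK.le
  have : (a : ℝ) ≤ b := hab
  nlinarith [mul_nonneg (sub_nonneg.2 h) (sub_nonneg.2 this)]

lemma strictAnti_repayment (hK : 0 < L.K) (h : L.γ < L.r) (t : ℝ) :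
    StrictAnti fun s : ℝ≥0 => L.repayment t s := fun a b hab => by
  refine mul_lt_mul_of_pos_left (Real.exp_lt_exp.2 ?_) hK
  have : (a : ℝ) < b := hab
  nlinarith [mul_pos (sub_pos.2 h) (sub_pos.2 this)]

/-- The Brownian motion started afresh at the time `t`. -/
def restart (W : ℝ≥0 → Ω → ℝ) (t s : ℝ≥0) (ω : Ω) : ℝ := shiftPath t (W · ω) s

/-- The growth of the stock at rate `r` and the compounding of dividends at rate `r` both cancel
against the discount factor. Only the repayment keeps a net rate, `γ - r`. -/
lemma discountedPayoff_eq_reward (S I : ℝ) (t : ℝ≥0) {ω : Ω} (hω : Continuous (W · ω)) (s : ℝ≥0) :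
    L.discountedPayoff W S I t ((t + s : ℝ≥0) : ℝ) ω
      = reward L.δ L.σ S I (fun s => L.repayment t s) (restart W t) s ω := by
  have hr : Continuous (restart W t · ω) := continuous_shiftPath hω t
  have hst : ∀ w : ℝ, 0 ≤ w → L.stock W S t (w + t) ω
      = S * (Real.exp (L.r * w) * gbm L.δ L.σ (restart W t · ω) w) := fun w hw => by
    have hp : pathEval (restart W t · ω) w = W (t + w.toNNReal) ω - W t ω :=
      pathEval_of_continuous hr w
    rw [stock, gbm, hp, Real.toNNReal_add hw t.coe_nonneg, Real.toNNReal_coe, add_comm w.toNNReal, ← Real.exp_add]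
    ring_nf
  have hdiv : L.dividends W S I t ((t + s : ℝ≥0) : ℝ) ω = Real.exp (L.r * s)
      * (I + S * (L.δ * gbmInt L.δ L.σ 0 (restart W t · ω) s)) := by
    have e : ∫ w in (t : ℝ)..((t + s : ℝ≥0) : ℝ),
        L.δ * Real.exp (L.r * (((t + s : ℝ≥0) : ℝ) - w)) * L.stock W S t w ω
        = ∫ w in (0 : ℝ)..s, L.δ * Real.exp (L.r * (s - w)) * L.stock W S t (w + t) ω := by
      have := intervalIntegral.integral_comp_add_right (a := 0) (b := s) (fun w =>
        L.δ * Real.exp (L.r * (((t + s : ℝ≥0) : ℝ) - w)) * L.stock W S t w ω) (t : ℝ)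
      rw [zero_add, add_comm (s : ℝ), ← NNReal.coe_add] at this
      rw [← this]
      refine intervalIntegral.integral_congr fun w _ => ?_
      have h : ((t + s : ℝ≥0) : ℝ) - (w + t) = s - w := by push_cast; ring
      simp only [h]
    unfold dividends
    rw [e]
    have e2 : ∫ w in (0 : ℝ)..s, L.δ * Real.exp (L.r * (s - w)) * L.stock W S t (w + t) ω
        = ∫ w in (0 : ℝ)..s, Real.exp (L.r * s) * (S * L.δ)
          * (w ^ 0 * gbm L.δ L.σ (restart W t · ω) w) := by
      refine intervalIntegral.integral_congr fun w hw => ?_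
      rw [uIcc_of_le s.coe_nonneg] at hw
      simp only [hst w hw.1]
      have : Real.exp (L.r * (s - w)) * Real.exp (L.r * w) = Real.exp (L.r * s) := by
        rw [← Real.exp_add]
        ring_nf
      rw [← this]
      ring
    rw [e2, intervalIntegral.integral_const_mul, gbmInt]
    push_cast
    ring_nf
  have h1 := hst s s.coe_nonneg
  unfold discountedPayoff reward
  have h2 : ((t + s : ℝ≥0) : ℝ) = s + t := by push_cast; ring
  rw [hdiv, h2, h1]
  rw [mul_max_of_nonneg _ _ (Real.exp_pos _).le, mul_zero]
  congr 1
  have e1 : Real.exp (-L.r * ((s : ℝ) + t - t)) * Real.exp (L.r * s) = 1 := by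
    rw [← Real.exp_add]
    simp
  have e2 : Real.exp (-L.r * ((s : ℝ) + t - t)) * Real.exp (L.γ * (s + t))
      = Real.exp (L.γ * (t + s) - L.r * s) := by
    rw [← Real.exp_add]
    ring_nf
  simp only [wealth, repayment, ← e2, pow_zero, one_mul]
  linear_combination (S * gbm L.δ L.σ (restart W t · ω) s
    + (I + S * (L.δ * gbmInt L.δ L.σ 0 (restart W t · ω) s))) * e1

lemma isStoppingTime_sub {t : ℝ≥0} {v : Ω → ℝ≥0}
    (hv : IsStoppingTime 𝓕 (fun ω => (v ω : WithTop ℝ≥0))) :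
    IsStoppingTime (shiftFiltration 𝓕 t) (fun ω => ((v ω - t : ℝ≥0) : WithTop ℝ≥0)) := fun s => by
  have := hv.measurableSet_le (t + s)
  simp only [WithTop.coe_le_coe, tsub_le_iff_left] at this ⊢
  exact this

lemma isRedemptionTime_maturity (hT : 0 < L.T) {t : ℝ} (ht : t ≤ L.T) :
    L.IsRedemptionTime 𝓕 t (fun _ => L.T.toNNReal) :=
  ⟨isStoppingTime_const 𝓕 _, fun _ => by rw [Real.coe_toNNReal _ hT.le]; exact ⟨ht, le_rfl⟩⟩

variable (hW : IsBrownianWrt W 𝓕 P)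

include hW

lemma discountedPayoff_ae_eq (S I : ℝ) {t : ℝ≥0} {v : Ω → ℝ≥0} (hv : ∀ ω, t ≤ v ω) :
    (fun ω => L.discountedPayoff W S I t (v ω) ω) =ᵐ[P]
      fun ω => reward L.δ L.σ S I (fun s => L.repayment t s) (restart W t) (v ω - t) ω := by
  filter_upwards [hW.isBrownian.cont] with ω hω
  rw [← discountedPayoff_eq_reward S I t hω, add_tsub_cancel_of_le (hv ω)]

lemma isBrownianWrt_restart (t : ℝ≥0) :
    IsBrownianWrt (restart W t) (shiftFiltration 𝓕 t) P := hW.shift t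

lemma expectedPayoff_maturity (S I : ℝ) {t : ℝ≥0} (ht : t ≤ L.T) :
    L.expectedPayoff P W S I t (fun _ => L.T.toNNReal)
      = ∫ ω, reward L.δ L.σ S I (fun s => L.repayment t s) (restart W t)
          (L.T.toNNReal - t) ω ∂P := by
  rw [expectedPayoff, integral_congr_ae (discountedPayoff_ae_eq hW S I fun _ =>
    NNReal.le_toNNReal_of_coe_le ht)]

variable [IsProbabilityMeasure P]

/-- The payoff of a redemption time is integrable, with a bound that does not depend on it. -/
lemma integrable_discountedPayoff (hδ : 0 ≤ L.δ) (hK : 0 < L.K) (S I : ℝ) {t : ℝ≥0}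
    {v : Ω → ℝ≥0} (hv : L.IsRedemptionTime 𝓕 t v) :
    Integrable (fun ω => L.discountedPayoff W S I t (v ω) ω) P ∧
      L.expectedPayoff P W S I t v
        ≤ ∫ ω, reward L.δ L.σ S I 0 (restart W t) (L.T.toNNReal - t) ω ∂P := by
  have ht : ∀ ω, t ≤ v ω := fun ω => by exact_mod_cast (hv.2 ω).1
  have h := integrable_reward_stopped (σ := L.σ) (S := S) (I := I) (isBrownianWrt_restart hW t) hδ
    (continuous_repayment (L := L) t) (fun s => repayment_nonneg hK t s)
    (isStoppingTime_sub hv.1) (b := L.T.toNNReal - t)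
    (fun ω => tsub_le_tsub_right (NNReal.le_toNNReal_of_coe_le (hv.2 ω).2) t)
  have e := discountedPayoff_ae_eq (L := L) hW S I ht
  refine ⟨h.1.congr e.symm, ?_⟩
  rw [expectedPayoff, integral_congr_ae e]
  exact h.2

lemma isOptimal_maturity (hδ : 0 ≤ L.δ) (hK : 0 < L.K) (hT : 0 < L.T) (h : L.γ ≤ L.r) (S I : ℝ)
    {t : ℝ} (ht0 : 0 ≤ t) (ht : t ≤ L.T) : L.IsOptimal P 𝓕 W S I t (fun _ => L.T.toNNReal) := by
  lift t to ℝ≥0 using ht0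
  refine ⟨isRedemptionTime_maturity hT ht, ⟨_, isRedemptionTime_maturity hT ht, rfl⟩, ?_⟩
  rintro x ⟨v, hv, rfl⟩
  have htv : ∀ ω, t ≤ v ω := fun ω => by exact_mod_cast (hv.2 ω).1
  rw [expectedPayoff_maturity hW S I ht, expectedPayoff,
    integral_congr_ae (discountedPayoff_ae_eq hW S I htv)]
  have := setIntegral_reward_stopped_le (σ := L.σ) (S := S) (I := I) (isBrownianWrt_restart hW t) hδ
    (continuous_repayment (L := L) t) (antitone_repayment hK h t) (isStoppingTime_sub hv.1) (a := 0)
    (b := L.T.toNNReal - t) (fun _ => zero_le)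
    (fun ω => tsub_le_tsub_right (NNReal.le_toNNReal_of_coe_le (hv.2 ω).2) t) MeasurableSet.univ
  simpa using this

lemma value_eq_expectedPayoff (hδ : 0 ≤ L.δ) (hK : 0 < L.K) (hT : 0 < L.T) (h : L.γ ≤ L.r) (S I : ℝ)
    {t : ℝ} (ht0 : 0 ≤ t) (ht : t ≤ L.T) :
    L.value P 𝓕 W S I t = L.expectedPayoff P W S I t (fun _ => L.T.toNNReal) :=
  (isOptimal_maturity hW hδ hK hT h S I ht0 ht).2.csSup_eq

lemma expectedPayoff_lt_value (hδ : 0 ≤ L.δ) (hσ : 0 < L.σ) (hK : 0 < L.K) (hT : 0 < L.T)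
    (h : L.γ < L.r) (hS : 0 < S) (hI : 0 ≤ I) {t : ℝ} (ht0 : 0 ≤ t) (ht : t ≤ L.T) {v : Ω → ℝ≥0}
    (hv : L.IsRedemptionTime 𝓕 t v) (hne : P {ω | (v ω : ℝ) < L.T} ≠ 0) :
    L.expectedPayoff P W S I t v < L.value P 𝓕 W S I t := by
  rw [value_eq_expectedPayoff hW hδ hK hT h.le S I ht0 ht]
  lift t to ℝ≥0 using ht0
  have htv : ∀ ω, t ≤ v ω := fun ω => by exact_mod_cast (hv.2 ω).1
  rw [expectedPayoff_maturity hW S I ht, expectedPayoff,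
    integral_congr_ae (discountedPayoff_ae_eq hW S I htv)]
  refine integral_reward_stopped_lt (isBrownianWrt_restart hW t) hδ hσ hS hI
    (continuous_repayment (L := L) t) (strictAnti_repayment hK h t)
    (fun s => repayment_nonneg hK t s) (isStoppingTime_sub hv.1)
    (fun ω => tsub_le_tsub_right (NNReal.le_toNNReal_of_coe_le (hv.2 ω).2) t) fun h0 => hne ?_
  refine measure_mono_null (fun ω hω => ?_) h0
  exact tsub_lt_tsub_right_of_le (htv ω) (Real.lt_toNNReal_iff_coe_lt.2 hω)

/-- Redeeming at once pays at least `S + I - K exp (γ t)`, and is strictly worse than the value. -/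
lemma redemptionRegion_eq_empty (hδ : 0 ≤ L.δ) (hσ : 0 < L.σ) (hK : 0 < L.K) (hT : 0 < L.T)
    (h : L.γ < L.r) : L.redemptionRegion P 𝓕 W = ∅ := by
  refine eq_empty_of_forall_notMem ?_
  rintro ⟨S, I, t⟩ ⟨⟨hS, hI, ht0, ht⟩, hV⟩
  simp only [mem_Ioi] at hS hI ht0 ht hV
  lift t to ℝ≥0 using ht0
  have hr : L.IsRedemptionTime 𝓕 t (fun _ => t) :=
    ⟨isStoppingTime_const 𝓕 _, fun _ => ⟨le_rfl, ht.le⟩⟩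
  have := expectedPayoff_lt_value hW hδ hσ hK hT h hS hI.le t.coe_nonneg ht.le hr (by simp [ht])
  rw [hV] at this
  refine this.not_ge ?_
  simp [expectedPayoff, discountedPayoff, stock, dividends]

/-! ### The value function -/

/-- The repayment at maturity, discounted to the time `t`. -/
def finalRepayment (L : StockLoan) (t : ℝ) : ℝ := L.K * Real.exp (L.γ * L.T - L.r * (L.T - t))

/-- The restarted Brownian motion has the law of `W`, so one fixed process represents the value for
all `t` and the time enters only through the arguments. -/
lemma value_eq_callValue (hδ : 0 ≤ L.δ) (hK : 0 < L.K) (hT : 0 < L.T) (h : L.γ ≤ L.r) (S I : ℝ)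
    {t : ℝ} (ht0 : 0 ≤ t) (ht : t ≤ L.T) :
    L.value P 𝓕 W S I t = callValue P W L.δ L.σ S (I - L.finalRepayment t) (L.T - t) := by
  rw [value_eq_expectedPayoff hW hδ hK hT h S I ht0 ht]
  lift t to ℝ≥0 using ht0
  have htT : t ≤ L.T.toNNReal := NNReal.le_toNNReal_of_coe_le ht
  have e : ((L.T.toNNReal - t : ℝ≥0) : ℝ) = L.T - t := by
    rw [NNReal.coe_sub htT, Real.coe_toNNReal _ hT.le]
  rw [expectedPayoff_maturity hW S I ht]
  unfold reward callValue
  have hk : L.repayment t (L.T - t) = L.finalRepayment t := by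
    rw [repayment, finalRepayment, add_sub_cancel]
  simp only [e, hk, add_sub_assoc]
  have mw := measurable_wealth L.δ L.σ 0 (L.T - t)
  exact integral_path_eq (isBrownianWrt_restart hW t).isBrownian.toIsPreBrownianReal
    hW.isBrownian.toIsPreBrownianReal (isBrownianWrt_restart hW t).measurable hW.measurable
    (Φ := fun f => max (S * wealth L.δ L.σ 0 f (L.T - t) + (I - L.finalRepayment t)) 0)
    (by fun_prop)

end

/-! ### The differential equation. -/

section

variable {Ω : Type*} {mΩ : MeasurableSpace Ω} {P : Measure Ω} {𝓕 : Filtration ℝ≥0 mΩ}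
  {W : ℝ≥0 → Ω → ℝ} {L : StockLoan}

lemma hasDerivAt_finalRepayment (L : StockLoan) (t : ℝ) :
    HasDerivAt L.finalRepayment (L.r * L.finalRepayment t) t := by
  have h := (((((hasDerivAt_id t).const_sub L.T).const_mul L.r).const_sub (L.γ * L.T)).exp).const_mul
    L.K
  refine h.congr_deriv ?_
  simp only [finalRepayment, id]
  ring

lemma continuous_finalRepayment (L : StockLoan) : Continuous L.finalRepayment := by
  unfold finalRepayment
  fun_prop

/-- The point at which `callValue` is evaluated for the state `(S, I)` at the time `t`. -/
def callPoint (L : StockLoan) (p : ℝ × ℝ × ℝ) : ℝ × ℝ × ℝ :=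
  (p.1, p.2.1 - L.finalRepayment p.2.2, L.T - p.2.2)

lemma continuous_callPoint (L : StockLoan) : Continuous L.callPoint := by
  have := L.continuous_finalRepayment
  unfold callPoint
  fun_prop

lemma mapsTo_callPoint (L : StockLoan) {Θ : ℝ} (hΘ : L.T ≤ Θ) :
    MapsTo L.callPoint L.domain (smoothRegion Θ) := by
  rintro ⟨S, I, t⟩ ⟨hS, hI, ht0, ht⟩
  exact ⟨hS, trivial, sub_pos.2 ht, (sub_le_self _ ht0).trans hΘ⟩

section

variable [IsProbabilityMeasure P] {B : ℝ≥0 → Ω → ℝ} {δ σ : ℝ} (hB : IsBrownianReal B P)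
  (hm : ∀ t, Measurable (B t)) (hδ : 0 ≤ δ) (hσ : 0 < σ)

include hB hm hδ hσ

lemma hasDerivAt_callValue_comp {S : ℝ} (hS : 0 < S) {Θ : ℝ≥0} {c τ : ℝ → ℝ} {c' τ' t : ℝ}
    (hc : HasDerivAt c c' t) (hτ : HasDerivAt τ τ' t) (h0 : 0 < τ t) (hΘ : τ t < Θ) :
    HasDerivAt (fun u => callValue P B δ σ S (c u) (τ u))
      (callProb P B δ σ S (c t) (τ t) * c' + callTheta P B δ σ Θ S (c t) (τ t) * τ') t := by
  have hnhds : ∀ᶠ p in 𝓝 (c t, τ t), p.2 ∈ Ioo (0 : ℝ) Θ :=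
    continuous_snd.continuousAt.eventually (Ioo_mem_nhds h0 hΘ)
  have hmap : ∀ {f : ℝ × ℝ × ℝ → ℝ}, ContinuousOn f (smoothRegion Θ) →
      ContinuousAt (fun p : ℝ × ℝ => f (S, p.1, p.2)) (c t, τ t) := fun {f} hf => by
    have h : ContinuousOn (fun p : ℝ × ℝ => f (S, p.1, p.2)) {p | p.2 ∈ Ioo (0 : ℝ) Θ} :=
      hf.comp (f := fun p : ℝ × ℝ => (S, p.1, p.2)) (by fun_prop)
        fun p hp => ⟨hS, trivial, hp.1, hp.2.le⟩
    exact h.continuousAt hnhds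
  exact hasDerivAt_comp_of_partial (f := fun x y => callValue P B δ σ S x y)
    (f₁ := fun x y => callProb P B δ σ S x y) (f₂ := fun x y => callTheta P B δ σ Θ S x y)
    (hnhds.mono fun p hp => hasDerivAt_callValue_right hB hm hδ hσ hS p.1 hp.1)
    (hnhds.mono fun p hp => hasDerivAt_callValue_time hB hm hδ hσ hS p.1 hp.1 hp.2)
    (hmap (continuousOn_callProb hB hm hδ hσ Θ)) (hmap (continuousOn_callTheta hB hm hδ hσ Θ))
    hc hτ

end

lemma callValue_zero [IsProbabilityMeasure P] {B : ℝ≥0 → Ω → ℝ} (hB : IsBrownianReal B P)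
    (δ σ S c : ℝ) : callValue P B δ σ S c 0 = max (S + c) 0 := by
  have h : ∀ᵐ ω ∂P, max (S * wealth δ σ 0 (B · ω) 0 + c) 0 = max (S + c) 0 := by
    filter_upwards [hB.cont, hB.eval_zero_ae_eq_zero] with ω hω h0
    rw [wealth_at_zero, gbm_at_zero hω h0, mul_one]
  rw [callValue, integral_congr_ae h]
  simp

/-- Along `c = I - finalRepayment t`, `τ = T - t` the chain rule gives the time derivative. The
second order terms and those with a factor `δ` cancel, leaving `r (u - S u_S - c u_c)`, which is
zero by `callValue_eq_add`. -/
lemma solvesLinearProblem_value [IsProbabilityMeasure P] (hW : IsBrownianWrt W 𝓕 P)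
    (hδ : 0 ≤ L.δ) (hσ : 0 < L.σ) (hK : 0 < L.K) (hT : 0 < L.T) (h : L.γ ≤ L.r) :
    L.SolvesLinearProblem (L.value P 𝓕 W) := by
  have hB := hW.isBrownian
  have hm := hW.measurable
  have hV : ∀ (S I : ℝ) {t : ℝ}, 0 ≤ t → t ≤ L.T → L.value P 𝓕 W S I t
      = callValue P W L.δ L.σ S (I - L.finalRepayment t) (L.T - t) := fun S I t h0 h1 =>
    value_eq_callValue hW hδ hK hT h S I h0 h1
  -- A horizon beyond `T` makes even `τ = T`, that is `t = 0`, an interior time.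
  obtain ⟨Θ, hΘT⟩ : ∃ Θ : ℝ≥0, L.T < Θ := by
    refine ⟨(L.T + 1).toNNReal, ?_⟩
    rw [Real.coe_toNNReal _ (by linarith)]
    linarith
  have hmap := L.mapsTo_callPoint hΘT.le
  have hcp := L.continuous_callPoint.continuousOn (s := L.domain)
  have hcomp : ∀ {f : ℝ × ℝ × ℝ → ℝ}, ContinuousOn f (smoothRegion Θ) →
      ContinuousOn (fun p : ℝ × ℝ × ℝ => f (p.1, p.2.1 - L.finalRepayment p.2.2, L.T - p.2.2))
        L.domain := fun hf => hf.comp hcp hmap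
  have cP := hcomp (continuousOn_callProb hB hm hδ hσ Θ)
  have cT := hcomp (continuousOn_callTheta hB hm hδ hσ Θ)
  have cD := hcomp (continuousOn_callDelta hB hm hδ hσ Θ)
  have cG := hcomp (continuousOn_callGamma hB hm hδ hσ Θ)
  have hk := L.continuous_finalRepayment
  have ck : Continuous fun p : ℝ × ℝ × ℝ => L.r * L.finalRepayment p.2.2 := by fun_prop
  refine ⟨?_, ⟨_, _, _, _, (ck.continuousOn.mul cP).neg.sub cT, cD, cG, cP, ?_⟩, ?_⟩
  · have := (continuousOn_callValue hB hm hδ L.σ Θ).comp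
      (L.continuous_callPoint.continuousOn (s := Ioi 0 ×ˢ Ioi 0 ×ˢ Icc 0 L.T))
      (fun p hp => ⟨trivial, trivial, sub_nonneg.2 hp.2.2.2,
        (sub_le_self _ hp.2.2.1).trans hΘT.le⟩)
    exact this.congr fun p hp => hV p.1 p.2.1 hp.2.2.1 hp.2.2.2
  · rintro S I t ⟨hS, hI, ht0, ht⟩
    simp only [mem_Ioi] at hS hI ht0 ht
    have hτ : 0 < L.T - t := sub_pos.2 ht
    have hτΘ : L.T - t < Θ := (sub_le_self _ ht0).trans_lt hΘT
    refine ⟨?_, ?_, ?_, ?_, ?_⟩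
    · have hd := hasDerivAt_callValue_comp hB hm hδ hσ hS (Θ := Θ)
        ((L.hasDerivAt_finalRepayment t).const_sub I) ((hasDerivAt_id t).const_sub L.T) hτ hτΘ
      refine ((hd.congr_deriv ?_).hasDerivWithinAt (s := Ico 0 L.T)).congr
        (fun u hu => hV S I hu.1 hu.2.le) (hV S I ht0 ht.le)
      simp only [id, Pi.sub_apply, Pi.neg_apply, Pi.mul_apply]
      ring
    · simp only [fun s => hV s I ht0 ht.le]
      exact hasDerivAt_callValue_left hB hm hδ hσ hS _ hτ
    · dsimp only
      exact hasDerivAt_callDelta hB hm hδ hσ hS _ hτ hτΘ.le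
    · simp only [fun i => hV S i ht0 ht.le]
      exact (hasDerivAt_callValue_right hB hm hδ hσ hS _ hτ).comp_sub_const I _
    · rw [hV S I ht0 ht.le, callValue_eq_add hB hm hδ L.σ S _ hτ.le]
      simp only [callTheta, Pi.sub_apply, Pi.neg_apply, Pi.mul_apply]
      ring
  · intro S I _ _
    rw [hV S I hT.le le_rfl, sub_self, callValue_zero hB, finalRepayment]
    simp [add_sub_assoc]

end

end StockLoan

end

theorem proposition5p2 {Ω : Type*} {mΩ : MeasurableSpace Ω} (P : Measure Ω)
    [IsProbabilityMeasure P] (𝓕 : Filtration ℝ≥0 mΩ) (W : ℝ≥0 → Ω → ℝ)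
    (hW : IsBrownianWrt W 𝓕 P) (L : StockLoan)
    (hr : 0 < L.r) (hδ : 0 < L.δ) (hσ : 0 < L.σ) (hK : 0 < L.K) (hT : 0 < L.T) :
    -- the optimal stopping problem is well posed
    (∀ S I t : ℝ, 0 < S → 0 ≤ I → 0 ≤ t → t ≤ L.T →
      (∀ v : Ω → ℝ≥0, L.IsRedemptionTime 𝓕 t v →
        Integrable (fun ω => L.discountedPayoff W S I t (v ω) ω) P) ∧
      BddAbove (L.achievable P 𝓕 W S I t)) ∧
    -- if `r > γ`, early redemption is never optimal, and holding to maturity is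
    (L.γ < L.r →
      L.redemptionRegion P 𝓕 W = ∅ ∧
      ∀ S I t : ℝ, 0 < S → 0 ≤ I → 0 ≤ t → t < L.T →
        L.IsOptimal P 𝓕 W S I t (fun _ => L.T.toNNReal) ∧
        ∀ v : Ω → ℝ≥0, L.IsRedemptionTime 𝓕 t v → P {ω | (v ω : ℝ) < L.T} ≠ 0 →
          L.expectedPayoff P W S I t v < L.value P 𝓕 W S I t) ∧
    -- if `r = γ`, holding to maturity is optimal
    (L.r = L.γ →
      ∀ S I t : ℝ, 0 < S → 0 ≤ I → 0 ≤ t → t < L.T →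
        L.IsOptimal P 𝓕 W S I t (fun _ => L.T.toNNReal)) ∧
    -- in both cases the value function solves the linear problem
    (L.γ ≤ L.r → L.SolvesLinearProblem (L.value P 𝓕 W)) := by
  refine ⟨fun S I t _ _ ht0 _ => ?_, fun h => ⟨?_, fun S I t hS hI ht0 ht => ⟨?_, fun v hv hne => ?_⟩⟩,
    fun h S I t _ _ ht0 ht => ?_, fun h => ?_⟩
  · lift t to ℝ≥0 using ht0
    refine ⟨fun v hv => (StockLoan.integrable_discountedPayoff hW hδ.le hK S I hv).1,
      ∫ ω, StockLoan.reward L.δ L.σ S I 0 (StockLoan.restart W t) (L.T.toNNReal - t) ω ∂P, ?_⟩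
    rintro x ⟨v, hv, rfl⟩
    exact (StockLoan.integrable_discountedPayoff hW hδ.le hK S I hv).2
  · exact StockLoan.redemptionRegion_eq_empty hW hδ.le hσ hK hT h
  · exact StockLoan.isOptimal_maturity hW hδ.le hK hT h.le S I ht0 ht.le
  · exact StockLoan.expectedPayoff_lt_value hW hδ.le hσ hK hT h hS hI ht0 ht.le hv hne
  · exact StockLoan.isOptimal_maturity hW hδ.le hK hT h.ge S I ht0 ht.le
  · exact StockLoan.solvesLinearProblem_value hW hδ.le hσ hK hT h
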